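/- **Setting.** Let $G$ be a finite group. Mackey functors are $G$-Mackey functors with values in abelian groups, $\boxtimes$ is their box product, and a Green functor is a (unital, associative) monoid for $\boxtimes$. Equivalently, a Green functor has values that are rings, restrictions that are ring homomorphisms, and transfers satisfying Frobenius reciprocity. For a Green functor $S$, the free $S$-module on a generator at level $U$ (a finite $G$-set) is $X\mapsto S(U\times X)$, and an $S$-module is *projective* if it is a direct summand of a direct sum of such modules. Exactness is levelwise. $\underline{\mathrm{Tor}}{}^S_n(M,N)$ is the Mackey functor $H_n(M\boxtimes_S P)$, where $M$ is a right $S$-module and $P\to N$ is any projective resolution of the left $S$-module $N$. Let $K$ be a commutative Green functor and let $R$ be an augmented $K$-algebra (associative; commutativity of $R$ is not needed). This means $R$ is a Green functor with a central map of Green functors $\eta:K\to R$ and a map of Green functors $\varepsilon:R\to K$ such that $\varepsilon\eta=\mathrm{id}_K$. Let $I=\ker\varepsilon$. Let $R^e=R\boxtimes_K R^{op}$, which acts on $R$ from the left by $(a\otimes b)\,r=arb$. Let $\rho:R^e\to R$, $a\otimes b\mapsto ab$, and $J=\ker\rho$. Let $E:R\to R^e$ be a map of Green functors with $\rho E=\eta\varepsilon$,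 and let $R^e_E$ be $R^e$ regarded as a right $R$-module via $E$. An $R$-bimodule $M$ is a Mackey functor with commuting left and right $R$-module structures that induce the same $K$-module structure via $\eta$. It is a right $R^e$-module by $m\,(a\otimes b)=b\,m\,a$, and $M_E$ denotes this module regarded as a right $R$-module via $E$. The ring $R$ acts on $K$ via $\varepsilon$. Let $$g:\ R^e_E\boxtimes_R K\to R,\qquad s\otimes x\mapsto s\,\eta(x),$$ which is a map of left $R^e$-modules. Given an $R$-projective resolution $F\to K$, an $R^e$-projective resolution $Q\to R$, and a chain map of $R^e$-modules $\tilde g:R^e_E\boxtimes_R F\to Q$ over $g$, the comparison map $$F^E:\ \underline{\mathrm{Tor}}{}^R_n(M_E,K)\to\underline{\mathrm{Tor}}{}^{R^e}_n(M,R)$$ is the map on homology induced by $M_E\boxtimes_R F\to M\boxtimes_{R^e}(R^e_E\boxtimes_R F)\to M\boxtimes_{R^e}Q$. Here the first map is $m\otimes x\mapsto m\otimes(1\otimes x)$ and the second is induced by $\tilde g$. **Theorem.** Assume * (E.1) $J=R^e\cdot E(I)$, that is, $J$ is the image of the map $R^e_E\boxtimes_R I\to R^e$, $s\otimes i\mapsto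 s\,E(i)$; * (E.2) $R^e_E$ is projective as a right $R$-module. Then: 1. $K$ has an $R$-projective resolution, and for every $R$-projective resolution $F\to K$ the complex $R^e_E\boxtimes_R F$, with the augmentation $R^e_E\boxtimes_R F\to R^e_E\boxtimes_R K\xrightarrow{\,g\,}R$, is an $R^e$-projective resolution of $R$. 2. For every $R$-bimodule $M$, every $R$-projective resolution $F\to K$ and every $R^e$-projective resolution $Q\to R$, a chain map $\tilde g:R^e_E\boxtimes_R F\to Q$ over $g$ exists. For every such $\tilde g$ and every $n\ge 0$, the comparison map $F^E:\underline{\mathrm{Tor}}{}^R_n(M_E,K)\to\underline{\mathrm{Tor}}{}^{R^e}_n(M,R)$ is an isomorphism of Mackey functors. -/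

import Mathlib

set_option linter.unusedSectionVars false

open CategoryTheory CategoryTheory.Limits

universe u

/-! ## Finite `G`-sets -/

/-- The category of finite `G`-sets and equivariant maps, on the small model whose underlying
sets are the standard finite sets. Every finite `G`-set is isomorphic to one of these. -/
abbrev FinGSet (G : Type u) [Group G] : Type u := Action FintypeCat.Skeleton.{u} G

namespace FinGSet

/-- The underlying-set functor. -/
noncomputable abbrev toType (G : Type u) [Group G] : FinGSet G ⥤ Type u :=
  Action.forget _ G ⋙ FintypeCat.Skeleton.incl ⋙ FintypeCat.incl

instance : HasFiniteLimits FintypeCat.Skeleton.{u} where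
  out _ _ _ := Adjunction.hasLimitsOfShape_of_equivalence FintypeCat.Skeleton.incl

instance : HasFiniteColimits FintypeCat.Skeleton.{u} where
  out _ _ _ := Adjunction.hasColimitsOfShape_of_equivalence FintypeCat.Skeleton.incl

instance (G : Type u) [Group G] : (toType G).ReflectsIsomorphisms := by
  have h1 : (Action.forget FintypeCat.Skeleton.{u} G).ReflectsIsomorphisms :=
    ⟨fun f hf => @Action.isIso_of_hom_isIso _ _ _ _ _ _ f hf⟩
  have h2 : (FintypeCat.Skeleton.incl.{u} ⋙ FintypeCat.incl).ReflectsIsomorphisms :=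
    inferInstance
  exact reflectsIsomorphisms_comp _ _

instance (G : Type u) [Group G] : FinitaryExtensive (FinGSet G) :=
  finitaryExtensive_of_preserves_and_reflects_isomorphism (toType G)

end FinGSet

namespace Mackey

section Axioms

variable {C : Type u} [Category.{u} C]

/-- The axioms of a Mackey functor: restrictions are contravariantly functorial, transfers are
covariantly functorial, the double coset (base change) formula holds for every pullback square,
and finite coproducts are sent to products. -/
structure IsMackey (obj : C → Type u) [∀ X, AddCommGroup (obj X)]
    (res : ∀ {X Y : C}, (X ⟶ Y) → obj Y →+ obj X)
    (tr : ∀ {X Y : C}, (X ⟶ Y) → obj X →+ obj Y) : Prop where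
  res_id : ∀ {X : C} (x : obj X), res (𝟙 X) x = x
  res_comp : ∀ {X Y Z : C} (f : X ⟶ Y) (g : Y ⟶ Z) (z : obj Z), res (f ≫ g) z = res f (res g z)
  tr_id : ∀ {X : C} (x : obj X), tr (𝟙 X) x = x
  tr_comp : ∀ {X Y Z : C} (f : X ⟶ Y) (g : Y ⟶ Z) (x : obj X), tr (f ≫ g) x = tr g (tr f x)
  base_change : ∀ {P X Y Z : C} {p : P ⟶ X} {q : P ⟶ Y} {f : X ⟶ Z} {g : Y ⟶ Z},
    IsPullback p q f g → ∀ x : obj X, res g (tr f x) = tr q (res p x)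
  subsingleton_of_isInitial : ∀ {X : C}, Nonempty (IsInitial X) → Subsingleton (obj X)
  bijective_of_isCoprod : ∀ {X Y Z : C} (i : X ⟶ Z) (j : Y ⟶ Z),
    Nonempty (IsColimit (BinaryCofan.mk i j)) →
      Function.Bijective (fun z : obj Z => (res i z, res j z))

theorem isPullback_prod_map_snd [HasFiniteLimits C] (U : C) {X Y : C} (g : X ⟶ Y) :
    IsPullback (prod.map (𝟙 U) g) prod.snd prod.snd g := by
  have key : ∀ {T : C} (a : T ⟶ U ⨯ Y) (b : T ⟶ X), a ≫ prod.snd = b ≫ g →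
      prod.lift (a ≫ prod.fst) b ≫ prod.map (𝟙 U) g = a := by
    intro T a b h
    ext
    · rw [Category.assoc, prod.map_fst, Category.comp_id, prod.lift_fst]
    · rw [Category.assoc, prod.map_snd, prod.lift_snd_assoc, h]
  refine ⟨⟨by simp⟩, ⟨PullbackCone.IsLimit.mk _ (fun s => prod.lift (s.fst ≫ prod.fst) s.snd)
    (fun s => key _ _ s.condition) (fun s => prod.lift_snd _ _) (fun s m h1 h2 => ?_)⟩⟩
  have key2 : ∀ {T : C} (m : T ⟶ U ⨯ X) (a : T ⟶ U ⨯ Y) (b : T ⟶ X), m ≫ prod.map (𝟙 U) g = a →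
      m ≫ prod.snd = b → m = prod.lift (a ≫ prod.fst) b := by
    rintro T m _ _ rfl rfl
    ext
    · rw [prod.lift_fst, Category.assoc, prod.map_fst, Category.comp_id]
    · rw [prod.lift_snd]
  exact key2 m _ _ h1 h2

theorem isPullback_prod_map [HasFiniteLimits C] (U : C) {P X Y Z : C} {p : P ⟶ X} {q : P ⟶ Y}
    {f : X ⟶ Z} {g : Y ⟶ Z} (h : IsPullback p q f g) :
    IsPullback (prod.map (𝟙 U) p) (prod.map (𝟙 U) q) (prod.map (𝟙 U) f) (prod.map (𝟙 U) g) := by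
  have h1 : IsPullback (prod.map (𝟙 U) p) (prod.snd ≫ q) (prod.snd ≫ f) g :=
    (isPullback_prod_map_snd U p).paste_vert h
  have h2 := isPullback_prod_map_snd U g
  exact IsPullback.of_bot (by simpa using h1) (by simp [h.w]) h2

section

variable [FinitaryExtensive C]

theorem isCoprod_pullback {X Y Z W P Q : C} {i : X ⟶ Z} {j : Y ⟶ Z}
    (h : Nonempty (IsColimit (BinaryCofan.mk i j))) {f : W ⟶ Z}
    {p : P ⟶ W} {p' : P ⟶ X} (hp : IsPullback p p' f i)
    {q : Q ⟶ W} {q' : Q ⟶ Y} (hq : IsPullback q q' f j) :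
    Nonempty (IsColimit (BinaryCofan.mk p q)) := by
  obtain ⟨h⟩ := h
  have := (BinaryCofan.isVanKampen_iff _).1 (FinitaryExtensive.vanKampen _ h)
    (BinaryCofan.mk p q) p' q' f hp.w.symm hq.w.symm
  exact this.2 ⟨hp, hq⟩

theorem isCoprod_prod [HasFiniteLimits C] (U : C) {X Y Z : C} {i : X ⟶ Z} {j : Y ⟶ Z}
    (h : Nonempty (IsColimit (BinaryCofan.mk i j))) :
    Nonempty (IsColimit (BinaryCofan.mk (prod.map (𝟙 U) i) (prod.map (𝟙 U) j))) :=
  isCoprod_pullback (f := (prod.snd : U ⨯ Z ⟶ Z)) h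
    (isPullback_prod_map_snd U i) (isPullback_prod_map_snd U j)

variable {obj : C → Type u} [∀ X, AddCommGroup (obj X)]
    {res : ∀ {X Y : C}, (X ⟶ Y) → obj Y →+ obj X}
    {tr : ∀ {X Y : C}, (X ⟶ Y) → obj X →+ obj Y}

/-- For functors with base change, additivity follows from the formula expressing an element over
a coproduct as the sum of the transfers of its restrictions. -/
theorem IsMackey.of_sum
    (res_id : ∀ {X : C} (x : obj X), res (𝟙 X) x = x)
    (res_comp : ∀ {X Y Z : C} (f : X ⟶ Y) (g : Y ⟶ Z) (z : obj Z),
      res (f ≫ g) z = res f (res g z))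
    (tr_id : ∀ {X : C} (x : obj X), tr (𝟙 X) x = x)
    (tr_comp : ∀ {X Y Z : C} (f : X ⟶ Y) (g : Y ⟶ Z) (x : obj X),
      tr (f ≫ g) x = tr g (tr f x))
    (base_change : ∀ {P X Y Z : C} {p : P ⟶ X} {q : P ⟶ Y} {f : X ⟶ Z} {g : Y ⟶ Z},
      IsPullback p q f g → ∀ x : obj X, res g (tr f x) = tr q (res p x))
    (sum : ∀ {X Y Z : C} (i : X ⟶ Z) (j : Y ⟶ Z), Nonempty (IsColimit (BinaryCofan.mk i j)) →
      ∀ z : obj Z, tr i (res i z) + tr j (res j z) = z) : IsMackey obj res tr := by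
  have hsub : ∀ {X : C}, Nonempty (IsInitial X) → Subsingleton (obj X) := by
    rintro X ⟨hX⟩
    have h := sum (𝟙 X) (𝟙 X) ⟨BinaryCofan.IsColimit.mk _ (fun f _ => f) (fun f _ => Category.id_comp f)
      (fun _ _ => hX.hom_ext _ _)
      (fun _ _ _ _ _ => hX.hom_ext _ _)⟩
    refine ⟨fun x y => ?_⟩
    have hx := h x
    have hy := h y
    simp only [res_id, tr_id, add_eq_left] at hx hy
    rw [hx, hy]
  refine ⟨res_id, res_comp, tr_id, tr_comp, base_change, hsub, ?_⟩
  intro X Y Z i j h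
  have hi : Mono i := FinitaryExtensive.mono_inl_of_isColimit h.some
  have hj : Mono j := FinitaryExtensive.mono_inr_of_isColimit h.some
  have hd : IsPullback (initial.to X) (initial.to Y) i j :=
    FinitaryExtensive.isPullback_initial_to_binaryCofan h.some
  have h0 : Subsingleton (obj (⊥_ C)) := hsub ⟨initialIsInitial⟩
  constructor
  · intro x y hxy
    simp only [Prod.mk.injEq] at hxy
    rw [← sum i j h x, ← sum i j h y, hxy.1, hxy.2]
  · rintro ⟨a, b⟩
    refine ⟨tr i a + tr j b, ?_⟩
    simp only [map_add, Prod.mk.injEq]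
    rw [base_change (IsKernelPair.id_of_mono i), base_change (IsKernelPair.id_of_mono j),
      base_change hd, base_change hd.flip, Subsingleton.elim (res (initial.to X) a) 0,
      Subsingleton.elim (res (initial.to Y) b) 0]
    simp [res_id, tr_id]

theorem IsMackey.sum (H : IsMackey obj res tr) {X Y Z : C} (i : X ⟶ Z) (j : Y ⟶ Z)
    (h : Nonempty (IsColimit (BinaryCofan.mk i j))) (z : obj Z) :
    tr i (res i z) + tr j (res j z) = z := by
  have hi : Mono i := FinitaryExtensive.mono_inl_of_isColimit h.some
  have hj : Mono j := FinitaryExtensive.mono_inr_of_isColimit h.some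
  have hd : IsPullback (initial.to X) (initial.to Y) i j :=
    FinitaryExtensive.isPullback_initial_to_binaryCofan h.some
  have h0 : Subsingleton (obj (⊥_ C)) := H.subsingleton_of_isInitial ⟨initialIsInitial⟩
  apply (H.bijective_of_isCoprod i j h).1
  simp only [map_add, Prod.mk.injEq]
  rw [H.base_change (IsKernelPair.id_of_mono i), H.base_change (IsKernelPair.id_of_mono j),
    H.base_change hd, H.base_change hd.flip, Subsingleton.elim (res (initial.to X) _) 0,
    Subsingleton.elim (res (initial.to Y) _) 0]
  simp [H.res_id, H.tr_id]

end

theorem IsMackey.tr_res_of_isIso {obj : C → Type u} [∀ X, AddCommGroup (obj X)]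
    {res : ∀ {X Y : C}, (X ⟶ Y) → obj Y →+ obj X}
    {tr : ∀ {X Y : C}, (X ⟶ Y) → obj X →+ obj Y} (H : IsMackey obj res tr)
    {X Y : C} (e : X ⟶ Y) [IsIso e] (y : obj Y) : tr e (res e y) = y := by
  have h : IsPullback e e (𝟙 Y) (𝟙 Y) := IsPullback.of_horiz_isIso ⟨rfl⟩
  rw [← H.base_change h, H.tr_id, H.res_id]

end Axioms


/-! ## Mackey functors, Green functors and their modules -/

section Basic

variable {C : Type u} [Category.{u} C]

/-- A Mackey functor on `C` (for `C = FinGSet G`: a `G`-Mackey functor), given by its values on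
objects together with its restrictions and transfers. -/
structure MackeyFunctor (C : Type u) [Category.{u} C] where
  obj : C → Type u
  [grp : ∀ X, AddCommGroup (obj X)]
  res : ∀ {X Y : C}, (X ⟶ Y) → obj Y →+ obj X
  tr : ∀ {X Y : C}, (X ⟶ Y) → obj X →+ obj Y
  isMackey : IsMackey obj res tr

attribute [instance] MackeyFunctor.grp

/-- A morphism of Mackey functors: a family of additive maps commuting with restrictions and
transfers. -/
structure MackeyHom (M N : MackeyFunctor C) where
  app : ∀ X, M.obj X →+ N.obj X
  app_res : ∀ {X Y : C} (f : X ⟶ Y) (y : M.obj Y), app X (M.res f y) = N.res f (app Y y)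
  app_tr : ∀ {X Y : C} (f : X ⟶ Y) (x : M.obj X), app Y (M.tr f x) = N.tr f (app X x)

/-- A morphism of Mackey functors is an isomorphism when it has a two-sided inverse. -/
def MackeyHom.IsIso {M N : MackeyFunctor C} (φ : MackeyHom M N) : Prop :=
  ∃ ψ : MackeyHom N M, (∀ X x, ψ.app X (φ.app X x) = x) ∧ ∀ X y, φ.app X (ψ.app X y) = y

/-- A (not necessarily commutative) Green functor: a Mackey functor with ring values whose
restrictions are ring homomorphisms and whose transfers satisfy Frobenius reciprocity. -/
structure GreenFunctor (C : Type u) [Category.{u} C] where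
  obj : C → Type u
  [ring : ∀ X, Ring (obj X)]
  res : ∀ {X Y : C}, (X ⟶ Y) → obj Y →+ obj X
  tr : ∀ {X Y : C}, (X ⟶ Y) → obj X →+ obj Y
  isMackey : IsMackey obj res tr
  res_one : ∀ {X Y : C} (f : X ⟶ Y), res f 1 = 1
  res_mul : ∀ {X Y : C} (f : X ⟶ Y) (a b : obj Y), res f (a * b) = res f a * res f b
  tr_mul : ∀ {X Y : C} (f : X ⟶ Y) (a : obj X) (b : obj Y), tr f a * b = tr f (a * res f b)
  mul_tr : ∀ {X Y : C} (f : X ⟶ Y) (a : obj Y) (b : obj X), a * tr f b = tr f (res f a * b)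

attribute [instance] GreenFunctor.ring

/-- A Green functor is commutative when all its values are commutative rings. -/
def GreenFunctor.IsCommutative (R : GreenFunctor C) : Prop :=
  ∀ X (a b : R.obj X), a * b = b * a

/-- A morphism of Green functors. -/
structure GreenHom (R S : GreenFunctor C) where
  app : ∀ X, R.obj X →+* S.obj X
  app_res : ∀ {X Y : C} (f : X ⟶ Y) (y : R.obj Y), app X (R.res f y) = S.res f (app Y y)
  app_tr : ∀ {X Y : C} (f : X ⟶ Y) (x : R.obj X), app Y (R.tr f x) = S.tr f (app X x)

/-- A (left) module over a Green functor. -/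
structure GModule (R : GreenFunctor C) where
  obj : C → Type u
  [grp : ∀ X, AddCommGroup (obj X)]
  [mod : ∀ X, Module (R.obj X) (obj X)]
  res : ∀ {X Y : C}, (X ⟶ Y) → obj Y →+ obj X
  tr : ∀ {X Y : C}, (X ⟶ Y) → obj X →+ obj Y
  isMackey : IsMackey obj res tr
  res_smul : ∀ {X Y : C} (f : X ⟶ Y) (r : R.obj Y) (m : obj Y),
    res f (r • m) = R.res f r • res f m
  smul_tr : ∀ {X Y : C} (f : X ⟶ Y) (r : R.obj Y) (m : obj X),
    r • tr f m = tr f (R.res f r • m)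
  tr_smul : ∀ {X Y : C} (f : X ⟶ Y) (r : R.obj X) (m : obj Y),
    R.tr f r • m = tr f (r • res f m)

attribute [instance] GModule.grp GModule.mod

/-- The Mackey functor underlying a module. -/
@[reducible] def GModule.toMackey {R : GreenFunctor C} (M : GModule R) : MackeyFunctor C where
  obj := M.obj
  res := M.res
  tr := M.tr
  isMackey := M.isMackey

/-- A morphism of modules over a Green functor. -/
structure GModuleHom {R : GreenFunctor C} (M N : GModule R) where
  app : ∀ X, M.obj X →ₗ[R.obj X] N.obj X
  app_res : ∀ {X Y : C} (f : X ⟶ Y) (y : M.obj Y), app X (M.res f y) = N.res f (app Y y)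
  app_tr : ∀ {X Y : C} (f : X ⟶ Y) (x : M.obj X), app Y (M.tr f x) = N.tr f (app X x)

/-- The opposite Green functor. -/
def GreenFunctor.op (R : GreenFunctor C) : GreenFunctor C where
  obj X := (R.obj X)ᵐᵒᵖ
  res f := AddMonoidHom.mulOp (R.res f)
  tr f := AddMonoidHom.mulOp (R.tr f)
  isMackey :=
    { res_id := fun x => MulOpposite.unop_injective (R.isMackey.res_id _)
      res_comp := fun f g x => MulOpposite.unop_injective (R.isMackey.res_comp f g _)
      tr_id := fun x => MulOpposite.unop_injective (R.isMackey.tr_id _)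
      tr_comp := fun f g x => MulOpposite.unop_injective (R.isMackey.tr_comp f g _)
      base_change := fun h x => MulOpposite.unop_injective (R.isMackey.base_change h _)
      subsingleton_of_isInitial := fun h =>
        ⟨fun _ _ => MulOpposite.unop_injective
          ((R.isMackey.subsingleton_of_isInitial h).elim _ _)⟩
      bijective_of_isCoprod := fun i j h => by
        have := R.isMackey.bijective_of_isCoprod i j h
        refine ⟨fun a b hab => MulOpposite.unop_injective (this.1 ?_), fun ⟨a, b⟩ => ?_⟩
        · simp only [Prod.mk.injEq] at hab ⊢
          exact ⟨congrArg MulOpposite.unop hab.1, congrArg MulOpposite.unop hab.2⟩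
        · obtain ⟨z, hz⟩ := this.2 (a.unop, b.unop)
          simp only [Prod.mk.injEq] at hz
          refine ⟨MulOpposite.op z, ?_⟩
          simp only [Prod.mk.injEq]
          exact ⟨MulOpposite.unop_injective hz.1, MulOpposite.unop_injective hz.2⟩ }
  res_one f := MulOpposite.unop_injective (R.res_one f)
  res_mul f a b := MulOpposite.unop_injective (R.res_mul f _ _)
  tr_mul f a b := MulOpposite.unop_injective (R.mul_tr f _ _)
  mul_tr f a b := MulOpposite.unop_injective (R.tr_mul f _ _)

/-- An element of `R`, viewed in the opposite Green functor. -/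
def GreenFunctor.toOp (R : GreenFunctor C) {X : C} (r : R.obj X) : R.op.obj X := MulOpposite.op r

/-- An element of the opposite Green functor, viewed in `R`. -/
def GreenFunctor.ofOp (R : GreenFunctor C) {X : C} (r : R.op.obj X) : R.obj X :=
  MulOpposite.unop r

/-- A right module over `R` is a left module over the opposite of `R`. -/
abbrev RightGModule (R : GreenFunctor C) := GModule R.op

/-- The morphism of opposite Green functors induced by a morphism of Green functors. -/
def GreenHom.op {R S : GreenFunctor C} (φ : GreenHom R S) : GreenHom R.op S.op where
  app X := RingHom.op (φ.app X)
  app_res f _ := MulOpposite.unop_injective (φ.app_res f _)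
  app_tr f _ := MulOpposite.unop_injective (φ.app_tr f _)

/-- `R` as a left module over itself. -/
def GreenFunctor.self (R : GreenFunctor C) : GModule R where
  obj := R.obj
  res := R.res
  tr := R.tr
  isMackey := R.isMackey
  res_smul := R.res_mul
  smul_tr := R.mul_tr
  tr_smul := R.tr_mul

/-- `R` as a right module over itself: `toOp r • x = x * r`. -/
def GreenFunctor.rself (R : GreenFunctor C) : RightGModule R where
  obj := R.obj
  mod X := inferInstanceAs (Module (R.obj X)ᵐᵒᵖ (R.obj X))
  res := R.res
  tr := R.tr
  isMackey := R.isMackey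
  res_smul f _ _ := R.res_mul f _ _
  smul_tr f _ _ := R.tr_mul f _ _
  tr_smul f _ _ := R.mul_tr f _ _

/-- Restriction of scalars of a module along a morphism of Green functors. -/
def GModule.restrict {R S : GreenFunctor C} (φ : GreenHom R S) (M : GModule S) :
    GModule R where
  obj := M.obj
  mod X := Module.compHom (M.obj X) (φ.app X)
  res := M.res
  tr := M.tr
  isMackey := M.isMackey
  res_smul f r m := (M.res_smul f (φ.app _ r) m).trans
    (congrArg (fun s : S.obj _ => s • M.res f m) (φ.app_res f r).symm)
  smul_tr f r m := (M.smul_tr f (φ.app _ r) m).trans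
    (congrArg (fun s : S.obj _ => M.tr f (s • m)) (φ.app_res f r).symm)
  tr_smul f r m := (congrArg (fun s : S.obj _ => s • m) (φ.app_tr f r)).trans
    (M.tr_smul f (φ.app _ r) m)

end Basic

/-! ## Free and projective modules -/

section Free

variable {C : Type u} [Category.{u} C] [HasFiniteLimits C] [FinitaryExtensive C]

/-- The free `R`-module `R{x_U}` on a generator at level `U`, with `R{x_U}(X) = R(U × X)`. -/
noncomputable def freeOn (R : GreenFunctor C) (U : C) : GModule R where
  obj X := R.obj (U ⨯ X)
  mod X :=
    { smul := fun r x => R.res (prod.snd : U ⨯ X ⟶ X) r * x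
      one_smul := fun x => by
        change R.res (prod.snd : U ⨯ X ⟶ X) 1 * x = x
        rw [R.res_one, one_mul]
      mul_smul := fun r s x => by
        change R.res (prod.snd : U ⨯ X ⟶ X) (r * s) * x = _ * (_ * x)
        rw [R.res_mul, mul_assoc]
      smul_zero := fun r => mul_zero _
      smul_add := fun r x y => mul_add _ _ _
      add_smul := fun r s x => by
        change R.res (prod.snd : U ⨯ X ⟶ X) (r + s) * x = _ * x + _ * x
        rw [map_add, add_mul]
      zero_smul := fun x => by
        change R.res (prod.snd : U ⨯ X ⟶ X) 0 * x = 0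
        rw [map_zero, zero_mul] }
  res f := R.res (prod.map (𝟙 U) f)
  tr f := R.tr (prod.map (𝟙 U) f)
  isMackey := IsMackey.of_sum
    (fun x => by rw [prod.map_id_id, R.isMackey.res_id])
    (fun f g x => by rw [← R.isMackey.res_comp, prod.map_map, Category.comp_id])
    (fun x => by rw [prod.map_id_id, R.isMackey.tr_id])
    (fun f g x => by rw [← R.isMackey.tr_comp, prod.map_map, Category.comp_id])
    (fun h x => R.isMackey.base_change (isPullback_prod_map U h) x)
    (fun i j h z => R.isMackey.sum _ _ (isCoprod_prod U h) z)
  res_smul {X Y} f r m := by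
    change R.res (prod.map (𝟙 U) f) (R.res prod.snd r * m) =
      R.res prod.snd (R.res f r) * R.res (prod.map (𝟙 U) f) m
    rw [R.res_mul, ← R.isMackey.res_comp, ← R.isMackey.res_comp, prod.map_snd]
  smul_tr {X Y} f r m := by
    change R.res prod.snd r * R.tr (prod.map (𝟙 U) f) m =
      R.tr (prod.map (𝟙 U) f) (R.res prod.snd (R.res f r) * m)
    rw [R.mul_tr, ← R.isMackey.res_comp, ← R.isMackey.res_comp, prod.map_snd]
  tr_smul {X Y} f r m := by
    change R.res prod.snd (R.tr f r) * m =
      R.tr (prod.map (𝟙 U) f) (R.res prod.snd r * R.res (prod.map (𝟙 U) f) m)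
    rw [R.isMackey.base_change (isPullback_prod_map_snd U f).flip, R.tr_mul]

/-- The direct sum of a family of modules. -/
noncomputable def directSum {R : GreenFunctor C} {ι : Type u} (M : ι → GModule R) :
    GModule R where
  obj X := Π₀ i, (M i).obj X
  res f := DFinsupp.mapRange.addMonoidHom fun i => (M i).res f
  tr f := DFinsupp.mapRange.addMonoidHom fun i => (M i).tr f
  isMackey := IsMackey.of_sum
    (fun _ => DFinsupp.ext fun i => (M i).isMackey.res_id _)
    (fun f g _ => DFinsupp.ext fun i => (M i).isMackey.res_comp f g _)
    (fun _ => DFinsupp.ext fun i => (M i).isMackey.tr_id _)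
    (fun f g _ => DFinsupp.ext fun i => (M i).isMackey.tr_comp f g _)
    (fun h _ => DFinsupp.ext fun i => (M i).isMackey.base_change h _)
    (fun k l h _ => DFinsupp.ext fun i => (M i).isMackey.sum k l h _)
  res_smul f r _ := DFinsupp.ext fun i => (M i).res_smul f r _
  smul_tr f r _ := DFinsupp.ext fun i => (M i).smul_tr f r _
  tr_smul f r _ := DFinsupp.ext fun i => (M i).tr_smul f r _

/-- A module is projective when it is a direct summand (retract) of a free module, that is, of a
direct sum of modules `R{x_U}`. -/
def IsProjective {R : GreenFunctor C} (P : GModule R) : Prop :=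
  ∃ (ι : Type u) (U : ι → C) (i : GModuleHom P (directSum fun k => freeOn R (U k)))
    (r : GModuleHom (directSum fun k => freeOn R (U k)) P), ∀ X x, r.app X (i.app X x) = x

end Free


/-! ## Relative box products -/

section Box

variable {C : Type u} [Category.{u} C]

section Defs

variable {R : GreenFunctor C} (M : RightGModule R) (N : GModule R)

/-- Generators of `(M ⊠_R N)(X)`: a morphism `f : Y ⟶ X` with elements of `M(Y)` and `N(Y)`. -/
structure BoxGen (X : C) where
  Y : C
  f : Y ⟶ X
  m : M.obj Y
  n : N.obj Y

/-- The relators of `(M ⊠_R N)(X)`: biadditivity, the two Frobenius (dinaturality) relations, and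
the `R`-balancing relation. -/
inductive BoxRelator (X : C) : FreeAbelianGroup (BoxGen M N X) → Prop
  | add_left {Y : C} (f : Y ⟶ X) (m m' : M.obj Y) (n : N.obj Y) :
      BoxRelator X (.of ⟨Y, f, m + m', n⟩ - (.of ⟨Y, f, m, n⟩ + .of ⟨Y, f, m', n⟩))
  | add_right {Y : C} (f : Y ⟶ X) (m : M.obj Y) (n n' : N.obj Y) :
      BoxRelator X (.of ⟨Y, f, m, n + n'⟩ - (.of ⟨Y, f, m, n⟩ + .of ⟨Y, f, m, n'⟩))
  | tr_left {Y Z : C} (h : Y ⟶ Z) (f : Z ⟶ X) (m : M.obj Y) (n : N.obj Z) :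
      BoxRelator X (.of ⟨Z, f, M.tr h m, n⟩ - .of ⟨Y, h ≫ f, m, N.res h n⟩)
  | tr_right {Y Z : C} (h : Y ⟶ Z) (f : Z ⟶ X) (m : M.obj Z) (n : N.obj Y) :
      BoxRelator X (.of ⟨Z, f, m, N.tr h n⟩ - .of ⟨Y, h ≫ f, M.res h m, n⟩)
  | balanced {Y : C} (f : Y ⟶ X) (r : R.obj Y) (m : M.obj Y) (n : N.obj Y) :
      BoxRelator X (.of ⟨Y, f, R.toOp r • m, n⟩ - .of ⟨Y, f, m, r • n⟩)

/-- The value at `X` of the relative box product `M ⊠_R N`. -/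
def Box (X : C) : Type u :=
  FreeAbelianGroup (BoxGen M N X) ⧸ AddSubgroup.closure {z | BoxRelator M N X z}

noncomputable instance (X : C) : AddCommGroup (Box M N X) :=
  inferInstanceAs (AddCommGroup (_ ⧸ AddSubgroup.closure {z | BoxRelator M N X z}))

end Defs

namespace Box

variable {R : GreenFunctor C} {M : RightGModule R} {N : GModule R}

variable (M N) in
/-- The class of `m ⊗ n` over `f : Y ⟶ X`: the transfer along `f` of the pure tensor `m ⊗ n`. -/
def mk {X Y : C} (f : Y ⟶ X) (m : M.obj Y) (n : N.obj Y) : Box M N X :=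
  QuotientAddGroup.mk (FreeAbelianGroup.of ⟨Y, f, m, n⟩)

theorem mk_eq_of_relator {X : C} {a b : FreeAbelianGroup (BoxGen M N X)}
    (h : BoxRelator M N X (a - b)) :
    (QuotientAddGroup.mk a : Box M N X) = QuotientAddGroup.mk b :=
  (QuotientAddGroup.eq_iff_sub_mem).2 (AddSubgroup.subset_closure h)

theorem mk_add_left {X Y : C} (f : Y ⟶ X) (m m' : M.obj Y) (n : N.obj Y) :
    mk M N f (m + m') n = mk M N f m n + mk M N f m' n :=
  mk_eq_of_relator (.add_left f m m' n)

theorem mk_add_right {X Y : C} (f : Y ⟶ X) (m : M.obj Y) (n n' : N.obj Y) :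
    mk M N f m (n + n') = mk M N f m n + mk M N f m n' :=
  mk_eq_of_relator (.add_right f m n n')

theorem mk_tr_left {X Y Z : C} (h : Y ⟶ Z) (f : Z ⟶ X) (m : M.obj Y) (n : N.obj Z) :
    mk M N f (M.tr h m) n = mk M N (h ≫ f) m (N.res h n) :=
  mk_eq_of_relator (.tr_left h f m n)

theorem mk_tr_right {X Y Z : C} (h : Y ⟶ Z) (f : Z ⟶ X) (m : M.obj Z) (n : N.obj Y) :
    mk M N f m (N.tr h n) = mk M N (h ≫ f) (M.res h m) n :=
  mk_eq_of_relator (.tr_right h f m n)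

theorem mk_balanced {X Y : C} (f : Y ⟶ X) (r : R.obj Y) (m : M.obj Y) (n : N.obj Y) :
    mk M N f (R.toOp r • m) n = mk M N f m (r • n) :=
  mk_eq_of_relator (.balanced f r m n)

/-- A family of functions on pure tensors is balanced when it respects the relators. -/
structure IsBalanced {A : Type*} [AddCommGroup A] {X : C}
    (φ : ∀ {Y : C}, (Y ⟶ X) → M.obj Y → N.obj Y → A) : Prop where
  add_left : ∀ {Y : C} (f : Y ⟶ X) (m m' : M.obj Y) (n : N.obj Y),
    φ f (m + m') n = φ f m n + φ f m' n
  add_right : ∀ {Y : C} (f : Y ⟶ X) (m : M.obj Y) (n n' : N.obj Y),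
    φ f m (n + n') = φ f m n + φ f m n'
  tr_left : ∀ {Y Z : C} (h : Y ⟶ Z) (f : Z ⟶ X) (m : M.obj Y) (n : N.obj Z),
    φ f (M.tr h m) n = φ (h ≫ f) m (N.res h n)
  tr_right : ∀ {Y Z : C} (h : Y ⟶ Z) (f : Z ⟶ X) (m : M.obj Z) (n : N.obj Y),
    φ f m (N.tr h n) = φ (h ≫ f) (M.res h m) n
  balanced : ∀ {Y : C} (f : Y ⟶ X) (r : R.obj Y) (m : M.obj Y) (n : N.obj Y),
    φ f (R.toOp r • m) n = φ f m (r • n)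

/-- The additive map out of `(M ⊠_R N)(X)` given by a balanced family. -/
def lift {A : Type*} [AddCommGroup A] {X : C}
    (φ : ∀ {Y : C}, (Y ⟶ X) → M.obj Y → N.obj Y → A) (h : IsBalanced (M := M) (N := N) φ) :
    Box M N X →+ A :=
  QuotientAddGroup.lift _ (FreeAbelianGroup.lift fun g : BoxGen M N X => φ g.f g.m g.n) (by
    rw [AddSubgroup.closure_le]
    rintro z (_ | _ | _ | _ | _)
    · simp [h.add_left]
    · simp [h.add_right]
    · simp [h.tr_left]
    · simp [h.tr_right]
    · simp [h.balanced])

@[simp] theorem lift_mk {A : Type*} [AddCommGroup A] {X : C}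
    (φ : ∀ {Y : C}, (Y ⟶ X) → M.obj Y → N.obj Y → A) (h : IsBalanced (M := M) (N := N) φ)
    {Y : C} (f : Y ⟶ X) (m : M.obj Y) (n : N.obj Y) : lift φ h (mk M N f m n) = φ f m n :=
  FreeAbelianGroup.lift_apply_of _ _

theorem induction {X : C} {p : Box M N X → Prop} (zero : p 0)
    (add : ∀ a b, p a → p b → p (a + b)) (neg : ∀ a, p a → p (-a))
    (mk : ∀ {Y : C} (f : Y ⟶ X) (m : M.obj Y) (n : N.obj Y), p (mk M N f m n)) (z : Box M N X) :
    p z := by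
  obtain ⟨z, rfl⟩ := QuotientAddGroup.mk_surjective z
  induction z using FreeAbelianGroup.induction_on with
  | zero => exact zero
  | of g => exact mk g.f g.m g.n
  | neg g h => exact neg _ h
  | add a b ha hb => exact add _ _ ha hb

theorem hom_ext {A : Type*} [AddCommGroup A] {X : C} {φ ψ : Box M N X →+ A}
    (h : ∀ {Y : C} (f : Y ⟶ X) (m : M.obj Y) (n : N.obj Y),
      φ (mk M N f m n) = ψ (mk M N f m n)) : φ = ψ := by
  ext z
  induction z using induction with
  | zero => simp
  | add a b ha hb => rw [map_add, map_add, ha, hb]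
  | neg a h => rw [map_neg, map_neg, h]
  | mk f m n => exact h f m n

theorem mk_res_res {X Y Z : C} (e : Z ⟶ Y) [IsIso e] (f : Y ⟶ X) (m : M.obj Y) (n : N.obj Y) :
    mk M N (e ≫ f) (M.res e m) (N.res e n) = mk M N f m n := by
  rw [← mk_tr_left, M.isMackey.tr_res_of_isIso]

/-- Pulled back pure tensors do not depend on the choice of the pullback. -/
theorem mk_pullback_eq {X X' Y P P' : C} {f : Y ⟶ X} {g : X' ⟶ X} {p : P ⟶ Y} {q : P ⟶ X'}
    {p' : P' ⟶ Y} {q' : P' ⟶ X'} (h : IsPullback p q f g) (h' : IsPullback p' q' f g)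
    (m : M.obj Y) (n : N.obj Y) :
    mk M N q (M.res p m) (N.res p n) = mk M N q' (M.res p' m) (N.res p' n) := by
  rw [← mk_res_res (h.isoIsPullback _ _ h').hom q', ← M.isMackey.res_comp,
    ← N.isMackey.res_comp, h.isoIsPullback_hom_fst, h.isoIsPullback_hom_snd]

/-- Transfers of `M ⊠_R N`: postcomposition. -/
noncomputable def tr {X X' : C} (g : X ⟶ X') : Box M N X →+ Box M N X' :=
  lift (fun f m n => mk M N (f ≫ g) m n)
    { add_left := fun _ _ _ _ => mk_add_left _ _ _ _
      add_right := fun _ _ _ _ => mk_add_right _ _ _ _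
      tr_left := fun h f m n => by rw [mk_tr_left, Category.assoc]
      tr_right := fun h f m n => by rw [mk_tr_right, Category.assoc]
      balanced := fun _ _ _ _ => mk_balanced _ _ _ _ }

@[simp] theorem tr_mk {X X' Y : C} (g : X ⟶ X') (f : Y ⟶ X) (m : M.obj Y) (n : N.obj Y) :
    tr g (mk M N f m n) = mk M N (f ≫ g) m n :=
  lift_mk _ _ _ _ _

theorem isPullback_slide [HasFiniteLimits C] {X X' Y Z : C} (h : Y ⟶ Z) (f : Z ⟶ X) (g : X' ⟶ X) :
    ∃ k : pullback (h ≫ f) g ⟶ pullback f g,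
      k ≫ pullback.snd f g = pullback.snd (h ≫ f) g ∧
      IsPullback (pullback.fst (h ≫ f) g) k h (pullback.fst f g) := by
  let k : pullback (h ≫ f) g ⟶ pullback f g :=
    pullback.lift (pullback.fst _ _ ≫ h) (pullback.snd _ _)
      (by rw [Category.assoc, pullback.condition])
  have h1 : k ≫ pullback.fst f g = pullback.fst (h ≫ f) g ≫ h := pullback.lift_fst _ _ _
  have h2 : k ≫ pullback.snd f g = pullback.snd (h ≫ f) g := pullback.lift_snd _ _ _
  refine ⟨k, h2, ?_⟩
  have e := (IsPullback.of_hasPullback (h ≫ f) g).flip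
  rw [← h2] at e
  exact (IsPullback.of_right e h1 (IsPullback.of_hasPullback f g).flip).flip

/-- Restrictions of `M ⊠_R N`: pullback. -/
noncomputable def res [HasFiniteLimits C] {X X' : C} (g : X' ⟶ X) : Box M N X →+ Box M N X' :=
  lift (fun f m n => mk M N (pullback.snd f g) (M.res (pullback.fst f g) m)
      (N.res (pullback.fst f g) n))
    { add_left := fun _ _ _ _ => by rw [map_add, mk_add_left]
      add_right := fun _ _ _ _ => by rw [map_add, mk_add_right]
      tr_left := fun h f m n => by
        obtain ⟨k, hk, hp⟩ := isPullback_slide h f g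
        rw [M.isMackey.base_change hp, mk_tr_left, hk, ← N.isMackey.res_comp,
          ← N.isMackey.res_comp, hp.w]
      tr_right := fun h f m n => by
        obtain ⟨k, hk, hp⟩ := isPullback_slide h f g
        rw [N.isMackey.base_change hp, mk_tr_right, hk, ← M.isMackey.res_comp,
          ← M.isMackey.res_comp, hp.w]
      balanced := fun f r m n => by
        rw [M.res_smul, N.res_smul, ← mk_balanced]
        rfl }

theorem res_mk [HasFiniteLimits C] {X X' Y P : C} {g : X' ⟶ X} {f : Y ⟶ X} {p : P ⟶ Y} {q : P ⟶ X'}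
    (h : IsPullback p q f g) (m : M.obj Y) (n : N.obj Y) :
    res g (mk M N f m n) = mk M N q (M.res p m) (N.res p n) :=
  (lift_mk _ _ _ _ _).trans (mk_pullback_eq (IsPullback.of_hasPullback f g) h m n)

theorem isMackey [HasFiniteLimits C] [FinitaryExtensive C] : IsMackey (Box M N) res tr := by
  refine IsMackey.of_sum ?_ ?_ ?_ ?_ ?_ ?_
  · intro X x
    suffices h : (res (𝟙 X) : Box M N X →+ _) = AddMonoidHom.id _ from DFunLike.congr_fun h x
    refine hom_ext fun f m n => ?_
    rw [res_mk (IsPullback.of_id_fst (f := f)), M.isMackey.res_id, N.isMackey.res_id]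
    rfl
  · intro X Y Z f g z
    suffices h : (res (f ≫ g) : Box M N Z →+ _) = (res f).comp (res g) from
      DFunLike.congr_fun h z
    refine hom_ext fun k m n => ?_
    have h1 := IsPullback.of_hasPullback k g
    have h2 := IsPullback.of_hasPullback (pullback.snd k g) f
    rw [res_mk (h2.paste_horiz h1), AddMonoidHom.comp_apply, res_mk h1, res_mk h2,
      M.isMackey.res_comp, N.isMackey.res_comp]
  · intro X x
    suffices h : (tr (𝟙 X) : Box M N X →+ _) = AddMonoidHom.id _ from DFunLike.congr_fun h x
    refine hom_ext fun f m n => ?_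
    simp
  · intro X Y Z f g z
    suffices h : (tr (f ≫ g) : Box M N X →+ _) = (tr g).comp (tr f) from
      DFunLike.congr_fun h z
    refine hom_ext fun k m n => ?_
    simp
  · intro P X Y Z p q f g h x
    suffices h : (res g : Box M N Z →+ _).comp (tr f) = (tr q).comp (res p) from
      DFunLike.congr_fun h x
    refine hom_ext fun k m n => ?_
    have h1 := IsPullback.of_hasPullback k p
    rw [AddMonoidHom.comp_apply, AddMonoidHom.comp_apply, tr_mk, res_mk h1, tr_mk,
      res_mk (h1.paste_vert h)]
  · intro X Y Z i j h z
    suffices h : (tr i).comp (res i : Box M N Z →+ _) + (tr j).comp (res j) = AddMonoidHom.id _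
      from DFunLike.congr_fun h z
    refine hom_ext fun f m n => ?_
    have h1 := IsPullback.of_hasPullback f i
    have h2 := IsPullback.of_hasPullback f j
    rw [AddMonoidHom.add_apply, AddMonoidHom.comp_apply, AddMonoidHom.comp_apply, res_mk h1,
      res_mk h2, tr_mk, tr_mk, ← h1.w, ← h2.w, ← mk_tr_right, ← mk_tr_right, ← mk_add_right,
      N.isMackey.sum _ _ (isCoprod_pullback h h1 h2)]
    rfl

theorem tr_mk_id {X Y : C} (f : Y ⟶ X) (m : M.obj Y) (n : N.obj Y) :
    tr f (mk M N (𝟙 Y) m n) = mk M N f m n := by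
  rw [tr_mk, Category.id_comp]

theorem res_mk_id [HasFiniteLimits C] {X Y : C} (f : Y ⟶ X) (m : M.obj X) (n : N.obj X) :
    res f (mk M N (𝟙 X) m n) = mk M N (𝟙 Y) (M.res f m) (N.res f n) :=
  res_mk IsPullback.of_id_snd m n

theorem hom_congr {A : Type*} [AddCommGroup A] {X : C} (φ ψ : Box M N X →+ A)
    (h : ∀ {Y : C} (f : Y ⟶ X) (m : M.obj Y) (n : N.obj Y),
      φ (mk M N f m n) = ψ (mk M N f m n)) (z : Box M N X) : φ z = ψ z :=
  DFunLike.congr_fun (hom_ext h) z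

end Box

variable [HasFiniteLimits C] [FinitaryExtensive C]

/-- The relative box product `M ⊠_R N` of a right and a left `R`-module, the quotient of
`M ⊠ N` by the relations `m r ⊗ n = m ⊗ r n`. -/
@[reducible] noncomputable def boxProduct {R : GreenFunctor C} (M : RightGModule R)
    (N : GModule R) : MackeyFunctor C where
  obj := Box M N
  res := Box.res
  tr := Box.tr
  isMackey := Box.isMackey

/-- A balanced pairing `M × N → A`: levelwise biadditive maps compatible with restrictions, with
transfers (Frobenius reciprocity) and with the action of `R`. -/
structure BoxPairing {R : GreenFunctor C} (M : RightGModule R) (N : GModule R)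
    (A : MackeyFunctor C) where
  toFun : ∀ {X : C}, M.obj X → N.obj X → A.obj X
  add_left : ∀ {X : C} (m m' : M.obj X) (n : N.obj X), toFun (m + m') n = toFun m n + toFun m' n
  add_right : ∀ {X : C} (m : M.obj X) (n n' : N.obj X), toFun m (n + n') = toFun m n + toFun m n'
  res : ∀ {X Y : C} (h : X ⟶ Y) (m : M.obj Y) (n : N.obj Y),
    A.res h (toFun m n) = toFun (M.res h m) (N.res h n)
  tr_left : ∀ {X Y : C} (h : X ⟶ Y) (m : M.obj X) (n : N.obj Y),
    toFun (M.tr h m) n = A.tr h (toFun m (N.res h n))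
  tr_right : ∀ {X Y : C} (h : X ⟶ Y) (m : M.obj Y) (n : N.obj X),
    toFun m (N.tr h n) = A.tr h (toFun (M.res h m) n)
  balanced : ∀ {X : C} (r : R.obj X) (m : M.obj X) (n : N.obj X),
    toFun (R.toOp r • m) n = toFun m (r • n)

namespace BoxPairing

variable {R : GreenFunctor C} {M : RightGModule R} {N : GModule R} {A : MackeyFunctor C}

/-- The additive map `(M ⊠_R N)(X) → A(X)` induced by a balanced pairing. -/
noncomputable def liftApp (t : BoxPairing M N A) (X : C) : Box M N X →+ A.obj X :=
  Box.lift (fun f m n => A.tr f (t.toFun m n))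
    { add_left := fun _ _ _ _ => by rw [t.add_left, map_add]
      add_right := fun _ _ _ _ => by rw [t.add_right, map_add]
      tr_left := fun _ _ _ _ => by rw [t.tr_left, A.isMackey.tr_comp]
      tr_right := fun _ _ _ _ => by rw [t.tr_right, A.isMackey.tr_comp]
      balanced := fun _ _ _ _ => by rw [t.balanced] }

@[simp] theorem liftApp_mk (t : BoxPairing M N A) {X Y : C} (f : Y ⟶ X) (m : M.obj Y)
    (n : N.obj Y) : t.liftApp X (Box.mk M N f m n) = A.tr f (t.toFun m n) :=
  Box.lift_mk _ _ _ _ _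

/-- The morphism `M ⊠_R N → A` induced by a balanced pairing. -/
noncomputable def lift (t : BoxPairing M N A) : MackeyHom (boxProduct M N) A where
  app := t.liftApp
  app_res {X Y} f y := by
    refine Box.hom_congr ((t.liftApp X).comp (Box.res f))
      ((A.res f).comp (t.liftApp Y)) (fun k m n => ?_) y
    have h := IsPullback.of_hasPullback k f
    rw [AddMonoidHom.comp_apply, AddMonoidHom.comp_apply, Box.res_mk h, liftApp_mk,
      liftApp_mk, A.isMackey.base_change h, t.res]
  app_tr {X Y} f x := by
    refine Box.hom_congr ((t.liftApp Y).comp (Box.tr f))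
      ((A.tr f).comp (t.liftApp X)) (fun k m n => ?_) x
    rw [AddMonoidHom.comp_apply, AddMonoidHom.comp_apply, Box.tr_mk, liftApp_mk,
      liftApp_mk, A.isMackey.tr_comp]

theorem lift_mk (t : BoxPairing M N A) {X Y : C} (f : Y ⟶ X) (m : M.obj Y)
    (n : N.obj Y) : t.lift.app X (Box.mk M N f m n) = A.tr f (t.toFun m n) :=
  t.liftApp_mk f m n

variable (M N) in
/-- The universal pairing `m, n ↦ m ⊗ n`. -/
noncomputable def tmul : BoxPairing M N (boxProduct M N) where
  toFun {X} m n := Box.mk M N (𝟙 X) m n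
  add_left _ _ _ := Box.mk_add_left _ _ _ _
  add_right _ _ _ := Box.mk_add_right _ _ _ _
  res h m n := Box.res_mk_id h m n
  tr_left h m n := by rw [Box.mk_tr_left, Box.tr_mk_id, Category.comp_id]
  tr_right h m n := by rw [Box.mk_tr_right, Box.tr_mk_id, Category.comp_id]
  balanced _ _ _ := Box.mk_balanced _ _ _ _

end BoxPairing

/-- The map `M ⊠_R N → M ⊠_R N'`, `m ⊗ n ↦ m ⊗ φ(n)`, induced by a module homomorphism `φ`. -/
noncomputable def boxMap {R : GreenFunctor C} (M : RightGModule R) {N N' : GModule R}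
    (φ : GModuleHom N N') : MackeyHom (boxProduct M N) (boxProduct M N') :=
  BoxPairing.lift
    { toFun := fun {X} m n => (BoxPairing.tmul M N').toFun m (φ.app X n)
      add_left := fun _ _ _ => BoxPairing.add_left _ _ _ _
      add_right := fun _ _ _ => by rw [map_add, BoxPairing.add_right]
      res := fun _ _ _ => by rw [BoxPairing.res, φ.app_res]
      tr_left := fun _ _ _ => by rw [BoxPairing.tr_left, φ.app_res]
      tr_right := fun _ _ _ => by rw [φ.app_tr, BoxPairing.tr_right]
      balanced := fun _ _ _ => by rw [BoxPairing.balanced, map_smul] }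

end Box


section Actions

variable {C : Type u} [Category.{u} C]

/-- The Mackey functor underlying a Green functor. -/
@[reducible] def GreenFunctor.toMackey (R : GreenFunctor C) : MackeyFunctor C where
  obj := R.obj
  res := R.res
  tr := R.tr
  isMackey := R.isMackey

/-- A pairing `S × M → M` of Mackey functors, written as additive operators on `M`. -/
structure Operators (S M : MackeyFunctor C) where
  act : ∀ X : C, S.obj X →+ M.obj X →+ M.obj X
  res_act : ∀ {X Y : C} (f : X ⟶ Y) (s : S.obj Y) (m : M.obj Y),
    M.res f (act Y s m) = act X (S.res f s) (M.res f m)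
  act_tr : ∀ {X Y : C} (f : X ⟶ Y) (s : S.obj Y) (m : M.obj X),
    act Y s (M.tr f m) = M.tr f (act X (S.res f s) m)
  tr_act : ∀ {X Y : C} (f : X ⟶ Y) (s : S.obj X) (m : M.obj Y),
    act Y (S.tr f s) m = M.tr f (act X s (M.res f m))

/-- The operators on a module given by scalar multiplication. -/
def GModule.operators {R : GreenFunctor C} (M : GModule R) :
    Operators R.toMackey M.toMackey where
  act X := AddMonoidHom.mk' (fun r => AddMonoidHom.mk' (fun m : M.obj X => r • m) (smul_add r))
    (fun r s => AddMonoidHom.ext fun m : M.obj X => add_smul r s m)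
  res_act f r m := M.res_smul f r m
  act_tr f r m := M.smul_tr f r m
  tr_act f r m := M.tr_smul f r m

/-- The operators on a right module given by right multiplication. -/
def RightGModule.operators {R : GreenFunctor C} (M : RightGModule R) :
    Operators R.toMackey M.toMackey where
  act X := AddMonoidHom.mk'
    (fun r : R.obj X => AddMonoidHom.mk' (fun m : M.obj X => R.toOp r • m) (smul_add (R.toOp r)))
    (fun r s => AddMonoidHom.ext fun m : M.obj X => add_smul (R.toOp r) (R.toOp s) m)
  res_act f r m := M.res_smul f (R.toOp r) m
  act_tr f r m := M.smul_tr f (R.toOp r) m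
  tr_act f r m := M.tr_smul f (R.toOp r) m

/-- Operators of `R`, regarded as operators of the opposite Green functor. -/
def Operators.ofOp {R : GreenFunctor C} {M : MackeyFunctor C} (φ : Operators R.toMackey M) :
    Operators R.op.toMackey M where
  act X := AddMonoidHom.mk' (fun r : R.op.obj X => φ.act X (R.ofOp r))
    (fun r s => (φ.act X).map_add (R.ofOp r) (R.ofOp s))
  res_act f r m := φ.res_act f (R.ofOp r) m
  act_tr f r m := φ.act_tr f (R.ofOp r) m
  tr_act f r m := φ.tr_act f (R.ofOp r) m

end Actions

section BoxActions

variable {C : Type u} [Category.{u} C] [HasFiniteLimits C] [FinitaryExtensive C]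

namespace Operators

section

variable {R : GreenFunctor C} {S : MackeyFunctor C} {M : RightGModule R} {N : GModule R}

/-- The additive maps underlying `boxLeft`. -/
noncomputable def boxLeftAct (φ : Operators S M.toMackey)
    (hφ : ∀ X (s : S.obj X) (r : R.obj X) (m : M.obj X),
      φ.act X s (R.toOp r • m) = R.toOp r • (φ.act X s m : M.obj X)) (X : C) :
    S.obj X →+ Box M N X →+ Box M N X :=
  AddMonoidHom.mk' (fun s => Box.lift (A := Box M N X)
      (fun {Y} f m n => Box.mk M N f (φ.act Y (S.res f s) m) n)
      { add_left := fun _ _ _ _ => by rw [map_add, Box.mk_add_left]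
        add_right := fun _ _ _ _ => Box.mk_add_right _ _ _ _
        tr_left := fun h f m n => by
          rw [φ.act_tr, Box.mk_tr_left, S.isMackey.res_comp]
        tr_right := fun h f m n => by
          rw [Box.mk_tr_right, φ.res_act, S.isMackey.res_comp]
        balanced := fun f r m n => by rw [hφ, Box.mk_balanced] })
    (fun s t => Box.hom_ext fun f m n => by
      rw [AddMonoidHom.add_apply, Box.lift_mk, Box.lift_mk, Box.lift_mk, map_add, map_add,
        AddMonoidHom.add_apply, Box.mk_add_left])

theorem boxLeftAct_mk (φ : Operators S M.toMackey)
    (hφ : ∀ X (s : S.obj X) (r : R.obj X) (m : M.obj X),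
      φ.act X s (R.toOp r • m) = R.toOp r • (φ.act X s m : M.obj X)) {X Y : C} (s : S.obj X)
    (f : Y ⟶ X) (m : M.obj Y) (n : N.obj Y) :
    boxLeftAct (N := N) φ hφ X s (Box.mk M N f m n) =
      Box.mk M N f (φ.act Y (S.res f s) m) n := by
  rw [boxLeftAct, AddMonoidHom.mk'_apply, Box.lift_mk]

/-- Operators on the left factor of `M ⊠_R N`: `s (m ⊗ n) = (s m) ⊗ n`. -/
noncomputable def boxLeft (φ : Operators S M.toMackey)
    (hφ : ∀ X (s : S.obj X) (r : R.obj X) (m : M.obj X),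
      φ.act X s (R.toOp r • m) = R.toOp r • (φ.act X s m : M.obj X)) :
    Operators S (boxProduct M N) where
  act := boxLeftAct φ hφ
  res_act {X Y} g s m := by
    refine Box.hom_congr ((Box.res g).comp (boxLeftAct φ hφ Y s))
      ((boxLeftAct φ hφ X (S.res g s)).comp (Box.res g)) (fun {P} k m n => ?_) m
    have h := IsPullback.of_hasPullback k g
    rw [AddMonoidHom.comp_apply, AddMonoidHom.comp_apply, Box.res_mk h, boxLeftAct_mk,
      boxLeftAct_mk, Box.res_mk h, φ.res_act, ← S.isMackey.res_comp, ← S.isMackey.res_comp, h.w]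
  act_tr {X Y} g s m := by
    refine Box.hom_congr ((boxLeftAct φ hφ Y s).comp (Box.tr g))
      ((Box.tr g).comp (boxLeftAct φ hφ X (S.res g s))) (fun {P} k m n => ?_) m
    rw [AddMonoidHom.comp_apply, AddMonoidHom.comp_apply, Box.tr_mk, boxLeftAct_mk,
      boxLeftAct_mk, Box.tr_mk, S.isMackey.res_comp]
  tr_act {X Y} g s m := by
    refine Box.hom_congr (boxLeftAct φ hφ Y (S.tr g s))
      (((Box.tr g).comp (boxLeftAct φ hφ X s)).comp (Box.res g)) (fun {P} k m n => ?_) m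
    have h := IsPullback.of_hasPullback k g
    rw [AddMonoidHom.comp_apply, AddMonoidHom.comp_apply, Box.res_mk h, boxLeftAct_mk,
      boxLeftAct_mk, Box.tr_mk, S.isMackey.base_change h.flip, φ.tr_act, Box.mk_tr_left, h.w]

/-- The additive maps underlying `boxRight`. -/
noncomputable def boxRightAct (φ : Operators S N.toMackey)
    (hφ : ∀ X (s : S.obj X) (r : R.obj X) (n : N.obj X),
      φ.act X s (r • n) = r • (φ.act X s n : N.obj X)) (X : C) :
    S.obj X →+ Box M N X →+ Box M N X :=
  AddMonoidHom.mk' (fun s => Box.lift (A := Box M N X)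
      (fun {Y} f m n => Box.mk M N f m (φ.act Y (S.res f s) n))
      { add_left := fun _ _ _ _ => Box.mk_add_left _ _ _ _
        add_right := fun _ _ _ _ => by rw [map_add, Box.mk_add_right]
        tr_left := fun h f m n => by
          rw [Box.mk_tr_left, φ.res_act, S.isMackey.res_comp]
        tr_right := fun h f m n => by
          rw [φ.act_tr, Box.mk_tr_right, S.isMackey.res_comp]
        balanced := fun f r m n => by rw [hφ, Box.mk_balanced] })
    (fun s t => Box.hom_ext fun f m n => by
      rw [AddMonoidHom.add_apply, Box.lift_mk, Box.lift_mk, Box.lift_mk, map_add, map_add,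
        AddMonoidHom.add_apply, Box.mk_add_right])

theorem boxRightAct_mk (φ : Operators S N.toMackey)
    (hφ : ∀ X (s : S.obj X) (r : R.obj X) (n : N.obj X),
      φ.act X s (r • n) = r • (φ.act X s n : N.obj X)) {X Y : C} (s : S.obj X)
    (f : Y ⟶ X) (m : M.obj Y) (n : N.obj Y) :
    boxRightAct (M := M) φ hφ X s (Box.mk M N f m n) =
      Box.mk M N f m (φ.act Y (S.res f s) n) := by
  rw [boxRightAct, AddMonoidHom.mk'_apply, Box.lift_mk]

/-- Operators on the right factor of `M ⊠_R N`: `s (m ⊗ n) = m ⊗ (s n)`. -/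
noncomputable def boxRight (φ : Operators S N.toMackey)
    (hφ : ∀ X (s : S.obj X) (r : R.obj X) (n : N.obj X),
      φ.act X s (r • n) = r • (φ.act X s n : N.obj X)) :
    Operators S (boxProduct M N) where
  act := boxRightAct φ hφ
  res_act {X Y} g s m := by
    refine Box.hom_congr ((Box.res g).comp (boxRightAct φ hφ Y s))
      ((boxRightAct φ hφ X (S.res g s)).comp (Box.res g)) (fun {P} k m n => ?_) m
    have h := IsPullback.of_hasPullback k g
    rw [AddMonoidHom.comp_apply, AddMonoidHom.comp_apply, Box.res_mk h, boxRightAct_mk,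
      boxRightAct_mk, Box.res_mk h, φ.res_act, ← S.isMackey.res_comp, ← S.isMackey.res_comp, h.w]
  act_tr {X Y} g s m := by
    refine Box.hom_congr ((boxRightAct φ hφ Y s).comp (Box.tr g))
      ((Box.tr g).comp (boxRightAct φ hφ X (S.res g s))) (fun {P} k m n => ?_) m
    rw [AddMonoidHom.comp_apply, AddMonoidHom.comp_apply, Box.tr_mk, boxRightAct_mk,
      boxRightAct_mk, Box.tr_mk, S.isMackey.res_comp]
  tr_act {X Y} g s m := by
    refine Box.hom_congr (boxRightAct φ hφ Y (S.tr g s))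
      (((Box.tr g).comp (boxRightAct φ hφ X s)).comp (Box.res g)) (fun {P} k m n => ?_) m
    have h := IsPullback.of_hasPullback k g
    rw [AddMonoidHom.comp_apply, AddMonoidHom.comp_apply, Box.res_mk h, boxRightAct_mk,
      boxRightAct_mk, Box.tr_mk, S.isMackey.base_change h.flip, φ.tr_act, Box.mk_tr_right, h.w]

end

section

variable {K : GreenFunctor C} {A : RightGModule K} {B : GModule K} {M : MackeyFunctor C}

/-- The additive maps underlying `box`. -/
noncomputable def boxAct (φ : Operators A.toMackey M) (ψ : Operators B.toMackey M)
    (hb : ∀ X (k : K.obj X) (a : A.obj X) (b : B.obj X) (m : M.obj X),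
      φ.act X (K.toOp k • a : A.obj X) (ψ.act X b m) = φ.act X a (ψ.act X (k • b : B.obj X) m))
    (X : C) : Box A B X →+ M.obj X →+ M.obj X :=
  Box.lift (fun {Y} f a b =>
      (M.tr f).comp (((φ.act Y a).comp (ψ.act Y b)).comp (M.res f)))
    { add_left := fun f a a' b => AddMonoidHom.ext fun m => by simp
      add_right := fun f a b b' => AddMonoidHom.ext fun m => by simp
      tr_left := fun {Y Z} h f a b => AddMonoidHom.ext fun m => by
        have e := φ.tr_act h a (ψ.act Z b (M.res f m))
        rw [ψ.res_act] at e
        simp only [AddMonoidHom.comp_apply]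
        rw [M.isMackey.tr_comp, M.isMackey.res_comp]
        exact congrArg _ e
      tr_right := fun {Y Z} h f a b => AddMonoidHom.ext fun m => by
        have e := congrArg (φ.act Z a) (ψ.tr_act h b (M.res f m))
        rw [φ.act_tr] at e
        simp only [AddMonoidHom.comp_apply]
        rw [M.isMackey.tr_comp, M.isMackey.res_comp]
        exact congrArg _ e
      balanced := fun f k a b => AddMonoidHom.ext fun m => congrArg _ (hb _ k a b _) }

variable (φ : Operators A.toMackey M) (ψ : Operators B.toMackey M)
    (hb : ∀ X (k : K.obj X) (a : A.obj X) (b : B.obj X) (m : M.obj X),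
      φ.act X (K.toOp k • a : A.obj X) (ψ.act X b m) = φ.act X a (ψ.act X (k • b : B.obj X) m))

theorem boxAct_mk {X Y : C} (f : Y ⟶ X) (a : A.obj Y) (b : B.obj Y) (m : M.obj X) :
    boxAct φ ψ hb X (Box.mk A B f a b) m =
      M.tr f (φ.act Y a (ψ.act Y b (M.res f m))) :=
  DFunLike.congr_fun (Box.lift_mk (M := A) (N := B) _ _ _ _ _) m

/-- Operators of `A ⊠_K B` on `M` obtained from operators of `A` and of `B`:
`(a ⊗ b) m = a (b m)`. -/
noncomputable def box : Operators (boxProduct A B) M where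
  act := boxAct φ ψ hb
  res_act {X Y} g z m := by
    refine Box.hom_congr ((M.res g).comp ((boxAct φ ψ hb Y).flip m))
      (((boxAct φ ψ hb X).flip (M.res g m)).comp (Box.res g)) (fun {P} k a b => ?_) z
    have h := IsPullback.of_hasPullback k g
    rw [AddMonoidHom.comp_apply, AddMonoidHom.comp_apply, Box.res_mk h, AddMonoidHom.flip_apply,
      AddMonoidHom.flip_apply, boxAct_mk, boxAct_mk, M.isMackey.base_change h, φ.res_act,
      ψ.res_act, ← M.isMackey.res_comp, ← M.isMackey.res_comp, h.w]
  act_tr {X Y} g z m := by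
    refine Box.hom_congr ((boxAct φ ψ hb Y).flip (M.tr g m))
      ((M.tr g).comp (((boxAct φ ψ hb X).flip m).comp (Box.res g))) (fun {P} k a b => ?_) z
    have h := IsPullback.of_hasPullback k g
    rw [AddMonoidHom.comp_apply, AddMonoidHom.comp_apply, Box.res_mk h, AddMonoidHom.flip_apply,
      AddMonoidHom.flip_apply, boxAct_mk, boxAct_mk, M.isMackey.base_change h.flip, ψ.act_tr,
      φ.act_tr, ← M.isMackey.tr_comp, ← M.isMackey.tr_comp, h.w]
  tr_act {X Y} g z m := by
    refine Box.hom_congr (((boxAct φ ψ hb Y).flip m).comp (Box.tr g))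
      ((M.tr g).comp ((boxAct φ ψ hb X).flip (M.res g m))) (fun {P} k a b => ?_) z
    rw [AddMonoidHom.comp_apply, AddMonoidHom.comp_apply, Box.tr_mk, AddMonoidHom.flip_apply,
      AddMonoidHom.flip_apply, boxAct_mk, boxAct_mk, M.isMackey.res_comp, M.isMackey.tr_comp]

end

end Operators

end BoxActions


/-! ## Algebras over a Green functor and their enveloping algebras -/

section Algebras

variable {C : Type u} [Category.{u} C]

/-- A (not necessarily commutative) algebra over a Green functor `K`: a Green functor with a
morphism from `K` whose values are central. -/
structure GAlgebra (K : GreenFunctor C) where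
  toGreen : GreenFunctor C
  unit : GreenHom K toGreen
  central : ∀ (X : C) (k : K.obj X) (a : toGreen.obj X), unit.app X k * a = a * unit.app X k

namespace GAlgebra

variable {K : GreenFunctor C} (A B : GAlgebra K)

/-- The opposite algebra. -/
def op : GAlgebra K where
  toGreen := A.toGreen.op
  unit :=
    { app := fun X =>
        { toFun := fun k => A.toGreen.toOp (A.unit.app X k)
          map_one' := congrArg A.toGreen.toOp (map_one (A.unit.app X))
          map_mul' := fun k l => congrArg A.toGreen.toOp
            ((map_mul (A.unit.app X) k l).trans (A.central X k (A.unit.app X l)))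
          map_zero' := congrArg A.toGreen.toOp (map_zero (A.unit.app X))
          map_add' := fun k l => congrArg A.toGreen.toOp (map_add (A.unit.app X) k l) }
      app_res := fun f k => congrArg A.toGreen.toOp (A.unit.app_res f k)
      app_tr := fun f k => congrArg A.toGreen.toOp (A.unit.app_tr f k) }
  central X k a := congrArg A.toGreen.toOp (A.central X k (A.toGreen.ofOp a)).symm

/-- `A` as a left `K`-module. -/
def leftMod : GModule K := A.toGreen.self.restrict A.unit

/-- `A` as a right `K`-module. -/
def rightMod : RightGModule K := A.toGreen.rself.restrict A.unit.op

/-- Left multiplication on `A`, with `A` regarded as a right `K`-module. -/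
def mulOperators : Operators A.rightMod.toMackey A.rightMod.toMackey :=
  A.toGreen.self.operators

/-- Left multiplication on `A`, with `A` regarded as a left `K`-module. -/
def mulOperators' : Operators A.leftMod.toMackey A.leftMod.toMackey :=
  A.toGreen.self.operators

theorem mulOperators_smul (X : C) (a : A.rightMod.obj X) (k : K.obj X) (x : A.rightMod.obj X) :
    A.mulOperators.act X a (K.toOp k • x) = K.toOp k • (A.mulOperators.act X a x : A.rightMod.obj X) :=
  (mul_assoc (G := A.toGreen.obj X) a x (A.unit.app X k)).symm

theorem mulOperators'_smul (X : C) (a : A.leftMod.obj X) (k : K.obj X) (x : A.leftMod.obj X) :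
    A.mulOperators'.act X a (k • x) = k • (A.mulOperators'.act X a x : A.leftMod.obj X) := by
  have e : ∀ a x : A.toGreen.obj X, a * (A.unit.app X k * x) = A.unit.app X k * (a * x) := by
    intro a x
    rw [← mul_assoc, ← mul_assoc, A.central X k a]
  exact e a x

variable [HasFiniteLimits C] [FinitaryExtensive C]

/-- Left multiplication by `A` on `A ⊠_K B`. -/
noncomputable def tensorLeft :
    Operators A.rightMod.toMackey (boxProduct A.rightMod B.leftMod) :=
  A.mulOperators.boxLeft A.mulOperators_smul

/-- Left multiplication by `B` on `A ⊠_K B`. -/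
noncomputable def tensorRight :
    Operators B.leftMod.toMackey (boxProduct A.rightMod B.leftMod) :=
  B.mulOperators'.boxRight B.mulOperators'_smul

variable {A B}

theorem tensorLeft_mk {X Y : C} (a : A.rightMod.obj X) (f : Y ⟶ X) (x : A.rightMod.obj Y)
    (y : B.leftMod.obj Y) :
    (A.tensorLeft B).act X a (Box.mk A.rightMod B.leftMod f x y) =
      Box.mk A.rightMod B.leftMod f (A.mulOperators.act Y (A.rightMod.res f a) x) y :=
  Operators.boxLeftAct_mk _ A.mulOperators_smul _ _ _ _

theorem tensorRight_mk {X Y : C} (b : B.leftMod.obj X) (f : Y ⟶ X) (x : A.rightMod.obj Y)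
    (y : B.leftMod.obj Y) :
    (A.tensorRight B).act X b (Box.mk A.rightMod B.leftMod f x y) =
      Box.mk A.rightMod B.leftMod f x (B.mulOperators'.act Y (B.leftMod.res f b) y) :=
  Operators.boxRightAct_mk _ B.mulOperators'_smul _ _ _ _

variable (A B)

theorem mulOperators_toOp_smul (X : C) (k : K.obj X) (a x : A.rightMod.obj X) :
    (A.mulOperators.act X (K.toOp k • a : A.rightMod.obj X) x : A.rightMod.obj X) =
      (K.toOp k • (A.mulOperators.act X a x : A.rightMod.obj X) : A.rightMod.obj X) := by
  have e : ∀ a x : A.toGreen.obj X, a * A.unit.app X k * x = a * x * A.unit.app X k := by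
    intro a x
    rw [mul_assoc, mul_assoc, A.central]
  exact e a x

theorem mulOperators'_smul_left (X : C) (k : K.obj X) (b y : B.leftMod.obj X) :
    (B.mulOperators'.act X (k • b : B.leftMod.obj X) y : B.leftMod.obj X) =
      (k • (B.mulOperators'.act X b y : B.leftMod.obj X) : B.leftMod.obj X) :=
  mul_assoc (G := B.toGreen.obj X) (B.unit.app X k) b y

theorem tensor_balanced (X : C) (k : K.obj X) (a : A.rightMod.obj X) (b : B.leftMod.obj X)
    (z : Box A.rightMod B.leftMod X) :
    (A.tensorLeft B).act X (K.toOp k • a : A.rightMod.obj X) ((A.tensorRight B).act X b z) =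
      (A.tensorLeft B).act X a ((A.tensorRight B).act X (k • b : B.leftMod.obj X) z) := by
  refine Box.hom_congr
    (((A.tensorLeft B).act X (K.toOp k • a : A.rightMod.obj X)).comp ((A.tensorRight B).act X b))
    (((A.tensorLeft B).act X a).comp ((A.tensorRight B).act X (k • b : B.leftMod.obj X)))
    (fun {Y} f x y => ?_) z
  rw [AddMonoidHom.comp_apply, AddMonoidHom.comp_apply, tensorRight_mk, tensorRight_mk,
    tensorLeft_mk, tensorLeft_mk, B.leftMod.res_smul, mulOperators'_smul_left]
  refine Eq.trans ?_ (Box.mk_balanced f (K.res f k) _ _)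
  rw [← mulOperators_toOp_smul]
  exact congrArg (fun t : A.rightMod.obj Y => Box.mk A.rightMod B.leftMod f
    (A.mulOperators.act Y t x) (B.mulOperators'.act Y (B.leftMod.res f b) y))
    (A.rightMod.res_smul f (K.toOp k) a)

/-- The multiplication of `A ⊠_K B`, given on pure tensors by `(a ⊗ b)(a' ⊗ b') = aa' ⊗ bb'`. -/
noncomputable def tensorMul :
    Operators (boxProduct A.rightMod B.leftMod) (boxProduct A.rightMod B.leftMod) :=
  (A.tensorLeft B).box (A.tensorRight B) (A.tensor_balanced B)

variable {A B}

theorem tensorMul_mk {X Y : C} (f : Y ⟶ X) (a : A.rightMod.obj Y) (b : B.leftMod.obj Y)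
    (z : Box A.rightMod B.leftMod X) :
    (A.tensorMul B).act X (Box.mk A.rightMod B.leftMod f a b) z =
      Box.tr f ((A.tensorLeft B).act Y a ((A.tensorRight B).act Y b (Box.res f z))) :=
  Operators.boxAct_mk _ _ (A.tensor_balanced B) _ _ _ _

section

variable {M : MackeyFunctor C} (φ : Operators A.rightMod.toMackey M)
  (ψ : Operators B.leftMod.toMackey M)
  (hb : ∀ X (k : K.obj X) (a : A.rightMod.obj X) (b : B.leftMod.obj X) (m : M.obj X),
      φ.act X (K.toOp k • a : A.rightMod.obj X) (ψ.act X b m) =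
        φ.act X a (ψ.act X (k • b : B.leftMod.obj X) m))

/-- Multiplicative commuting operators of `A` and `B` give multiplicative operators of
`A ⊠_K B`. -/
theorem box_act_mul
    (hc : ∀ X (a : A.rightMod.obj X) (b : B.leftMod.obj X) (m : M.obj X),
      φ.act X a (ψ.act X b m) = ψ.act X b (φ.act X a m))
    (hφ : ∀ X (a a' : A.rightMod.obj X) (m : M.obj X),
      φ.act X (A.mulOperators.act X a a') m = φ.act X a (φ.act X a' m))
    (hψ : ∀ X (b b' : B.leftMod.obj X) (m : M.obj X),
      ψ.act X (B.mulOperators'.act X b b') m = ψ.act X b (ψ.act X b' m))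
    {X : C} (z w : Box A.rightMod B.leftMod X) (m : M.obj X) :
    Operators.boxAct φ ψ hb X ((A.tensorMul B).act X z w) m =
      Operators.boxAct φ ψ hb X z (Operators.boxAct φ ψ hb X w m) := by
  have h1 : ∀ {X : C} (a : A.rightMod.obj X) (w : Box A.rightMod B.leftMod X) (m : M.obj X),
      Operators.boxAct φ ψ hb X ((A.tensorLeft B).act X a w) m =
        φ.act X a (Operators.boxAct φ ψ hb X w m) := by
    intro X a w m
    refine Box.hom_congr (((Operators.boxAct φ ψ hb X).flip m).comp ((A.tensorLeft B).act X a))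
      ((φ.act X a).comp ((Operators.boxAct φ ψ hb X).flip m)) (fun {Y} g x y => ?_) w
    rw [AddMonoidHom.comp_apply, AddMonoidHom.comp_apply, tensorLeft_mk, AddMonoidHom.flip_apply,
      AddMonoidHom.flip_apply, Operators.boxAct_mk, Operators.boxAct_mk, hφ, φ.act_tr]
  have h2 : ∀ {X : C} (b : B.leftMod.obj X) (w : Box A.rightMod B.leftMod X) (m : M.obj X),
      Operators.boxAct φ ψ hb X ((A.tensorRight B).act X b w) m =
        ψ.act X b (Operators.boxAct φ ψ hb X w m) := by
    intro X b w m
    refine Box.hom_congr (((Operators.boxAct φ ψ hb X).flip m).comp ((A.tensorRight B).act X b))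
      ((ψ.act X b).comp ((Operators.boxAct φ ψ hb X).flip m)) (fun {Y} g x y => ?_) w
    rw [AddMonoidHom.comp_apply, AddMonoidHom.comp_apply, tensorRight_mk, AddMonoidHom.flip_apply,
      AddMonoidHom.flip_apply, Operators.boxAct_mk, Operators.boxAct_mk, hψ, ψ.act_tr, hc]
  refine Box.hom_congr
    (((Operators.boxAct φ ψ hb X).flip m).comp ((A.tensorMul B).act X |>.flip w))
    ((Operators.boxAct φ ψ hb X).flip (Operators.boxAct φ ψ hb X w m)) (fun {Y} f a b => ?_) z
  rw [AddMonoidHom.comp_apply, AddMonoidHom.flip_apply, AddMonoidHom.flip_apply,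
    AddMonoidHom.flip_apply, tensorMul_mk, Operators.boxAct_mk]
  have h3 := (φ.box ψ hb).tr_act f
    ((A.tensorLeft B).act Y a ((A.tensorRight B).act Y b (Box.res f w))) m
  have h4 := (φ.box ψ hb).res_act f w m
  refine h3.trans (congrArg (M.tr f) ?_)
  refine (h1 _ _ _).trans ?_
  rw [h2]
  exact congrArg (fun t => φ.act Y a (ψ.act Y b t)) h4.symm

/-- Antimultiplicative commuting operators of `A` and `B` give antimultiplicative operators of
`A ⊠_K B`. -/
theorem box_act_mul_rev
    (hc : ∀ X (a : A.rightMod.obj X) (b : B.leftMod.obj X) (m : M.obj X),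
      φ.act X a (ψ.act X b m) = ψ.act X b (φ.act X a m))
    (hφ : ∀ X (a a' : A.rightMod.obj X) (m : M.obj X),
      φ.act X (A.mulOperators.act X a a') m = φ.act X a' (φ.act X a m))
    (hψ : ∀ X (b b' : B.leftMod.obj X) (m : M.obj X),
      ψ.act X (B.mulOperators'.act X b b') m = ψ.act X b' (ψ.act X b m))
    {X : C} (z w : Box A.rightMod B.leftMod X) (m : M.obj X) :
    Operators.boxAct φ ψ hb X ((A.tensorMul B).act X z w) m =
      Operators.boxAct φ ψ hb X w (Operators.boxAct φ ψ hb X z m) := by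
  have h1 : ∀ {X : C} (a : A.rightMod.obj X) (w : Box A.rightMod B.leftMod X) (m : M.obj X),
      Operators.boxAct φ ψ hb X ((A.tensorLeft B).act X a w) m =
        Operators.boxAct φ ψ hb X w (φ.act X a m) := by
    intro X a w m
    refine Box.hom_congr (((Operators.boxAct φ ψ hb X).flip m).comp ((A.tensorLeft B).act X a))
      ((Operators.boxAct φ ψ hb X).flip (φ.act X a m)) (fun {Y} g x y => ?_) w
    rw [AddMonoidHom.comp_apply, tensorLeft_mk, AddMonoidHom.flip_apply,
      AddMonoidHom.flip_apply, Operators.boxAct_mk, Operators.boxAct_mk, hφ, φ.res_act, ← hc]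
  have h2 : ∀ {X : C} (b : B.leftMod.obj X) (w : Box A.rightMod B.leftMod X) (m : M.obj X),
      Operators.boxAct φ ψ hb X ((A.tensorRight B).act X b w) m =
        Operators.boxAct φ ψ hb X w (ψ.act X b m) := by
    intro X b w m
    refine Box.hom_congr (((Operators.boxAct φ ψ hb X).flip m).comp ((A.tensorRight B).act X b))
      ((Operators.boxAct φ ψ hb X).flip (ψ.act X b m)) (fun {Y} g x y => ?_) w
    rw [AddMonoidHom.comp_apply, tensorRight_mk, AddMonoidHom.flip_apply,
      AddMonoidHom.flip_apply, Operators.boxAct_mk, Operators.boxAct_mk, hψ, ψ.res_act]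
  refine Box.hom_congr
    (((Operators.boxAct φ ψ hb X).flip m).comp ((A.tensorMul B).act X |>.flip w))
    ((Operators.boxAct φ ψ hb X w).comp ((Operators.boxAct φ ψ hb X).flip m))
    (fun {Y} f a b => ?_) z
  rw [AddMonoidHom.comp_apply, AddMonoidHom.flip_apply, AddMonoidHom.flip_apply,
    AddMonoidHom.comp_apply, AddMonoidHom.flip_apply, tensorMul_mk, Operators.boxAct_mk]
  have h3 := (φ.box ψ hb).tr_act f
    ((A.tensorLeft B).act Y a ((A.tensorRight B).act Y b (Box.res f w))) m
  have h4 := (φ.box ψ hb).act_tr f w (φ.act Y a (ψ.act Y b (M.res f m)))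
  refine h3.trans (Eq.trans (congrArg (M.tr f) ?_) h4.symm)
  refine (h1 _ _ _).trans ?_
  rw [h2]
  exact congrArg (Operators.boxAct φ ψ hb Y (Box.res f w)) (hc _ _ _ _).symm

end

end GAlgebra

end Algebras


section Enveloping

variable {C : Type u} [Category.{u} C]

/-- The module defined by unital multiplicative operators. -/
def GModule.ofOperators {R : GreenFunctor C} {M : MackeyFunctor C} (φ : Operators R.toMackey M)
    (one : ∀ X (m : M.obj X), φ.act X (1 : R.obj X) m = m)
    (mul : ∀ X (r s : R.obj X) (m : M.obj X),
      φ.act X (r * s : R.obj X) m = φ.act X r (φ.act X s m)) : GModule R where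
  obj := M.obj
  mod X :=
    { smul := fun r m => φ.act X r m
      one_smul := one X
      mul_smul := mul X
      smul_zero := fun r => map_zero (φ.act X r)
      smul_add := fun r => map_add (φ.act X r)
      add_smul := fun r s m => DFunLike.congr_fun (map_add (φ.act X) r s) m
      zero_smul := fun m => DFunLike.congr_fun (map_zero (φ.act X)) m }
  res := M.res
  tr := M.tr
  isMackey := M.isMackey
  res_smul := φ.res_act
  smul_tr := φ.act_tr
  tr_smul := φ.tr_act

/-- A bimodule over a `K`-algebra: a Mackey functor with commuting left and right module
structures whose restrictions to `K` agree. -/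
structure Bimodule {K : GreenFunctor C} (A : GAlgebra K) where
  obj : C → Type u
  [grp : ∀ X, AddCommGroup (obj X)]
  [lmod : ∀ X, Module (A.toGreen.obj X) (obj X)]
  [rmod : ∀ X, Module (A.toGreen.op.obj X) (obj X)]
  res : ∀ {X Y : C}, (X ⟶ Y) → obj Y →+ obj X
  tr : ∀ {X Y : C}, (X ⟶ Y) → obj X →+ obj Y
  isMackey : IsMackey obj res tr
  res_smul : ∀ {X Y : C} (f : X ⟶ Y) (r : A.toGreen.obj Y) (m : obj Y),
    res f (r • m) = A.toGreen.res f r • res f m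
  smul_tr : ∀ {X Y : C} (f : X ⟶ Y) (r : A.toGreen.obj Y) (m : obj X),
    r • tr f m = tr f (A.toGreen.res f r • m)
  tr_smul : ∀ {X Y : C} (f : X ⟶ Y) (r : A.toGreen.obj X) (m : obj Y),
    A.toGreen.tr f r • m = tr f (r • res f m)
  res_rsmul : ∀ {X Y : C} (f : X ⟶ Y) (r : A.toGreen.op.obj Y) (m : obj Y),
    res f (r • m) = A.toGreen.op.res f r • res f m
  rsmul_tr : ∀ {X Y : C} (f : X ⟶ Y) (r : A.toGreen.op.obj Y) (m : obj X),
    r • tr f m = tr f (A.toGreen.op.res f r • m)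
  tr_rsmul : ∀ {X Y : C} (f : X ⟶ Y) (r : A.toGreen.op.obj X) (m : obj Y),
    A.toGreen.op.tr f r • m = tr f (r • res f m)
  smul_rsmul : ∀ {X : C} (a : A.toGreen.obj X) (b : A.toGreen.op.obj X) (m : obj X),
    a • b • m = b • a • m
  unit_smul : ∀ {X : C} (k : K.obj X) (m : obj X),
    A.unit.app X k • m = A.toGreen.toOp (A.unit.app X k) • m

attribute [instance] Bimodule.grp Bimodule.lmod Bimodule.rmod

namespace Bimodule

variable {K : GreenFunctor C} {A : GAlgebra K} (M : Bimodule A)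

/-- The left module underlying a bimodule. -/
def left : GModule A.toGreen where
  obj := M.obj
  res := M.res
  tr := M.tr
  isMackey := M.isMackey
  res_smul := M.res_smul
  smul_tr := M.smul_tr
  tr_smul := M.tr_smul

/-- The right module underlying a bimodule. -/
def right : RightGModule A.toGreen where
  obj := M.obj
  res := M.res
  tr := M.tr
  isMackey := M.isMackey
  res_smul := M.res_rsmul
  smul_tr := M.rsmul_tr
  tr_smul := M.tr_rsmul

/-- The Mackey functor underlying a bimodule. -/
@[reducible] def toMackey : MackeyFunctor C where
  obj := M.obj
  res := M.res
  tr := M.tr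
  isMackey := M.isMackey

end Bimodule

/-- The regular bimodule of an algebra. -/
def GAlgebra.regular {K : GreenFunctor C} (A : GAlgebra K) : Bimodule A where
  obj := A.toGreen.obj
  rmod X := A.toGreen.rself.mod X
  res := A.toGreen.res
  tr := A.toGreen.tr
  isMackey := A.toGreen.isMackey
  res_smul := A.toGreen.self.res_smul
  smul_tr := A.toGreen.self.smul_tr
  tr_smul := A.toGreen.self.tr_smul
  res_rsmul := A.toGreen.rself.res_smul
  rsmul_tr := A.toGreen.rself.smul_tr
  tr_rsmul := A.toGreen.rself.tr_smul
  smul_rsmul {X} a b m := (mul_assoc (G := A.toGreen.obj X) a m (A.toGreen.ofOp b)).symm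
  unit_smul {X} k m := A.central X k m

variable [HasFiniteLimits C] [FinitaryExtensive C]

namespace GAlgebra

variable {K : GreenFunctor C} (A B : GAlgebra K)

/-- The unit of `A`, with `A` regarded as a right `K`-module. -/
def one (X : C) : A.rightMod.obj X := (1 : A.toGreen.obj X)

/-- The unit of `A`, with `A` regarded as a left `K`-module. -/
def one' (X : C) : A.leftMod.obj X := (1 : A.toGreen.obj X)

theorem boxAct_one {A B : GAlgebra K} {M : MackeyFunctor C} (φ : Operators A.rightMod.toMackey M)
    (ψ : Operators B.leftMod.toMackey M)
    (hb : ∀ X (k : K.obj X) (a : A.rightMod.obj X) (b : B.leftMod.obj X) (m : M.obj X),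
      φ.act X (K.toOp k • a : A.rightMod.obj X) (ψ.act X b m) =
        φ.act X a (ψ.act X (k • b : B.leftMod.obj X) m))
    (hφ : ∀ X (m : M.obj X), φ.act X (A.one X) m = m)
    (hψ : ∀ X (m : M.obj X), ψ.act X (B.one' X) m = m) (X : C) (m : M.obj X) :
    Operators.boxAct φ ψ hb X (Box.mk A.rightMod B.leftMod (𝟙 X) (A.one X)
      (B.one' X)) m = m := by
  rw [Operators.boxAct_mk, hφ, hψ, M.isMackey.res_id, M.isMackey.tr_id]

theorem tensorLeft_one (X : C) (z : Box A.rightMod B.leftMod X) :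
    (A.tensorLeft B).act X (A.one X) z = z := by
  refine Box.hom_congr ((A.tensorLeft B).act X (A.one X)) (AddMonoidHom.id _)
    (fun {Y} f x y => (tensorLeft_mk _ _ _ _).trans ?_) z
  have e : A.mulOperators.act Y (A.rightMod.res f (A.one X)) x = x :=
    (show ∀ t : A.toGreen.obj Y, A.toGreen.res f 1 * t = t by
      intro t; rw [A.toGreen.res_one, one_mul]) x
  rw [e]
  rfl

theorem tensorRight_one (X : C) (z : Box A.rightMod B.leftMod X) :
    (A.tensorRight B).act X (B.one' X) z = z := by
  refine Box.hom_congr ((A.tensorRight B).act X (B.one' X)) (AddMonoidHom.id _)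
    (fun {Y} f x y => (tensorRight_mk _ _ _ _).trans ?_) z
  have e : B.mulOperators'.act Y (B.leftMod.res f (B.one' X)) y = y :=
    (show ∀ t : B.toGreen.obj Y, B.toGreen.res f 1 * t = t by
      intro t; rw [B.toGreen.res_one, one_mul]) y
  rw [e]
  rfl

theorem tensorLeft_mul (X : C) (a a' : A.rightMod.obj X) (z : Box A.rightMod B.leftMod X) :
    (A.tensorLeft B).act X (A.mulOperators.act X a a') z =
      (A.tensorLeft B).act X a ((A.tensorLeft B).act X a' z) := by
  refine Box.hom_congr ((A.tensorLeft B).act X (A.mulOperators.act X a a'))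
    (((A.tensorLeft B).act X a).comp ((A.tensorLeft B).act X a')) (fun {Y} f x y => ?_) z
  rw [AddMonoidHom.comp_apply, tensorLeft_mk, tensorLeft_mk, tensorLeft_mk]
  have e : A.mulOperators.act Y (A.rightMod.res f (A.mulOperators.act X a a')) x =
      A.mulOperators.act Y (A.rightMod.res f a) (A.mulOperators.act Y (A.rightMod.res f a') x) :=
    (show ∀ (r s : A.toGreen.obj X) (t : A.toGreen.obj Y), A.toGreen.res f (r * s) * t =
        A.toGreen.res f r * (A.toGreen.res f s * t) by
      intro r s t; rw [A.toGreen.res_mul, mul_assoc]) a a' x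
  rw [e]

theorem tensorRight_mul (X : C) (b b' : B.leftMod.obj X) (z : Box A.rightMod B.leftMod X) :
    (A.tensorRight B).act X (B.mulOperators'.act X b b') z =
      (A.tensorRight B).act X b ((A.tensorRight B).act X b' z) := by
  refine Box.hom_congr ((A.tensorRight B).act X (B.mulOperators'.act X b b'))
    (((A.tensorRight B).act X b).comp ((A.tensorRight B).act X b')) (fun {Y} f x y => ?_) z
  rw [AddMonoidHom.comp_apply, tensorRight_mk, tensorRight_mk, tensorRight_mk]
  have e : B.mulOperators'.act Y (B.leftMod.res f (B.mulOperators'.act X b b')) y =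
      B.mulOperators'.act Y (B.leftMod.res f b) (B.mulOperators'.act Y (B.leftMod.res f b') y) :=
    (show ∀ (r s : B.toGreen.obj X) (t : B.toGreen.obj Y), B.toGreen.res f (r * s) * t =
        B.toGreen.res f r * (B.toGreen.res f s * t) by
      intro r s t; rw [B.toGreen.res_mul, mul_assoc]) b b' y
  rw [e]

theorem tensorLeft_tensorRight (X : C) (a : A.rightMod.obj X) (b : B.leftMod.obj X)
    (z : Box A.rightMod B.leftMod X) :
    (A.tensorLeft B).act X a ((A.tensorRight B).act X b z) =
      (A.tensorRight B).act X b ((A.tensorLeft B).act X a z) := by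
  refine Box.hom_congr (((A.tensorLeft B).act X a).comp ((A.tensorRight B).act X b))
    (((A.tensorRight B).act X b).comp ((A.tensorLeft B).act X a)) (fun {Y} f x y => ?_) z
  rw [AddMonoidHom.comp_apply, AddMonoidHom.comp_apply, tensorLeft_mk, tensorRight_mk,
    tensorRight_mk, tensorLeft_mk]

theorem tensorMul_one (X : C) (z : Box A.rightMod B.leftMod X) :
    (A.tensorMul B).act X z (Box.mk A.rightMod B.leftMod (𝟙 X) (A.one X)
      (B.one' X)) = z := by
  refine Box.hom_congr ((A.tensorMul B).act X |>.flip (Box.mk A.rightMod B.leftMod (𝟙 X)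
    (A.one X) (B.one' X))) (AddMonoidHom.id _) (fun {Y} f x y => ?_) z
  rw [AddMonoidHom.flip_apply, tensorMul_mk, Box.res_mk_id, tensorRight_mk, tensorLeft_mk]
  have e1 : A.mulOperators.act Y (A.rightMod.res (𝟙 Y) x)
      (A.rightMod.res f (A.one X)) = x := by
    refine Eq.trans ?_ (mul_one (M := A.toGreen.obj Y) x)
    exact congrArg₂ (fun s t : A.toGreen.obj Y => s * t) (A.toGreen.isMackey.res_id x)
      (A.toGreen.res_one f)
  have e2 : B.mulOperators'.act Y (B.leftMod.res (𝟙 Y) y)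
      (B.leftMod.res f (B.one' X)) = y := by
    refine Eq.trans ?_ (mul_one (M := B.toGreen.obj Y) y)
    exact congrArg₂ (fun s t : B.toGreen.obj Y => s * t) (B.toGreen.isMackey.res_id y)
      (B.toGreen.res_one f)
  rw [e1, e2, Box.tr_mk_id]
  rfl

end GAlgebra

/-- The Green functor `A ⊠_K B`, with `(a ⊗ b)(a' ⊗ b') = aa' ⊗ bb'`. -/
noncomputable def GAlgebra.tensor {K : GreenFunctor C} (A B : GAlgebra K) : GreenFunctor C where
  obj := Box A.rightMod B.leftMod
  ring X :=
    { (inferInstance : AddCommGroup (Box A.rightMod B.leftMod X)) with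
      mul := fun z w => (A.tensorMul B).act X z w
      one := Box.mk A.rightMod B.leftMod (𝟙 X) (A.one X) (B.one' X)
      left_distrib := fun z => map_add ((A.tensorMul B).act X z)
      right_distrib := fun z w v => DFunLike.congr_fun (map_add ((A.tensorMul B).act X) z w) v
      zero_mul := fun z => DFunLike.congr_fun (map_zero ((A.tensorMul B).act X)) z
      mul_zero := fun z => map_zero ((A.tensorMul B).act X z)
      mul_assoc := GAlgebra.box_act_mul (A.tensorLeft B) (A.tensorRight B) (A.tensor_balanced B)
        (A.tensorLeft_tensorRight B) (A.tensorLeft_mul B) (A.tensorRight_mul B)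
      one_mul := GAlgebra.boxAct_one (A.tensorLeft B) (A.tensorRight B) (A.tensor_balanced B)
        (A.tensorLeft_one B) (A.tensorRight_one B) X
      mul_one := A.tensorMul_one B X }
  res := Box.res
  tr := Box.tr
  isMackey := Box.isMackey
  res_one {X Y} f := (Box.res_mk_id f _ _).trans
    (congrArg₂ (fun (a : A.toGreen.obj X) (b : B.toGreen.obj X) =>
      Box.mk A.rightMod B.leftMod (𝟙 X) a b) (A.toGreen.res_one f) (B.toGreen.res_one f))
  res_mul := (A.tensorMul B).res_act
  tr_mul := (A.tensorMul B).tr_act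
  mul_tr := (A.tensorMul B).act_tr

/-- The enveloping algebra `A^e = A ⊠_K A^op`. -/
noncomputable def GAlgebra.env {K : GreenFunctor C} (A : GAlgebra K) : GreenFunctor C :=
  A.tensor A.op

namespace Bimodule

variable {K : GreenFunctor C} {A : GAlgebra K} (M : Bimodule A)

/-- The operators `m ↦ a m` of `A` on a bimodule. -/
def leftOps : Operators A.rightMod.toMackey M.toMackey := M.left.operators

/-- The operators `m ↦ m b` of `A^op` on a bimodule. -/
def rightOps : Operators A.op.leftMod.toMackey M.toMackey :=
  GModule.operators (R := A.toGreen.op) M.right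

/-- The operators `m ↦ m a`, with `A` regarded as the left factor of `A ⊠_K A^op`. -/
def leftOps' : Operators A.rightMod.toMackey M.toMackey :=
  RightGModule.operators (R := A.toGreen) M.right

/-- The operators `m ↦ b m`, with `A` regarded as the right factor of `A ⊠_K A^op`. -/
def rightOps' : Operators A.op.leftMod.toMackey M.toMackey :=
  Operators.ofOp (R := A.toGreen) (GModule.operators (R := A.toGreen) M.left)

theorem ops_balanced (X : C) (k : K.obj X) (a : A.rightMod.obj X) (b : A.op.leftMod.obj X)
    (m : M.obj X) :
    M.leftOps.act X (K.toOp k • a : A.rightMod.obj X) (M.rightOps.act X b m) =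
      M.leftOps.act X a (M.rightOps.act X (k • b : A.op.leftMod.obj X) m) := by
  have e : ∀ (a : A.toGreen.obj X) (b : A.toGreen.op.obj X),
      (a * A.unit.app X k) • b • m = a • (A.toGreen.toOp (A.unit.app X k) * b) • m := by
    intro a b
    rw [mul_smul, mul_smul, M.unit_smul]
  exact e a b

theorem ops'_balanced (X : C) (k : K.obj X) (a : A.rightMod.obj X) (b : A.op.leftMod.obj X)
    (m : M.obj X) :
    M.leftOps'.act X (K.toOp k • a : A.rightMod.obj X) (M.rightOps'.act X b m) =
      M.leftOps'.act X a (M.rightOps'.act X (k • b : A.op.leftMod.obj X) m) := by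
  have e : ∀ a b : A.toGreen.obj X,
      (A.toGreen.toOp (A.unit.app X k) * A.toGreen.toOp a) • b • m =
        A.toGreen.toOp a • (b * A.unit.app X k) • m := by
    intro a b
    rw [mul_smul, mul_smul, M.unit_smul, ← M.smul_rsmul, ← M.smul_rsmul, ← M.smul_rsmul,
      ← mul_smul (A.toGreen.toOp a), ← mul_smul (A.toGreen.toOp (A.unit.app X k))]
    exact congrArg (fun t : A.toGreen.obj X => b • A.toGreen.toOp t • m)
      (A.central X k a).symm
  exact e a (A.toGreen.ofOp b)

/-- A bimodule as a left module over the enveloping algebra: `(a ⊗ b) m = a m b`. -/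
noncomputable def toLeftEnv : GModule A.env :=
  GModule.ofOperators (R := A.env) (M := M.toMackey) (M.leftOps.box M.rightOps M.ops_balanced)
    (GAlgebra.boxAct_one M.leftOps M.rightOps M.ops_balanced
      (fun X m => one_smul (A.toGreen.obj X) m) (fun X m => one_smul (A.toGreen.op.obj X) m))
    (fun _ => GAlgebra.box_act_mul M.leftOps M.rightOps M.ops_balanced
      (fun _ a b m => M.smul_rsmul a b m)
      (fun X a a' m => mul_smul (α := A.toGreen.obj X) a a' m)
      (fun X b b' m => mul_smul (α := A.toGreen.op.obj X) b b' m))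

/-- A bimodule as a right module over the enveloping algebra: `m (a ⊗ b) = b m a`. -/
noncomputable def toRightEnv : RightGModule A.env :=
  GModule.ofOperators (R := A.env.op) (M := M.toMackey)
    (Operators.ofOp (R := A.env) (M.leftOps'.box M.rightOps' M.ops'_balanced))
    (GAlgebra.boxAct_one M.leftOps' M.rightOps' M.ops'_balanced
      (fun X m => one_smul (A.toGreen.op.obj X) m) (fun X m => one_smul (A.toGreen.obj X) m))
    (fun _ r s m => GAlgebra.box_act_mul_rev M.leftOps' M.rightOps' M.ops'_balanced
      (fun _ a b m => (M.smul_rsmul (A.toGreen.ofOp b) (A.toGreen.toOp a) m).symm)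
      (fun _ a a' m => mul_smul (A.toGreen.toOp a') (A.toGreen.toOp a) m)
      (fun _ b b' m => mul_smul (A.toGreen.ofOp b') (A.toGreen.ofOp b) m)
      (A.env.ofOp s) (A.env.ofOp r) m)

end Bimodule

end Enveloping


/-! ## Base change, resolutions and Tor -/

section BaseChange

variable {C : Type u} [Category.{u} C] [HasFiniteLimits C] [FinitaryExtensive C]

theorem boxMap_mk {R : GreenFunctor C} (M : RightGModule R) {N N' : GModule R}
    (ψ : GModuleHom N N') {X Y : C} (f : Y ⟶ X) (m : M.obj Y) (n : N.obj Y) :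
    (boxMap M ψ).app X (Box.mk M N f m n) = Box.mk M N' f m (ψ.app Y n) :=
  (BoxPairing.lift_mk _ f m n).trans (Box.tr_mk_id f m (ψ.app Y n))

section

variable {R S : GreenFunctor C} (φ : GreenHom R S)

/-- `S` as a right `R`-module via `φ : R → S`. -/
def rightVia : RightGModule R := S.rself.restrict φ.op

/-- Left multiplication on `S`, as operators on the right `R`-module `S`. -/
def rightViaOps : Operators S.toMackey (rightVia φ).toMackey := S.self.operators

theorem rightViaOps_smul (X : C) (s : S.obj X) (r : R.obj X) (x : (rightVia φ).obj X) :
    (rightViaOps φ).act X s (R.toOp r • x) =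
      R.toOp r • ((rightViaOps φ).act X s x : (rightVia φ).obj X) :=
  (mul_assoc (G := S.obj X) s x (φ.app X r)).symm

/-- Left multiplication by `S` on `S ⊠_R N`. -/
noncomputable def baseChangeOps (N : GModule R) :
    Operators S.toMackey (boxProduct (rightVia φ) N) :=
  (rightViaOps φ).boxLeft (rightViaOps_smul φ)

theorem baseChangeOps_mk (N : GModule R) {X Y : C} (s : S.obj X) (f : Y ⟶ X)
    (x : (rightVia φ).obj Y) (n : N.obj Y) :
    (baseChangeOps φ N).act X s (Box.mk (rightVia φ) N f x n) =
      Box.mk (rightVia φ) N f ((rightViaOps φ).act Y (S.res f s) x) n :=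
  Operators.boxLeftAct_mk _ (rightViaOps_smul φ) _ _ _ _

/-- The base change `S ⊠_R N` of an `R`-module along `φ : R → S`, with `s (s' ⊗ n) = s s' ⊗ n`. -/
noncomputable def baseChange (N : GModule R) : GModule S :=
  GModule.ofOperators (baseChangeOps φ N)
    (fun X z => by
      refine Box.hom_congr ((baseChangeOps φ N).act X (1 : S.obj X)) (AddMonoidHom.id _)
        (fun {Y} f x n => ?_) z
      have e : (rightViaOps φ).act Y (S.res f 1) x = x :=
        (show ∀ t : S.obj Y, S.res f 1 * t = t by intro t; rw [S.res_one, one_mul]) x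
      rw [baseChangeOps_mk, e]
      rfl)
    (fun X s t z => by
      refine Box.hom_congr ((baseChangeOps φ N).act X (s * t))
        (((baseChangeOps φ N).act X s).comp ((baseChangeOps φ N).act X t))
        (fun {Y} f x n => ?_) z
      have e : (rightViaOps φ).act Y (S.res f (s * t)) x =
          (rightViaOps φ).act Y (S.res f s) ((rightViaOps φ).act Y (S.res f t) x) :=
        (show ∀ y : S.obj Y, S.res f (s * t) * y = S.res f s * (S.res f t * y) by
          intro y; rw [S.res_mul, mul_assoc]) x
      rw [AddMonoidHom.comp_apply, baseChangeOps_mk, baseChangeOps_mk, baseChangeOps_mk, e])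

theorem baseChange_smul_mk (N : GModule R) {X Y : C} (s : S.obj X) (f : Y ⟶ X)
    (x : (rightVia φ).obj Y) (n : N.obj Y) :
    s • (show (baseChange φ N).obj X from Box.mk (rightVia φ) N f x n) =
      (show (baseChange φ N).obj X from
        Box.mk (rightVia φ) N f ((rightViaOps φ).act Y (S.res f s) x) n) :=
  baseChangeOps_mk φ N s f x n

/-- The `S`-linear map `S ⊠_R N → S ⊠_R N'`, `s ⊗ n ↦ s ⊗ ψ(n)`. -/
noncomputable def baseChangeMap {N N' : GModule R} (ψ : GModuleHom N N') :
    GModuleHom (baseChange φ N) (baseChange φ N') where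
  app X :=
    { toFun := (boxMap (rightVia φ) ψ).app X
      map_add' := ((boxMap (rightVia φ) ψ).app X).map_add
      map_smul' := fun s z => by
        refine Box.hom_congr
          (((boxMap (rightVia φ) ψ).app X).comp ((baseChangeOps φ N).act X s))
          (((baseChangeOps φ N').act X s).comp ((boxMap (rightVia φ) ψ).app X))
          (fun {Y} f x n => ?_) z
        rw [AddMonoidHom.comp_apply, AddMonoidHom.comp_apply, baseChangeOps_mk, boxMap_mk,
          boxMap_mk, baseChangeOps_mk] }
  app_res := (boxMap (rightVia φ) ψ).app_res
  app_tr := (boxMap (rightVia φ) ψ).app_tr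

/-- The pairing `S × N → N'`, `(s, n) ↦ s ψ(n)`, for an `R`-linear map `ψ : N → N'` to an
`S`-module. -/
def liftPairing {N : GModule R} {N' : GModule S} (ψ : GModuleHom N (N'.restrict φ)) :
    BoxPairing (rightVia φ) N N'.toMackey where
  toFun {X} s n := (show S.obj X from s) • (show N'.obj X from ψ.app X n)
  add_left {X} s t n := add_smul (R := S.obj X) s t (show N'.obj X from ψ.app X n)
  add_right {X} s n n' := by
    rw [map_add]
    exact smul_add (show S.obj X from s) (show N'.obj X from ψ.app X n) (ψ.app X n')
  res {X Y} h s n := by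
    rw [ψ.app_res]
    exact N'.res_smul h s (ψ.app Y n)
  tr_left {X Y} h s n := by
    rw [ψ.app_res]
    exact N'.tr_smul h s (ψ.app Y n)
  tr_right {X Y} h s n := by
    rw [ψ.app_tr]
    exact N'.smul_tr h s (ψ.app X n)
  balanced {X} r s n := by
    rw [map_smul]
    exact mul_smul (show S.obj X from s) (φ.app X r) (show N'.obj X from ψ.app X n)

/-- The `S`-linear map `S ⊠_R N → N'`, `s ⊗ n ↦ s ψ(n)`, adjoint to an `R`-linear map
`ψ : N → N'`. -/
noncomputable def baseChangeLift {N : GModule R} {N' : GModule S}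
    (ψ : GModuleHom N (N'.restrict φ)) : GModuleHom (baseChange φ N) N' where
  app X :=
    { toFun := (liftPairing φ ψ).lift.app X
      map_add' := ((liftPairing φ ψ).lift.app X).map_add
      map_smul' := fun s z => by
        refine Box.hom_congr
          (((liftPairing φ ψ).lift.app X).comp ((baseChangeOps φ N).act X s))
          ((N'.operators.act X s).comp ((liftPairing φ ψ).lift.app X))
          (fun {Y} f x n => ?_) z
        rw [AddMonoidHom.comp_apply, AddMonoidHom.comp_apply, baseChangeOps_mk,
          BoxPairing.lift_mk, BoxPairing.lift_mk]
        refine Eq.trans ?_ (N'.smul_tr f s _).symm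
        exact congrArg (N'.tr f) (mul_smul (S.res f s) (show S.obj Y from x)
          (show N'.obj Y from ψ.app Y n)) }
  app_res := (liftPairing φ ψ).lift.app_res
  app_tr := (liftPairing φ ψ).lift.app_tr

/-- The pure tensor `1 ⊗ n` in `S ⊠_R N`. -/
noncomputable def oneTmul (N : GModule R) {X : C} (n : N.obj X) : (baseChange φ N).obj X :=
  Box.mk (rightVia φ) N (𝟙 X) (1 : S.obj X) n

theorem oneTmul_add (N : GModule R) {X : C} (n n' : N.obj X) :
    oneTmul φ N (n + n') = oneTmul φ N n + oneTmul φ N n' :=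
  Box.mk_add_right _ _ _ _

theorem oneTmul_res (N : GModule R) {X Y : C} (h : X ⟶ Y) (n : N.obj Y) :
    (baseChange φ N).res h (oneTmul φ N n) = oneTmul φ N (N.res h n) :=
  (Box.res_mk_id h _ n).trans (congrArg (fun t : (rightVia φ).obj X =>
    Box.mk (rightVia φ) N (𝟙 X) t (N.res h n)) (S.res_one h))

theorem oneTmul_tr (N : GModule R) {X Y : C} (h : X ⟶ Y) (n : N.obj X) :
    oneTmul φ N (N.tr h n) = (baseChange φ N).tr h (oneTmul φ N n) := by
  refine ((BoxPairing.tmul (rightVia φ) N).tr_right h (1 : S.obj Y) n).trans ?_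
  exact congrArg (fun t : (rightVia φ).obj X => Box.tr h
    (Box.mk (rightVia φ) N (𝟙 X) t n)) (S.res_one h)

theorem oneTmul_smul (N : GModule R) {X : C} (r : R.obj X) (n : N.obj X) :
    oneTmul φ N (r • n) = φ.app X r • oneTmul φ N n := by
  refine (Box.mk_balanced (𝟙 X) r (show (rightVia φ).obj X from (1 : S.obj X)) n).symm.trans ?_
  refine Eq.trans ?_ (baseChange_smul_mk φ N (φ.app X r) (𝟙 X) (1 : S.obj X) n).symm
  refine congrArg (fun t : (rightVia φ).obj X => Box.mk (rightVia φ) N (𝟙 X) t n) ?_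
  have e : (1 : S.obj X) * φ.app X r = S.res (𝟙 X) (φ.app X r) * 1 := by
    rw [S.isMackey.res_id, one_mul, mul_one]
  exact e

/-- The canonical map `M ⊠_R N → M ⊠_S (S ⊠_R N)`, `m ⊗ n ↦ m ⊗ (1 ⊗ n)`, for a right `S`-module
`M` regarded as a right `R`-module via `φ`. -/
noncomputable def boxChange (M : RightGModule S) (N : GModule R) :
    MackeyHom (boxProduct (M.restrict φ.op) N) (boxProduct M (baseChange φ N)) :=
  BoxPairing.lift
    { toFun := fun {X} m n =>
        (BoxPairing.tmul M (baseChange φ N)).toFun (show M.obj X from m) (oneTmul φ N n)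
      add_left := fun m m' n => (BoxPairing.tmul M (baseChange φ N)).add_left m m' _
      add_right := fun m n n' => by rw [oneTmul_add, BoxPairing.add_right]
      res := fun h m n => by
        rw [BoxPairing.res, oneTmul_res]
        rfl
      tr_left := fun h m n => by
        rw [← oneTmul_res]
        exact (BoxPairing.tmul M (baseChange φ N)).tr_left h m _
      tr_right := fun h m n => by
        rw [oneTmul_tr]
        exact (BoxPairing.tmul M (baseChange φ N)).tr_right h m _
      balanced := fun {X} r m n => by
        rw [oneTmul_smul]
        exact (BoxPairing.tmul M (baseChange φ N)).balanced (φ.app X r) m _ }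

end

end BaseChange

section Homology

variable {C : Type u} [Category.{u} C]

/-- Composition of morphisms of Mackey functors. -/
def MackeyHom.comp {M N P : MackeyFunctor C} (ψ : MackeyHom N P) (φ : MackeyHom M N) :
    MackeyHom M P where
  app X := (ψ.app X).comp (φ.app X)
  app_res f y := (congrArg _ (φ.app_res f y)).trans (ψ.app_res f _)
  app_tr f y := (congrArg _ (φ.app_tr f y)).trans (ψ.app_tr f _)

/-- The zero morphism. -/
def MackeyHom.zero (M N : MackeyFunctor C) : MackeyHom M N where
  app _ := 0
  app_res _ _ := (map_zero _).symm
  app_tr _ _ := (map_zero _).symm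

/-- A morphism of modules, as a morphism of Mackey functors. -/
def GModuleHom.toMackeyHom {R : GreenFunctor C} {M N : GModule R} (φ : GModuleHom M N) :
    MackeyHom M.toMackey N.toMackey where
  app X := (φ.app X).toAddMonoidHom
  app_res := φ.app_res
  app_tr := φ.app_tr

variable [FinitaryExtensive C]

/-- The homology `ker g / im f` of a sequence `L → M → N` of Mackey functors with zero composite. -/
def homology {L M N : MackeyFunctor C} (f : MackeyHom L M) (g : MackeyHom M N) :
    MackeyFunctor C where
  obj X := (g.app X).ker ⧸ ((f.app X).range.addSubgroupOf (g.app X).ker)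
  res {X Y} h := QuotientAddGroup.map _ _
    (((M.res h).comp (g.app Y).ker.subtype).codRestrict (g.app X).ker fun y => by
      have hy : g.app Y y = 0 := y.2
      simp [AddMonoidHom.mem_ker, g.app_res, hy]) (by
    rintro ⟨y, hy⟩ ⟨l, rfl⟩
    exact ⟨L.res h l, f.app_res h l⟩)
  tr {X Y} h := QuotientAddGroup.map _ _
    (((M.tr h).comp (g.app X).ker.subtype).codRestrict (g.app Y).ker fun y => by
      have hy : g.app X y = 0 := y.2
      simp [AddMonoidHom.mem_ker, g.app_tr, hy]) (by
    rintro ⟨y, hy⟩ ⟨l, rfl⟩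
    exact ⟨L.tr h l, f.app_tr h l⟩)
  isMackey := by
    refine IsMackey.of_sum ?_ ?_ ?_ ?_ ?_ ?_
    · intro X x
      induction x using QuotientAddGroup.induction_on with
      | H x => exact congrArg _ (Subtype.ext (M.isMackey.res_id _))
    · intro X Y Z p q x
      induction x using QuotientAddGroup.induction_on with
      | H x => exact congrArg _ (Subtype.ext (M.isMackey.res_comp p q _))
    · intro X x
      induction x using QuotientAddGroup.induction_on with
      | H x => exact congrArg _ (Subtype.ext (M.isMackey.tr_id _))
    · intro X Y Z p q x
      induction x using QuotientAddGroup.induction_on with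
      | H x => exact congrArg _ (Subtype.ext (M.isMackey.tr_comp p q _))
    · intro P X Y Z p q i j h x
      induction x using QuotientAddGroup.induction_on with
      | H x => exact congrArg _ (Subtype.ext (M.isMackey.base_change h _))
    · intro X Y Z i j h x
      induction x using QuotientAddGroup.induction_on with
      | H x => exact congrArg _ (Subtype.ext (M.isMackey.sum i j h _))

/-- The map on homology induced by a morphism in the middle that preserves cycles and
boundaries. -/
def homologyMap {L M N L' M' N' : MackeyFunctor C} {f : MackeyHom L M} {g : MackeyHom M N}
    {f' : MackeyHom L' M'} {g' : MackeyHom M' N'} (β : MackeyHom M M')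
    (hker : ∀ X (m : M.obj X), g.app X m = 0 → g'.app X (β.app X m) = 0)
    (him : ∀ X (l : L.obj X), ∃ l' : L'.obj X, f'.app X l' = β.app X (f.app X l)) :
    MackeyHom (homology f g) (homology f' g') where
  app X := QuotientAddGroup.map _ _
    (((β.app X).comp (g.app X).ker.subtype).codRestrict (g'.app X).ker fun y =>
      hker X y y.2) (by
    rintro ⟨y, hy⟩ ⟨l, rfl⟩
    exact him X l)
  app_res h x := by
    induction x using QuotientAddGroup.induction_on with
    | H x => exact congrArg _ (Subtype.ext (β.app_res h _))
  app_tr h x := by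
    induction x using QuotientAddGroup.induction_on with
    | H x => exact congrArg _ (Subtype.ext (β.app_tr h _))

end Homology


section Tor

variable {C : Type u} [Category.{u} C]

/-- A sequence `⋯ → X₁ → X₀ → N` of `R`-modules. -/
structure AugSequence {R : GreenFunctor C} (N : GModule R) where
  X : ℕ → GModule R
  d : ∀ n, GModuleHom (X (n + 1)) (X n)
  aug : GModuleHom (X 0) N

/-- `⋯ → X₁ → X₀ → N` is a projective resolution of `N`: all `Xₙ` are projective and the sequence
`⋯ → X₁ → X₀ → N → 0` is exact. -/
structure AugSequence.IsProjectiveResolution [HasFiniteLimits C] [FinitaryExtensive C]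
    {R : GreenFunctor C} {N : GModule R} (P : AugSequence N) : Prop where
  projective : ∀ n, IsProjective (P.X n)
  surjective : ∀ Y, Function.Surjective (P.aug.app Y)
  exact_zero : ∀ Y, Function.Exact ((P.d 0).app Y) (P.aug.app Y)
  exact_succ : ∀ n Y, Function.Exact ((P.d (n + 1)).app Y) ((P.d n).app Y)

/-- A chain map over the identity of `N`. -/
structure AugSequence.Hom {R : GreenFunctor C} {N : GModule R} (P Q : AugSequence N) where
  f : ∀ n, GModuleHom (P.X n) (Q.X n)
  comm : ∀ n Y (x : (P.X (n + 1)).obj Y),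
    (f n).app Y ((P.d n).app Y x) = (Q.d n).app Y ((f (n + 1)).app Y x)
  aug_comm : ∀ Y (x : (P.X 0).obj Y), Q.aug.app Y ((f 0).app Y x) = P.aug.app Y x

/-- Composition of module homomorphisms. -/
def GModuleHom.comp {R : GreenFunctor C} {L M N : GModule R} (ψ : GModuleHom M N)
    (φ : GModuleHom L M) : GModuleHom L N where
  app X := (ψ.app X).comp (φ.app X)
  app_res f y := (congrArg _ (φ.app_res f y)).trans (ψ.app_res f _)
  app_tr f y := (congrArg _ (φ.app_tr f y)).trans (ψ.app_tr f _)

variable [HasFiniteLimits C] [FinitaryExtensive C]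

/-- The base change `⋯ → S ⊠_R X₁ → S ⊠_R X₀ → S ⊠_R N → N'` of a sequence along `φ : R → S`,
augmented through a map `g : S ⊠_R N → N'`. -/
noncomputable def AugSequence.baseChange {R S : GreenFunctor C} (φ : GreenHom R S) {N : GModule R}
    {N' : GModule S} (g : GModuleHom (baseChange φ N) N') (P : AugSequence N) :
    AugSequence N' where
  X n := Mackey.baseChange φ (P.X n)
  d n := baseChangeMap φ (P.d n)
  aug := g.comp (baseChangeMap φ P.aug)

/-- The `n`-th homology Mackey functor of `M ⊠_R P`. When `P` is a projective resolution of `N`,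
this is `Tor_n^R(M, N)`. -/
noncomputable def tor {R : GreenFunctor C} (M : RightGModule R) {N : GModule R}
    (P : AugSequence N) : ℕ → MackeyFunctor C
  | 0 => homology (boxMap M (P.d 0)) (MackeyHom.zero _ (boxProduct M (P.X 0)))
  | n + 1 => homology (boxMap M (P.d (n + 1))) (boxMap M (P.d n))

/-- The map on homology induced by maps `M ⊠_R Pₙ → M' ⊠_S Qₙ` commuting with the
differentials. -/
noncomputable def torMap {R S : GreenFunctor C} {M : RightGModule R} {N : GModule R}
    {P : AugSequence N} {M' : RightGModule S} {N' : GModule S} {Q : AugSequence N'}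
    (τ : ∀ n, MackeyHom (boxProduct M (P.X n)) (boxProduct M' (Q.X n)))
    (hτ : ∀ n Y z, (τ n).app Y ((boxMap M (P.d n)).app Y z) =
      (boxMap M' (Q.d n)).app Y ((τ (n + 1)).app Y z)) :
    ∀ n, MackeyHom (tor M P n) (tor M' Q n)
  | 0 => homologyMap (τ 0) (fun _ _ _ => rfl) (fun Y z => ⟨_, (hτ 0 Y z).symm⟩)
  | n + 1 => homologyMap (τ (n + 1))
      (fun Y z hz => (hτ n Y z).symm.trans ((congrArg _ hz).trans (map_zero _)))
      (fun Y z => ⟨_, (hτ (n + 1) Y z).symm⟩)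

theorem boxChange_mk {R S : GreenFunctor C} (φ : GreenHom R S) (M : RightGModule S)
    (N : GModule R) {X Y : C} (f : Y ⟶ X) (m : M.obj Y) (n : N.obj Y) :
    (boxChange φ M N).app X (Box.mk (M.restrict φ.op) N f m n) =
      Box.mk M (Mackey.baseChange φ N) f m (oneTmul φ N n) :=
  (BoxPairing.lift_mk _ f _ n).trans (Box.tr_mk_id f m (oneTmul φ N n))

theorem baseChangeMap_oneTmul {R S : GreenFunctor C} (φ : GreenHom R S) {N N' : GModule R}
    (ψ : GModuleHom N N') {X : C} (n : N.obj X) :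
    (baseChangeMap φ ψ).app X (oneTmul φ N n) = oneTmul φ N' (ψ.app X n) :=
  boxMap_mk (rightVia φ) ψ (𝟙 X) (1 : S.obj X) n

theorem torComparison_comm {R S : GreenFunctor C} (φ : GreenHom R S) {N : GModule R}
    {N' : GModule S} (M : RightGModule S) (P : AugSequence N) (Q : AugSequence N')
    (F : ∀ n, GModuleHom (Mackey.baseChange φ (P.X n)) (Q.X n))
    (hF : ∀ n Y (x : (Mackey.baseChange φ (P.X (n + 1))).obj Y),
      (F n).app Y ((baseChangeMap φ (P.d n)).app Y x) = (Q.d n).app Y ((F (n + 1)).app Y x))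
    (n : ℕ) (Y : C) (z : (boxProduct (M.restrict φ.op) (P.X (n + 1))).obj Y) :
    ((boxMap M (F n)).comp (boxChange φ M (P.X n))).app Y
        ((boxMap (M.restrict φ.op) (P.d n)).app Y z) =
      (boxMap M (Q.d n)).app Y
        (((boxMap M (F (n + 1))).comp (boxChange φ M (P.X (n + 1)))).app Y z) := by
  refine Box.hom_congr
    ((((boxMap M (F n)).app Y).comp ((boxChange φ M (P.X n)).app Y)).comp
      ((boxMap (M.restrict φ.op) (P.d n)).app Y))
    (((boxMap M (Q.d n)).app Y).comp
      (((boxMap M (F (n + 1))).app Y).comp ((boxChange φ M (P.X (n + 1))).app Y)))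
    (fun {Z} f m x => ?_) z
  have a1 := boxMap_mk (M.restrict φ.op) (P.d n) f m x
  have a2 := boxChange_mk φ M (P.X n) f m ((P.d n).app Z x)
  have a3 := boxMap_mk M (F n) f m (oneTmul φ (P.X n) ((P.d n).app Z x))
  have b1 := boxChange_mk φ M (P.X (n + 1)) f m x
  have b2 := boxMap_mk M (F (n + 1)) f m (oneTmul φ (P.X (n + 1)) x)
  have b3 := boxMap_mk M (Q.d n) f m ((F (n + 1)).app Z (oneTmul φ (P.X (n + 1)) x))
  have c := (congrArg ((F n).app Z) (baseChangeMap_oneTmul φ (P.d n) x)).symm.trans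
    (hF n Z (oneTmul φ (P.X (n + 1)) x))
  have lhs := (congrArg (fun t => (boxMap M (F n)).app Y ((boxChange φ M (P.X n)).app Y t)) a1).trans
    ((congrArg ((boxMap M (F n)).app Y) a2).trans a3)
  have rhs := (congrArg (fun t => (boxMap M (Q.d n)).app Y ((boxMap M (F (n + 1))).app Y t)) b1).trans
    ((congrArg ((boxMap M (Q.d n)).app Y) b2).trans b3)
  exact lhs.trans ((congrArg (fun t => Box.mk M (Q.X n) f m t) c).trans rhs.symm)

/-- The comparison map `Tor_n^R(M, N) → Tor_n^S(M, N')` for a morphism `φ : R → S` and a right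
`S`-module `M`. It is computed by `M ⊠_R P ≅ M ⊠_S (S ⊠_R P) → M ⊠_S Q`, where the second map is
induced by a chain map `S ⊠_R P → Q` over `g : S ⊠_R N → N'`. -/
noncomputable def torComparison {R S : GreenFunctor C} (φ : GreenHom R S) {N : GModule R}
    {N' : GModule S} (g : GModuleHom (baseChange φ N) N') (M : RightGModule S)
    {P : AugSequence N} {Q : AugSequence N'} (h : (P.baseChange φ g).Hom Q) :
    ∀ n, MackeyHom (tor (M.restrict φ.op) P n) (tor M Q n) :=
  torMap (fun n => (boxMap M (h.f n)).comp (boxChange φ M (P.X n)))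
    (torComparison_comm φ M P Q h.f h.comm)

end Tor

section Augmented

variable {C : Type u} [Category.{u} C]

/-- An augmented algebra over a Green functor `K`: a `K`-algebra `R` with a morphism of
`K`-algebras `ε : R → K`. -/
structure AugmentedAlgebra (K : GreenFunctor C) extends GAlgebra K where
  aug : GreenHom toGreen K
  aug_unit : ∀ (X : C) (k : K.obj X), aug.app X (unit.app X k) = k

namespace AugmentedAlgebra

variable {K : GreenFunctor C} (R : AugmentedAlgebra K)

/-- `K` as a left `R`-module via the augmentation. -/
def base : GModule R.toGreen := K.self.restrict R.aug

variable [HasFiniteLimits C] [FinitaryExtensive C]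

/-- `R` as a left module over its enveloping algebra: `(a ⊗ b) r = a r b`. -/
noncomputable def envMod : GModule R.env := R.regular.toLeftEnv

/-- The augmentation `ρ : R^e → R`, `a ⊗ b ↦ ab`, that is, `z ↦ z • 1`. -/
noncomputable def rho : GModuleHom R.env.self R.envMod where
  app X :=
    { toFun := fun z => (show R.env.obj X from z) • (show R.envMod.obj X from
        (1 : R.toGreen.obj X))
      map_add' := fun z w => add_smul (R := R.env.obj X) z w _
      map_smul' := fun z w => mul_smul (α := R.env.obj X) z w _ }
  app_res {X Y} f z := by
    refine Eq.trans ?_ (R.envMod.res_smul f z (1 : R.toGreen.obj Y)).symm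
    exact congrArg (fun t : R.envMod.obj X => (R.env.res f z : R.env.obj X) • t)
      (R.toGreen.res_one f).symm
  app_tr {X Y} f z := by
    refine (R.envMod.tr_smul f z (1 : R.toGreen.obj Y)).trans ?_
    exact congrArg (fun t : R.envMod.obj X => R.envMod.tr f ((show R.env.obj X from z) • t))
      (R.toGreen.res_one f)

theorem rho_mk {X Y : C} (f : Y ⟶ X) (a b : R.toGreen.obj Y) :
    R.rho.app X (Box.mk R.rightMod R.op.leftMod f a (R.toGreen.toOp b)) =
      R.toGreen.tr f (a * b) := by
  refine (Operators.boxAct_mk R.regular.leftOps R.regular.rightOps R.regular.ops_balanced f a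
    (R.toGreen.toOp b) (1 : R.toGreen.obj X)).trans (congrArg (R.toGreen.tr f) ?_)
  have e : a * (R.toGreen.res f 1 * b) = a * b := by rw [R.toGreen.res_one, one_mul]
  exact e

/-- `R^e E(I)` at level `X`, where `I` is the kernel of the augmentation `R → K`: the image of
`R^e ⊠_R I → R^e`, consisting of the sums of transfers of products `s E(i)`. -/
noncomputable def extendedIdeal (E : GreenHom R.toGreen R.env) (X : C) : AddSubgroup (R.env.obj X) :=
  AddSubgroup.closure {z | ∃ (Y : C) (f : Y ⟶ X) (s : R.env.obj Y) (i : R.toGreen.obj Y),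
    R.aug.app Y i = 0 ∧ z = R.env.tr f (s * E.app Y i)}

theorem unit_aug_mul (E : GreenHom R.toGreen R.env)
    (hE : ∀ X (r : R.toGreen.obj X), R.rho.app X (E.app X r) = R.unit.app X (R.aug.app X r))
    {X : C} (r : R.toGreen.obj X) (k : K.obj X) :
    R.unit.app X (R.aug.app X r * k) =
      E.app X r • (show R.envMod.obj X from R.unit.app X k) := by
  have h1 : R.rho.app X (E.app X (R.unit.app X k)) = R.unit.app X k := by
    rw [hE, R.aug_unit]
  have h2 : E.app X r • (show R.envMod.obj X from R.rho.app X (E.app X (R.unit.app X k))) =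
      R.rho.app X (E.app X (r * R.unit.app X k)) := by
    rw [map_mul]
    exact (mul_smul (E.app X r) (E.app X (R.unit.app X k))
      (show R.envMod.obj X from (1 : R.toGreen.obj X))).symm
  have h3 : R.rho.app X (E.app X (r * R.unit.app X k)) =
      R.unit.app X (R.aug.app X r * k) := by
    rw [hE, map_mul, R.aug_unit]
  exact h3.symm.trans (h2.symm.trans
    (congrArg (fun t : R.envMod.obj X => E.app X r • t) h1))

/-- The unit `η : K → R`, as a map of `R`-modules, where `R` acts on itself via `E : R → R^e`. -/
noncomputable def unitHom (E : GreenHom R.toGreen R.env)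
    (hE : ∀ X (r : R.toGreen.obj X), R.rho.app X (E.app X r) = R.unit.app X (R.aug.app X r)) :
    GModuleHom R.base (R.envMod.restrict E) where
  app X :=
    { toFun := R.unit.app X
      map_add' := map_add (R.unit.app X)
      map_smul' := fun r k => R.unit_aug_mul E hE r k }
  app_res := R.unit.app_res
  app_tr := R.unit.app_tr

/-- The map `g : R^e ⊠_R K → R`, `s ⊗ k ↦ s η(k)`. -/
noncomputable def comparison (E : GreenHom R.toGreen R.env)
    (hE : ∀ X (r : R.toGreen.obj X), R.rho.app X (E.app X r) = R.unit.app X (R.aug.app X r)) :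
    GModuleHom (baseChange E R.base) R.envMod :=
  baseChangeLift E (R.unitHom E hE)

end AugmentedAlgebra

end Augmented

end Mackey

/-! Write `g` for the map from the box product of `R^e` and `K` over `R` to `R`. Everything follows
from two facts: `g` is an isomorphism, and base change along `E` is exact.

For the first, the augmentation identifies `K` with `R/I`, so every element of the source of `g` has
the form `s ⊗ 1`, and `s E(i) ⊗ 1 = s ⊗ ε(i) = 0` for `i` in `I`. On such elements `g` is `ρ`,
because `g(s ⊗ 1) = s η(1) = ρ(s)`. By (E.1) the kernel of `ρ` is `R^e E(I)`, whose elements already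
die in the box product; so `g` is injective. It is surjective because `ρ(r ⊗ 1) = r`. This is
`AugmentedAlgebra.comparison_bijective`.

For the second, a projective right module is flat for the box product (`IsProjective.boxMap_exact`).
Boxing with the free right module on a generator at level `U` is evaluation at `U ⨯ -`, which is
exact since exactness is levelwise; sums and retracts then give all projectives. With (E.2), base
change along `E` is exact. It also preserves projectives, since the base change of a free `R`-module
is the free `R^e`-module on the same generators. Hence it carries an `R`-projective resolution of
`K` to an `R^e`-projective resolution of its base change, and `g` replaces that base change by `R`.
Resolutions of `K` exist because every module is a quotient of the free module on all its elements.

For Tor, the map `m ⊗ x ↦ m ⊗ (1 ⊗ x)` is an isomorphism for every right `R^e`-module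
(`boxChange_bijective`). A chain map between two projective resolutions of `R` over the identity is
a homotopy equivalence by the comparison theorem, and it stays one after boxing with `M`. The
comparison map is the composite of the two on homology; `torComparison_isIso` carries this out on
cycles and boundaries. Levelwise bijectivity suffices for an isomorphism of Mackey functors. -/

namespace Mackey

/-! ## Morphisms of modules -/

section ModuleHoms

variable {C : Type u} [Category.{u} C] {R : GreenFunctor C}

/-- The difference of two morphisms of modules. -/
def GModuleHom.sub {M N : GModule R} (φ ψ : GModuleHom M N) : GModuleHom M N where
  app X := φ.app X - ψ.app X
  app_res f y := by
    rw [LinearMap.sub_apply, LinearMap.sub_apply, φ.app_res, ψ.app_res, map_sub]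
  app_tr f y := by
    rw [LinearMap.sub_apply, LinearMap.sub_apply, φ.app_tr, ψ.app_tr, map_sub]

/-- The identity morphism of a module. -/
def GModuleHom.id (M : GModule R) : GModuleHom M M where
  app _ := LinearMap.id
  app_res _ _ := rfl
  app_tr _ _ := rfl

/-- A morphism of modules, restricted along a morphism of Green functors. -/
def GModuleHom.restrict {S : GreenFunctor C} (φ : GreenHom R S) {M N : GModule S}
    (ψ : GModuleHom M N) : GModuleHom (M.restrict φ) (N.restrict φ) where
  app X :=
    { toFun := ψ.app X
      map_add' := map_add (ψ.app X)
      map_smul' := fun r m => map_smul (ψ.app X) (φ.app X r) (show M.obj X from m) }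
  app_res := ψ.app_res
  app_tr := ψ.app_tr

variable [HasFiniteLimits C] [FinitaryExtensive C]

/-- The kernel of a morphism of modules. -/
def GModuleHom.kernel {M N : GModule R} (φ : GModuleHom M N) : GModule R where
  obj X := LinearMap.ker (φ.app X)
  res {X Y} f := ((M.res f).comp (LinearMap.ker (φ.app Y)).subtype.toAddMonoidHom).codRestrict
    (LinearMap.ker (φ.app X)) fun y => by
      have hy : φ.app Y y = 0 := y.2
      change φ.app X (M.res f y) = 0
      rw [φ.app_res, hy, map_zero]
  tr {X Y} f := ((M.tr f).comp (LinearMap.ker (φ.app X)).subtype.toAddMonoidHom).codRestrict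
    (LinearMap.ker (φ.app Y)) fun y => by
      have hy : φ.app X y = 0 := y.2
      change φ.app Y (M.tr f y) = 0
      rw [φ.app_tr, hy, map_zero]
  -- All axioms used by `IsMackey.of_sum`, including the sum formula that replaces additivity, are
  -- identities between elements, so a levelwise subgroup stable under restrictions and transfers
  -- inherits them.
  isMackey := IsMackey.of_sum
    (fun _ => Subtype.ext (M.isMackey.res_id _))
    (fun f g _ => Subtype.ext (M.isMackey.res_comp f g _))
    (fun _ => Subtype.ext (M.isMackey.tr_id _))
    (fun f g _ => Subtype.ext (M.isMackey.tr_comp f g _))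
    (fun h _ => Subtype.ext (M.isMackey.base_change h _))
    (fun k l h _ => Subtype.ext (M.isMackey.sum k l h _))
  res_smul f r m := Subtype.ext (M.res_smul f r m)
  smul_tr f r m := Subtype.ext (M.smul_tr f r m)
  tr_smul f r m := Subtype.ext (M.tr_smul f r m)

/-- The inclusion of the kernel of a morphism of modules. -/
def GModuleHom.kernelι {M N : GModule R} (φ : GModuleHom M N) : GModuleHom φ.kernel M where
  app X := (LinearMap.ker (φ.app X)).subtype
  app_res _ _ := rfl
  app_tr _ _ := rfl

theorem GModuleHom.exact_kernelι {M N : GModule R} (φ : GModuleHom M N) (X : C) :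
    Function.Exact (φ.kernelι.app X) (φ.app X) :=
  LinearMap.exact_subtype_ker_map (φ.app X)

end ModuleHoms

/-! ## The universal property of free modules -/

section FreeModules

variable {C : Type u} [Category.{u} C] [HasFiniteLimits C]

/-- The generator of `R{x_U}` is the transfer of `1` along the diagonal of `U`. Pulling the diagonal
back along the projection yields the graph of `prod.fst`, so base change in this square computes the
restrictions of the generator. -/
theorem isPullback_graph (U X : C) :
    IsPullback (prod.fst : U ⨯ X ⟶ U) (prod.lift prod.fst (𝟙 (U ⨯ X)))
      (prod.lift (𝟙 U) (𝟙 U)) (prod.map (𝟙 U) (prod.fst : U ⨯ X ⟶ U)) := by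
  have key : ∀ {T : C} (a : T ⟶ U) (b : T ⟶ U ⨯ (U ⨯ X)),
      a ≫ prod.lift (𝟙 U) (𝟙 U) = b ≫ prod.map (𝟙 U) prod.fst →
      (b ≫ prod.snd) ≫ prod.fst = a ∧
        (b ≫ prod.snd) ≫ prod.lift prod.fst (𝟙 (U ⨯ X)) = b := by
    intro T a b h
    have h1 := congrArg (· ≫ prod.fst) h
    have h2 := congrArg (· ≫ prod.snd) h
    simp only [Category.assoc, prod.lift_fst, prod.lift_snd, prod.map_fst, prod.map_snd,
      Category.comp_id] at h1 h2
    refine ⟨by rw [h2, Category.assoc], ?_⟩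
    apply prod.hom_ext
    · rw [Category.assoc, prod.lift_fst, Category.assoc, ← h2, h1]
    · rw [Category.assoc, prod.lift_snd, Category.comp_id]
  have key' : ∀ {T : C} (m : T ⟶ U ⨯ X) (b : T ⟶ U ⨯ (U ⨯ X)),
      m ≫ prod.lift prod.fst (𝟙 (U ⨯ X)) = b → m = b ≫ prod.snd := by
    rintro T m _ rfl
    rw [Category.assoc, prod.lift_snd, Category.comp_id]
  exact ⟨⟨by ext <;> simp⟩, ⟨PullbackCone.IsLimit.mk _ (fun s => s.snd ≫ prod.snd)
    (fun s => (key _ _ s.condition).1) (fun s => (key _ _ s.condition).2)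
    (fun s m _ h => key' m _ h)⟩⟩

variable [FinitaryExtensive C] (R : GreenFunctor C) (U : C)

/-- The generator of the free module `R{x_U}`. -/
noncomputable def freeGen : (freeOn R U).obj U := R.tr (prod.lift (𝟙 U) (𝟙 U)) 1

theorem freeGen_res (X : C) :
    (freeOn R U).res (prod.fst : U ⨯ X ⟶ U) (freeGen R U) =
      R.tr (prod.lift prod.fst (𝟙 (U ⨯ X))) 1 :=
  (R.isMackey.base_change (isPullback_graph U X) 1).trans (by rw [R.res_one])

/-- This is the Yoneda formula for free modules: each element is obtained from the generator by
restriction, multiplication and transfer. By Frobenius the product is the transfer of `x` along the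
graph of `prod.fst`, and the graph followed by the projection back to `U ⨯ X` is the identity. -/
theorem tr_snd_smul_freeGen {X : C} (x : R.obj (U ⨯ X)) :
    (freeOn R U).tr (prod.snd : U ⨯ X ⟶ X)
      (x • (freeOn R U).res (prod.fst : U ⨯ X ⟶ U) (freeGen R U)) =
    (show (freeOn R U).obj X from x) := by
  rw [freeGen_res]
  change R.tr (prod.map (𝟙 U) prod.snd) (R.res prod.snd x * R.tr _ 1) = x
  rw [R.mul_tr, mul_one, ← R.isMackey.tr_comp, ← R.isMackey.res_comp, prod.lift_snd,
    R.isMackey.res_id, prod.lift_map, Category.comp_id, Category.id_comp, prod.lift_fst_snd,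
    R.isMackey.tr_id]

variable {R U}

/-- The morphism `R{x_U} → N` that sends the generator to a given element of `N(U)`. -/
noncomputable def freeDesc {N : GModule R} (n : N.obj U) : GModuleHom (freeOn R U) N where
  app X :=
    { toFun := fun x => N.tr (prod.snd : U ⨯ X ⟶ X)
        ((show R.obj (U ⨯ X) from x) • N.res (prod.fst : U ⨯ X ⟶ U) n)
      map_add' := fun x y => by
        rw [← map_add]
        exact congrArg _ (add_smul (R := R.obj (U ⨯ X)) x y _)
      map_smul' := fun r x => by
        rw [RingHom.id_apply, N.smul_tr]
        exact congrArg _ (mul_smul (R.res prod.snd r) (show R.obj (U ⨯ X) from x) _) }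
  app_res {X Y} f y := by
    refine Eq.trans ?_ (N.isMackey.base_change (isPullback_prod_map_snd U f) _).symm
    rw [N.res_smul, ← N.isMackey.res_comp, prod.map_fst, Category.comp_id]
    rfl
  app_tr {X Y} f x := by
    refine Eq.trans (congrArg (N.tr prod.snd) (N.tr_smul (prod.map (𝟙 U) f) x _)) ?_
    rw [← N.isMackey.tr_comp, ← N.isMackey.res_comp, prod.map_fst, Category.comp_id,
      prod.map_snd, N.isMackey.tr_comp]
    rfl

theorem freeDesc_freeGen {N : GModule R} (n : N.obj U) :
    (freeDesc n).app U (freeGen R U) = n := by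
  change N.tr prod.snd (R.tr (prod.lift (𝟙 U) (𝟙 U)) 1 • N.res prod.fst n) = n
  rw [N.tr_smul, one_smul, ← N.isMackey.tr_comp, ← N.isMackey.res_comp, prod.lift_fst,
    prod.lift_snd, N.isMackey.res_id, N.isMackey.tr_id]

/-- Applying `φ` to the formula `tr_snd_smul_freeGen` gives the uniqueness half of the universal
property. -/
theorem freeOn_hom_apply {N : GModule R} (φ : GModuleHom (freeOn R U) N) {X : C}
    (x : (freeOn R U).obj X) :
    φ.app X x = (freeDesc (φ.app U (freeGen R U))).app X x := by
  have h := congrArg (φ.app X) (tr_snd_smul_freeGen R U (show R.obj (U ⨯ X) from x))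
  rw [φ.app_tr, map_smul, φ.app_res] at h
  exact h.symm

theorem freeOn_hom_ext {N : GModule R} {φ ψ : GModuleHom (freeOn R U) N}
    (h : φ.app U (freeGen R U) = ψ.app U (freeGen R U)) {X : C} (x : (freeOn R U).obj X) :
    φ.app X x = ψ.app X x := by
  rw [freeOn_hom_apply φ, freeOn_hom_apply ψ, h]

/-! ### Universal property of direct sums -/

section DirectSum

open Classical in
/-- The inclusion of a summand of a direct sum. -/
noncomputable def directSumι {ι : Type u} (M : ι → GModule R) (i : ι) :
    GModuleHom (M i) (directSum M) where
  app X := DFinsupp.lsingle (M := fun i => (M i).obj X) i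
  app_res f _ := (DFinsupp.mapRange_single (f := fun i => (M i).res f)
    (hf := fun _ => map_zero _)).symm
  app_tr f _ := (DFinsupp.mapRange_single (f := fun i => (M i).tr f)
    (hf := fun _ => map_zero _)).symm

/-- Stated for additive maps rather than linear ones, because restrictions and transfers, and pure
tensors in one variable, are only additive at a fixed level. -/
theorem directSum_addHom_ext {ι : Type u} {M : ι → GModule R} {X : C} {A : Type*}
    [AddCommGroup A] {φ ψ : (directSum M).obj X →+ A}
    (h : ∀ i (x : (M i).obj X), φ ((directSumι M i).app X x) = ψ ((directSumι M i).app X x)) :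
    φ = ψ := by
  classical
  refine DFinsupp.addHom_ext (β := fun i => (M i).obj X) fun i x => ?_
  have e : DFinsupp.single (β := fun i => (M i).obj X) i x = (directSumι M i).app X x := by
    change _ = DFinsupp.single (β := fun i => (M i).obj X) i x
    congr
  exact e ▸ h i x

theorem directSum_hom_ext {ι : Type u} {M : ι → GModule R} {N : GModule R}
    {φ ψ : GModuleHom (directSum M) N}
    (h : ∀ i X (x : (M i).obj X),
      φ.app X ((directSumι M i).app X x) = ψ.app X ((directSumι M i).app X x)) {X : C}
    (x : (directSum M).obj X) : φ.app X x = ψ.app X x :=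
  DFunLike.congr_fun (directSum_addHom_ext (φ := (φ.app X).toAddMonoidHom)
    (ψ := (ψ.app X).toAddMonoidHom) fun i => h i X) x

open Classical in
/-- The linear map out of a direct sum at one level. -/
noncomputable def directSumDescApp {ι : Type u} {M : ι → GModule R} {N : GModule R}
    (φ : ∀ i, GModuleHom (M i) N) (X : C) : (directSum M).obj X →ₗ[R.obj X] N.obj X :=
  DFinsupp.lsum ℕ (M := fun i => (M i).obj X) fun i => (φ i).app X

theorem directSumDescApp_ι {ι : Type u} {M : ι → GModule R} {N : GModule R}
    (φ : ∀ i, GModuleHom (M i) N) {X : C} (i : ι) (x : (M i).obj X) :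
    directSumDescApp φ X ((directSumι M i).app X x) = (φ i).app X x := by
  classical
  exact DFinsupp.lsum_single (M := fun i => (M i).obj X) _ _ _ _

/-- The morphism out of a direct sum given by morphisms out of the summands. -/
noncomputable def directSumDesc {ι : Type u} {M : ι → GModule R} {N : GModule R}
    (φ : ∀ i, GModuleHom (M i) N) : GModuleHom (directSum M) N where
  app := directSumDescApp φ
  app_res {X Y} f y := by
    refine DFunLike.congr_fun (directSum_addHom_ext
      (φ := (directSumDescApp φ X).toAddMonoidHom.comp ((directSum M).res f))
      (ψ := (N.res f).comp (directSumDescApp φ Y).toAddMonoidHom) fun i x => ?_) y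
    change directSumDescApp φ X ((directSum M).res f ((directSumι M i).app Y x)) =
      N.res f (directSumDescApp φ Y ((directSumι M i).app Y x))
    rw [← (directSumι M i).app_res, directSumDescApp_ι, directSumDescApp_ι, (φ i).app_res]
  app_tr {X Y} f y := by
    refine DFunLike.congr_fun (directSum_addHom_ext
      (φ := (directSumDescApp φ Y).toAddMonoidHom.comp ((directSum M).tr f))
      (ψ := (N.tr f).comp (directSumDescApp φ X).toAddMonoidHom) fun i x => ?_) y
    change directSumDescApp φ Y ((directSum M).tr f ((directSumι M i).app X x)) =
      N.tr f (directSumDescApp φ X ((directSumι M i).app X x))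
    rw [← (directSumι M i).app_tr, directSumDescApp_ι, directSumDescApp_ι, (φ i).app_tr]

end DirectSum

/-! ### Free modules on families and the lifting property of projectives -/

/-- The free module on a family of generators. -/
noncomputable abbrev freeModule (R : GreenFunctor C) {ι : Type u} (U : ι → C) : GModule R :=
  directSum fun k => freeOn R (U k)

/-- A generator of a free module. -/
noncomputable def basisElem (R : GreenFunctor C) {ι : Type u} (U : ι → C) (k : ι) :
    (freeModule R U).obj (U k) :=
  (directSumι (fun k => freeOn R (U k)) k).app (U k) (freeGen R (U k))

/-- The morphism out of a free module with prescribed values on the generators. -/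
noncomputable def freeModuleDesc {ι : Type u} {U : ι → C} {N : GModule R}
    (n : ∀ k, N.obj (U k)) : GModuleHom (freeModule R U) N :=
  directSumDesc fun k => freeDesc (n k)

theorem freeModuleDesc_basisElem {ι : Type u} {U : ι → C} {N : GModule R}
    (n : ∀ k, N.obj (U k)) (k : ι) :
    (freeModuleDesc n).app (U k) (basisElem R U k) = n k :=
  (directSumDescApp_ι (fun k => freeDesc (n k)) k (freeGen R (U k))).trans (freeDesc_freeGen (n k))

theorem freeModule_hom_ext {ι : Type u} {U : ι → C} {N : GModule R}
    {φ ψ : GModuleHom (freeModule R U) N}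
    (h : ∀ k, φ.app (U k) (basisElem R U k) = ψ.app (U k) (basisElem R U k)) {X : C}
    (x : (freeModule R U).obj X) : φ.app X x = ψ.app X x :=
  directSum_hom_ext (fun k _ y => freeOn_hom_ext (U := U k)
    (φ := φ.comp (directSumι (fun k => freeOn R (U k)) k))
    (ψ := ψ.comp (directSumι (fun k => freeOn R (U k)) k)) (h k) y) x

/-- A morphism from a projective module lifts along any morphism whose image contains its image. -/
theorem IsProjective.exists_lift {P A B : GModule R} (hP : IsProjective P)
    (φ : GModuleHom P B) (ψ : GModuleHom A B) (h : ∀ X x, ∃ a, ψ.app X a = φ.app X x) :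
    ∃ χ : GModuleHom P A, ∀ X x, ψ.app X (χ.app X x) = φ.app X x := by
  obtain ⟨ι, U, i, r, hr⟩ := hP
  -- A lift is needed only on the generators of the free module of which `P` is a retract; there it
  -- amounts to choosing one preimage for each generator.
  choose a ha using fun k => h (U k) (r.app (U k) (basisElem R U k))
  refine ⟨(freeModuleDesc a).comp i, fun X x => ?_⟩
  -- The chosen map lifts `φ ∘ r` on the whole free module, and `r ∘ i` is the identity of `P`.
  refine (freeModule_hom_ext (φ := ψ.comp (freeModuleDesc a)) (ψ := φ.comp r)
    (fun k => ?_) (i.app X x)).trans (congrArg (φ.app X) (hr X x))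
  exact (congrArg (ψ.app (U k)) (freeModuleDesc_basisElem a k)).trans (ha k)

theorem isProjective_freeModule {ι : Type u} (U : ι → C) : IsProjective (freeModule R U) :=
  ⟨ι, U, GModuleHom.id _, GModuleHom.id _, fun _ _ => rfl⟩

theorem IsProjective.of_retract {P Q : GModule R} (hQ : IsProjective Q) (i : GModuleHom P Q)
    (r : GModuleHom Q P) (h : ∀ X x, r.app X (i.app X x) = x) : IsProjective P := by
  obtain ⟨ι, U, i', r', h'⟩ := hQ
  exact ⟨ι, U, i'.comp i, r.comp r', fun X x =>
    (congrArg (r.app X) (h' X (i.app X x))).trans (h X x)⟩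

end FreeModules

/-! ## Flatness of projective modules -/

section Flat

variable {C : Type u} [Category.{u} C] [HasFiniteLimits C] [FinitaryExtensive C]
  {R : GreenFunctor C}

/-- A coordinate of an element of a free right module. -/
noncomputable def freeCoord {ι : Type u} {U : ι → C} {Y : C} (m : (freeModule R.op U).obj Y) (k : ι) :
    R.obj (U k ⨯ Y) :=
  R.ofOp ((show Π₀ k, (freeOn R.op (U k)).obj Y from m) k)

/-- The evaluation `(⨁ₖ R{x_{Uₖ}}) ⊠_R N → ⨁ₖ N(Uₖ × -)` on pure tensors, for the free right
module on the left. -/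
noncomputable def freeEvalTensor {ι : Type u} (U : ι → C) (N : GModule R) {X Y : C} (f : Y ⟶ X)
    (m : (freeModule R.op U).obj Y) (n : N.obj Y) : Π₀ k, N.obj (U k ⨯ X) :=
  DFinsupp.mapRange (β₁ := fun k => (freeOn R.op (U k)).obj Y)
    (fun k r => N.tr (prod.map (𝟙 (U k)) f)
      ((R.ofOp (show R.op.obj (U k ⨯ Y) from r)) • N.res (prod.snd : U k ⨯ Y ⟶ Y) n))
    (fun k => by
      refine Eq.trans (congrArg _ (zero_smul (R.obj (U k ⨯ Y)) _)) (map_zero _)) m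

/-- In each coordinate the two transfer relations are the Frobenius formulas of `N` along `prod.map
(𝟙 (U k)) h`. Transfers in `N` are first brought to level `U k ⨯ -` by base change along the
projections. Balancing is associativity of the action of `R(U k ⨯ Y)`. -/
theorem freeEvalTensor_isBalanced {ι : Type u} (U : ι → C) (N : GModule R) (X : C) :
    Box.IsBalanced (M := freeModule R.op U) (N := N) (X := X)
      (fun f m n => freeEvalTensor U N f m n) where
  add_left f m m' n := DFinsupp.ext fun k => by
    refine Eq.trans (congrArg _ (add_smul (R := R.obj _) (freeCoord m k) (freeCoord m' k) _))
      (map_add (N.tr (prod.map (𝟙 (U k)) f)) _ _)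
  add_right f m n n' := DFinsupp.ext fun k => by
    refine Eq.trans (congrArg (N.tr _) ?_) (map_add (N.tr _) _ _)
    rw [map_add, smul_add]
  tr_left {Y Z} h f m n := DFinsupp.ext fun k => by
    have e := N.tr_smul (prod.map (𝟙 (U k)) h) (freeCoord m k)
      (N.res prod.snd n)
    rw [← N.isMackey.res_comp, prod.map_snd, N.isMackey.res_comp] at e
    refine (congrArg (N.tr (prod.map (𝟙 (U k)) f)) e).trans ?_
    rw [← N.isMackey.tr_comp, prod.map_map, Category.comp_id]
    rfl
  tr_right {Y Z} h f m n := DFinsupp.ext fun k => by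
    have e := N.smul_tr (prod.map (𝟙 (U k)) h) (freeCoord m k)
      (N.res prod.snd n)
    rw [← N.isMackey.base_change (isPullback_prod_map_snd (U k) h).flip] at e
    refine (congrArg (N.tr (prod.map (𝟙 (U k)) f)) e).trans ?_
    rw [← N.isMackey.tr_comp, prod.map_map, Category.comp_id]
    rfl
  balanced {Y} f r m n := DFinsupp.ext fun k => by
    refine congrArg (N.tr (prod.map (𝟙 (U k)) f)) ?_
    rw [N.res_smul]
    exact mul_smul (freeCoord m k) (R.res prod.snd r) (N.res prod.snd n)

/-- The evaluation `(⨁ₖ R{x_{Uₖ}}) ⊠_R N → ⨁ₖ N(Uₖ × -)`. -/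
noncomputable def freeEval {ι : Type u} (U : ι → C) (N : GModule R) (X : C) :
    Box (freeModule R.op U) N X →+ Π₀ k, N.obj (U k ⨯ X) :=
  Box.lift (fun f m n => freeEvalTensor U N f m n) (freeEvalTensor_isBalanced U N X)

/-- The generator of the summand with index `k`, restricted to `Uₖ × X`. -/
noncomputable def basisElemAt (R : GreenFunctor C) {ι : Type u} (U : ι → C) (k : ι) (X : C) :
    (freeModule R U).obj (U k ⨯ X) :=
  (freeModule R U).res prod.fst (basisElem R U k)

theorem basisElemAt_eq {ι : Type u} (U : ι → C) (k : ι) (X : C) :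
    basisElemAt R U k X = (directSumι (fun k => freeOn R (U k)) k).app (U k ⨯ X)
      ((freeOn R (U k)).res prod.fst (freeGen R (U k))) :=
  ((directSumι (fun k => freeOn R (U k)) k).app_res prod.fst (freeGen R (U k))).symm

theorem basisElemAt_res {ι : Type u} (U : ι → C) (k : ι) {X Y : C} (f : Y ⟶ X) :
    (freeModule R U).res (prod.map (𝟙 (U k)) f) (basisElemAt R U k X) = basisElemAt R U k Y := by
  rw [basisElemAt, ← (freeModule R U).isMackey.res_comp, prod.map_fst, Category.comp_id]
  rfl

/-- The formula `tr_snd_smul_freeGen`, transported into a direct sum. It lets a tensor with one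
nonzero coordinate be rewritten in terms of the generator. -/
theorem tr_snd_smul_basisElemAt {ι : Type u} (U : ι → C) (k : ι) {X : C}
    (x : R.obj (U k ⨯ X)) :
    (freeModule R U).tr (prod.snd : U k ⨯ X ⟶ X) (x • basisElemAt R U k X) =
      (directSumι (fun k => freeOn R (U k)) k).app X (show (freeOn R (U k)).obj X from x) := by
  rw [basisElemAt_eq, ← map_smul, ← (directSumι (fun k => freeOn R (U k)) k).app_tr,
    tr_snd_smul_freeGen]

/-- The inverse `⨁ₖ N(Uₖ × -) → (⨁ₖ R{x_{Uₖ}}) ⊠_R N` of the evaluation. -/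
noncomputable def freeCoeval {ι : Type u} (U : ι → C) (N : GModule R) (X : C) :
    (Π₀ k, N.obj (U k ⨯ X)) →+ Box (freeModule R.op U) N X :=
  open Classical in
  DFinsupp.liftAddHom fun k =>
    { toFun := fun x => Box.mk (freeModule R.op U) N prod.snd (basisElemAt R.op U k X) x
      map_zero' := by
        have h := Box.mk_add_right (M := freeModule R.op U) (N := N)
          (prod.snd : U k ⨯ X ⟶ X) (basisElemAt R.op U k X) 0 0
        rwa [add_zero, left_eq_add] at h
      map_add' := fun x y => Box.mk_add_right _ _ _ _ }

open Classical in
theorem freeEval_mk_single {ι : Type u} (U : ι → C) (N : GModule R) {X Y : C} (f : Y ⟶ X) (k : ι)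
    (r : R.op.obj (U k ⨯ Y)) (n : N.obj Y) :
    freeEval U N X (Box.mk (freeModule R.op U) N f
      ((directSumι (fun k => freeOn R.op (U k)) k).app Y
        (show (freeOn R.op (U k)).obj Y from r)) n) =
    DFinsupp.single k (N.tr (prod.map (𝟙 (U k)) f) (R.ofOp r • N.res prod.snd n)) := by
  exact (Box.lift_mk _ _ _ _ _).trans DFinsupp.mapRange_single

open Classical in
theorem freeCoeval_single {ι : Type u} (U : ι → C) (N : GModule R) {X : C} (k : ι)
    (x : N.obj (U k ⨯ X)) :
    freeCoeval U N X (DFinsupp.single k x) =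
      Box.mk (freeModule R.op U) N prod.snd (basisElemAt R.op U k X) x := by
  exact DFinsupp.liftAddHom_apply_single (β := fun k => N.obj (U k ⨯ X)) _ k x

/-- The restricted generator is the transfer of `1` along a graph. Frobenius moves this transfer
onto the element of `N`, and the resulting composites of the graph with projections are identities.
-/
theorem freeEval_freeCoeval {ι : Type u} (U : ι → C) (N : GModule R) (X : C)
    (x : Π₀ k, N.obj (U k ⨯ X)) : freeEval U N X (freeCoeval U N X x) = x := by
  classical
  refine DFunLike.congr_fun (f := (freeEval U N X).comp (freeCoeval U N X))
    (g := AddMonoidHom.id _) (DFinsupp.addHom_ext fun k x => ?_) x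
  rw [AddMonoidHom.comp_apply, freeCoeval_single, basisElemAt_eq, freeGen_res]
  refine (freeEval_mk_single U N prod.snd k _ x).trans (congrArg (DFinsupp.single k) ?_)
  have e := N.tr_smul (prod.lift prod.fst (𝟙 (U k ⨯ X))) (1 : R.obj (U k ⨯ X))
    (N.res prod.snd x)
  refine (congrArg (N.tr (prod.map (𝟙 (U k)) prod.snd)) e).trans ?_
  rw [one_smul, ← N.isMackey.tr_comp, ← N.isMackey.res_comp, prod.lift_snd, N.isMackey.res_id,
    prod.lift_map, Category.comp_id, Category.id_comp, prod.lift_fst_snd, N.isMackey.tr_id]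

/-- For the restricted generator `b` and a coordinate `r`, the transfer in the right factor slides
out, `r` is balanced to the left, and the projection slides back in: `b ⊗ tr (r n)` becomes a
transfer of `b r ⊗ n`, with `b` and `n` suitably restricted, and then of `tr (b r) ⊗ n`. Here `tr (b
r)` is the element with the single coordinate `r`. -/
theorem freeCoeval_freeEval {ι : Type u} (U : ι → C) (N : GModule R) (X : C)
    (z : Box (freeModule R.op U) N X) : freeCoeval U N X (freeEval U N X z) = z := by
  classical
  refine Box.hom_congr ((freeCoeval U N X).comp (freeEval U N X)) (AddMonoidHom.id _)
    (fun {Y} f m n => ?_) z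
  -- A pure tensor is additive in its left entry when `f` and `n` are fixed, so the identity need
  -- only be checked for an entry in a single summand.
  let mkHom : (freeModule R.op U).obj Y →+ Box (freeModule R.op U) N X :=
    AddMonoidHom.mk' (fun m => Box.mk (freeModule R.op U) N f m n)
      fun m m' => Box.mk_add_left f m m' n
  let mkHom' : (freeModule R.op U).obj Y →+ Box (freeModule R.op U) N X :=
    ((freeCoeval U N X).comp (freeEval U N X)).comp mkHom
  refine DFunLike.congr_fun (f := mkHom') (g := mkHom)
    (directSum_addHom_ext fun k r => ?_) m
  change freeCoeval U N X (freeEval U N X (Box.mk (freeModule R.op U) N f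
      ((directSumι (fun k => freeOn R.op (U k)) k).app Y r) n)) =
    Box.mk (freeModule R.op U) N f ((directSumι (fun k => freeOn R.op (U k)) k).app Y r) n
  rw [freeEval_mk_single U N f k (show R.op.obj (U k ⨯ Y) from r) n, freeCoeval_single,
    Box.mk_tr_right, basisElemAt_res, ← Box.mk_balanced, prod.map_snd, ← Box.mk_tr_left]
  exact congrArg (fun t => Box.mk (freeModule R.op U) N f t n)
    (tr_snd_smul_basisElemAt U k (show R.op.obj (U k ⨯ Y) from r))

theorem freeEval_boxMap {ι : Type u} (U : ι → C) {N N' : GModule R} (ψ : GModuleHom N N') (X : C)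
    (z : Box (freeModule R.op U) N X) :
    freeEval U N' X ((boxMap (freeModule R.op U) ψ).app X z) =
      DFinsupp.mapRange.addMonoidHom (fun k => (ψ.app (U k ⨯ X)).toAddMonoidHom)
        (freeEval U N X z) := by
  refine Box.hom_congr ((freeEval U N' X).comp ((boxMap (freeModule R.op U) ψ).app X))
    ((DFinsupp.mapRange.addMonoidHom (fun k => (ψ.app (U k ⨯ X)).toAddMonoidHom)).comp
      (freeEval U N X)) (fun {Y} f m n => ?_) z
  rw [AddMonoidHom.comp_apply, AddMonoidHom.comp_apply, boxMap_mk]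
  refine (Box.lift_mk _ _ _ _ _).trans ?_
  refine Eq.trans ?_ (congrArg _ (Box.lift_mk _ (freeEvalTensor_isBalanced U N X) f m n).symm)
  refine DFinsupp.ext fun k => ?_
  refine Eq.trans ?_ (ψ.app_tr (prod.map (𝟙 (U k)) f) _).symm
  rw [map_smul, ψ.app_res]
  rfl

/-- The evaluation as an isomorphism of groups. -/
noncomputable def freeEvalEquiv {ι : Type u} (U : ι → C) (N : GModule R) (X : C) :
    Box (freeModule R.op U) N X ≃+ Π₀ k, N.obj (U k ⨯ X) :=
  { freeEval U N X with
    invFun := freeCoeval U N X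
    left_inv := freeCoeval_freeEval U N X
    right_inv := freeEval_freeCoeval U N X }

/-- Preimages chosen coordinate by coordinate can be assembled with finite support. This is the
content of `DFinsupp.mrange_mapRangeAddMonoidHom`. -/
theorem dfinsupp_mapRange_exact {ι : Type*} {A B D : ι → Type*} [∀ i, AddCommGroup (A i)]
    [∀ i, AddCommGroup (B i)] [∀ i, AddCommGroup (D i)] (f : ∀ i, A i →+ B i)
    (g : ∀ i, B i →+ D i) (h : ∀ i, Function.Exact (f i) (g i)) :
    Function.Exact (DFinsupp.mapRange.addMonoidHom f) (DFinsupp.mapRange.addMonoidHom g) := by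
  intro y
  constructor
  · intro hy
    have hy' : y ∈ AddMonoidHom.mrange (DFinsupp.mapRange.addMonoidHom f) := by
      rw [DFinsupp.mrange_mapRangeAddMonoidHom]
      intro i _
      exact (h i (y i)).1 (DFunLike.congr_fun hy i)
    exact hy'
  · rintro ⟨x, rfl⟩
    exact DFinsupp.ext fun i => (h i).apply_apply_eq_zero (x i)

/-- Under the natural isomorphism `freeEvalEquiv`, boxing with a free right module is a direct sum
of evaluations at `U k ⨯ X`. The hypothesis supplies exactness at every such level. -/
theorem freeModule_boxMap_exact {ι : Type u} (U : ι → C) {A B D : GModule R} (f : GModuleHom A B)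
    (g : GModuleHom B D) (h : ∀ X, Function.Exact (f.app X) (g.app X)) (X : C) :
    Function.Exact ((boxMap (freeModule R.op U) f).app X)
      ((boxMap (freeModule R.op U) g).app X) := by
  refine (Function.Exact.iff_of_ladder_addEquiv (e₁ := freeEvalEquiv U A X)
    (e₂ := freeEvalEquiv U B X) (e₃ := freeEvalEquiv U D X)
    (g₁₂ := DFinsupp.mapRange.addMonoidHom (fun k => (f.app (U k ⨯ X)).toAddMonoidHom))
    (g₂₃ := DFinsupp.mapRange.addMonoidHom (fun k => (g.app (U k ⨯ X)).toAddMonoidHom))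
    (AddMonoidHom.ext fun z => (freeEval_boxMap U f X z).symm)
    (AddMonoidHom.ext fun z => (freeEval_boxMap U g X z).symm)).1
    (dfinsupp_mapRange_exact _ _ fun k => h (U k ⨯ X))

/-! ### From free to projective right modules -/

/-- The map `M ⊠_R N → M' ⊠_R N` induced by a morphism of right modules. -/
noncomputable def boxMapLeft {M M' : RightGModule R} (φ : GModuleHom M M') (N : GModule R) (X : C) :
    Box M N X →+ Box M' N X :=
  Box.lift (fun {Y} f m n => Box.mk M' N f (φ.app Y m) n)
    { add_left := fun _ _ _ _ => by rw [map_add, Box.mk_add_left]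
      add_right := fun _ _ _ _ => Box.mk_add_right _ _ _ _
      tr_left := fun _ _ _ _ => by rw [φ.app_tr, Box.mk_tr_left]
      tr_right := fun _ _ _ _ => by rw [Box.mk_tr_right, φ.app_res]
      balanced := fun _ _ _ _ => by rw [map_smul, Box.mk_balanced] }

theorem boxMapLeft_mk {M M' : RightGModule R} (φ : GModuleHom M M') (N : GModule R) {X Y : C}
    (f : Y ⟶ X) (m : M.obj Y) (n : N.obj Y) :
    boxMapLeft φ N X (Box.mk M N f m n) = Box.mk M' N f (φ.app Y m) n :=
  Box.lift_mk _ _ _ _ _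

theorem boxMap_boxMapLeft {M M' : RightGModule R} (φ : GModuleHom M M') {N N' : GModule R}
    (ψ : GModuleHom N N') (X : C) (z : Box M N X) :
    (boxMap M' ψ).app X (boxMapLeft φ N X z) = boxMapLeft φ N' X ((boxMap M ψ).app X z) := by
  refine Box.hom_congr (((boxMap M' ψ).app X).comp (boxMapLeft φ N X))
    ((boxMapLeft φ N' X).comp ((boxMap M ψ).app X)) (fun {Y} f m n => ?_) z
  rw [AddMonoidHom.comp_apply, AddMonoidHom.comp_apply, boxMapLeft_mk, boxMap_mk, boxMap_mk,
    boxMapLeft_mk]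

/-- Projective right modules are flat. -/
theorem IsProjective.boxMap_exact {M : RightGModule R} (hM : IsProjective M) {A B D : GModule R}
    (f : GModuleHom A B) (g : GModuleHom B D) (h : ∀ X, Function.Exact (f.app X) (g.app X))
    (X : C) : Function.Exact ((boxMap M f).app X) ((boxMap M g).app X) := by
  obtain ⟨ι, U, i, r, hr⟩ := hM
  -- A retract of an exact sequence is exact: a kernel element is sent by `i` to the free case,
  -- lifted there, and the lift is brought back by `r`. Naturality in the second variable makes this
  -- compatible with `f` and `g`.
  have hri : ∀ (N : GModule R) (z : Box M N X),
      boxMapLeft r N X (boxMapLeft i N X z) = z := by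
    intro N z
    refine Box.hom_congr ((boxMapLeft r N X).comp (boxMapLeft i N X)) (AddMonoidHom.id _)
      (fun {Y} f m n => ?_) z
    rw [AddMonoidHom.comp_apply, boxMapLeft_mk, boxMapLeft_mk, hr]
    rfl
  have hF := freeModule_boxMap_exact U f g h X
  intro z
  constructor
  · intro hz
    have h1 : (boxMap (freeModule R.op U) g).app X (boxMapLeft i B X z) = 0 := by
      rw [boxMap_boxMapLeft, hz, map_zero]
    obtain ⟨w, hw⟩ := (hF _).1 h1
    refine ⟨boxMapLeft r A X w, ?_⟩
    rw [boxMap_boxMapLeft, hw, hri]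
  · rintro ⟨w, rfl⟩
    have h1 := hF.apply_apply_eq_zero (boxMapLeft i A X w)
    rw [boxMap_boxMapLeft, boxMap_boxMapLeft] at h1
    rw [← hri D ((boxMap M g).app X _), h1, map_zero]

/-- Pure tensors generate the target and lift entry by entry; no flatness of `M` enters. -/
theorem boxMap_surjective (M : RightGModule R) {A B : GModule R} (f : GModuleHom A B)
    (h : ∀ X, Function.Surjective (f.app X)) (X : C) :
    Function.Surjective ((boxMap M f).app X) := by
  intro z
  induction z using Box.induction with
  | zero => exact ⟨0, map_zero _⟩
  | add a b ha hb =>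
    obtain ⟨a, rfl⟩ := ha
    obtain ⟨b, rfl⟩ := hb
    exact ⟨a + b, map_add _ _ _⟩
  | neg a ha =>
    obtain ⟨a, rfl⟩ := ha
    exact ⟨-a, map_neg _ _⟩
  | @mk Y f m n =>
    obtain ⟨n, rfl⟩ := h Y n
    exact ⟨Box.mk M A f m n, boxMap_mk _ _ _ _ _⟩

end Flat

/-! ## Base change of projective modules -/

section BaseChangeProjective

variable {C : Type u} [Category.{u} C] [HasFiniteLimits C] [FinitaryExtensive C]
  {R S : GreenFunctor C} (φ : GreenHom R S)

/-- The unit `N → S ⊠_R N`, `n ↦ 1 ⊗ n`, of base change. -/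
noncomputable def baseChangeUnit (N : GModule R) :
    GModuleHom N ((baseChange φ N).restrict φ) where
  app _ :=
    { toFun := oneTmul φ N
      map_add' := oneTmul_add φ N
      map_smul' := oneTmul_smul φ N }
  app_res h n := (oneTmul_res φ N h n).symm
  app_tr h n := oneTmul_tr φ N h n

/-- Exhibits the elements `1 ⊗ n` as generators of the base change under the action of `S` and
transfers. An `S`-linear map out of it is therefore determined by its values on them. -/
theorem mk_eq_tr_smul_oneTmul (N : GModule R) {X Y : C} (f : Y ⟶ X) (s : S.obj Y) (n : N.obj Y) :
    (show (baseChange φ N).obj X from Box.mk (rightVia φ) N f s n) =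
      (baseChange φ N).tr f (s • oneTmul φ N n) := by
  have h1 := baseChange_smul_mk φ N s (𝟙 Y) (1 : S.obj Y) n
  have e : S.res (𝟙 Y) s * 1 = s := by rw [mul_one, S.isMackey.res_id]
  refine Eq.trans ?_ (congrArg ((baseChange φ N).tr f) h1).symm
  exact (Box.tr_mk_id (M := rightVia φ) (N := N) f s n).symm.trans
    (congrArg (fun t : (rightVia φ).obj Y => Box.tr f (Box.mk (rightVia φ) N (𝟙 Y) t n)) e.symm)

theorem baseChange_hom_ext {N : GModule R} {N' : GModule S} {α β : GModuleHom (baseChange φ N) N'}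
    (h : ∀ X (n : N.obj X), α.app X (oneTmul φ N n) = β.app X (oneTmul φ N n)) {X : C}
    (z : (baseChange φ N).obj X) : α.app X z = β.app X z := by
  refine Box.hom_congr (M := rightVia φ) (N := N) (α.app X).toAddMonoidHom
    (β.app X).toAddMonoidHom (fun {Y} f s n => ?_) z
  have e := mk_eq_tr_smul_oneTmul φ N f s n
  refine (congrArg (α.app X) e).trans (Eq.trans ?_ (congrArg (β.app X) e).symm)
  have h' : α.app Y ((show S.obj Y from s) • oneTmul φ N n) =
      β.app Y ((show S.obj Y from s) • oneTmul φ N n) := by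
    rw [map_smul, map_smul, h]
  exact (α.app_tr f _).trans ((congrArg (N'.tr f) h').trans (β.app_tr f _).symm)

theorem baseChangeLift_oneTmul {N : GModule R} {N' : GModule S}
    (ψ : GModuleHom N (N'.restrict φ)) {X : C} (n : N.obj X) :
    (baseChangeLift φ ψ).app X (oneTmul φ N n) = ψ.app X n := by
  refine (BoxPairing.lift_mk (liftPairing φ ψ) (𝟙 X) (1 : S.obj X) n).trans ?_
  exact (N'.isMackey.tr_id _).trans (one_smul (S.obj X) (show N'.obj X from ψ.app X n))

/-- The base change of a free module is free on the same generators. Only one of the two composites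
is needed here, since projectivity asks for no more than a retract. -/
theorem isProjective_baseChange_freeModule {ι : Type u} (U : ι → C) :
    IsProjective (baseChange φ (freeModule R U)) := by
  let ψ : GModuleHom (freeModule R U) ((freeModule S U).restrict φ) :=
    freeModuleDesc fun k => basisElem S U k
  let r : GModuleHom (freeModule S U) (baseChange φ (freeModule R U)) :=
    freeModuleDesc fun k => oneTmul φ _ (basisElem R U k)
  refine ⟨ι, U, baseChangeLift φ ψ, r, fun X z => ?_⟩
  refine baseChange_hom_ext φ (α := r.comp (baseChangeLift φ ψ)) (β := GModuleHom.id _)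
    (fun X n => ?_) z
  refine (congrArg (r.app X) (baseChangeLift_oneTmul φ ψ n)).trans ?_
  -- On elements `1 ⊗ n` the claim is an equality of two `R`-linear maps out of a free module: `r`
  -- after `ψ`, and the unit of base change. Both send a generator `x` to `1 ⊗ x`.
  refine freeModule_hom_ext (φ := (r.restrict φ).comp ψ) (ψ := baseChangeUnit φ _)
    (fun k => ?_) n
  have h : ψ.app (U k) (basisElem R U k) = basisElem S U k := freeModuleDesc_basisElem _ k
  exact (congrArg (r.app (U k)) h).trans (freeModuleDesc_basisElem _ k)

/-- Base change is functorial, hence preserves the retraction of a free module onto `P`. -/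
theorem IsProjective.baseChange {P : GModule R} (hP : IsProjective P) :
    IsProjective (baseChange φ P) := by
  obtain ⟨ι, U, i, r, h⟩ := hP
  refine (isProjective_baseChange_freeModule φ U).of_retract (baseChangeMap φ i)
    (baseChangeMap φ r) fun X z => ?_
  refine baseChange_hom_ext φ (α := (baseChangeMap φ r).comp (baseChangeMap φ i))
    (β := GModuleHom.id _) (fun X n => ?_) z
  refine (congrArg ((baseChangeMap φ r).app X) (baseChangeMap_oneTmul φ i n)).trans ?_
  exact (baseChangeMap_oneTmul φ r _).trans (congrArg (oneTmul φ P) (h X n))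

/-- Base change along `φ` preserves projective resolutions when `S` is projective as a right
`R`-module and the augmentation of the base change is an isomorphism. -/
theorem AugSequence.IsProjectiveResolution.baseChange {φ : GreenHom R S}
    (hφ : IsProjective (rightVia φ)) {N : GModule R} {N' : GModule S}
    (g : GModuleHom (Mackey.baseChange φ N) N') (hg : ∀ X, Function.Bijective (g.app X))
    {P : AugSequence N} (hP : P.IsProjectiveResolution) :
    (P.baseChange φ g).IsProjectiveResolution where
  projective n := (hP.projective n).baseChange φ
  surjective Y := (hg Y).2.comp (boxMap_surjective (rightVia φ) P.aug hP.surjective Y)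
  exact_zero Y := by
    -- Flatness gives exactness with the base changed augmentation; composing with the injective map
    -- `g` leaves its kernel unchanged.
    have h := hφ.boxMap_exact (P.d 0) P.aug hP.exact_zero Y
    intro z
    refine Iff.trans ?_ (h z)
    exact ⟨fun hz => (hg Y).1 (hz.trans (map_zero _).symm),
      fun hz => (congrArg (g.app Y) hz).trans (map_zero _)⟩
  exact_succ n Y := hφ.boxMap_exact (P.d (n + 1)) (P.d n) (hP.exact_succ n) Y

end BaseChangeProjective

/-! ## Projective resolutions -/

section Resolutions

variable {C : Type u} [Category.{u} C] [HasFiniteLimits C] [FinitaryExtensive C]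
  {R : GreenFunctor C}

/-- The free module generated by all elements of `N`. -/
noncomputable def freeCover (N : GModule R) : GModule R :=
  freeModule R fun k : (U : C) × N.obj U => k.1

/-- The canonical morphism from the free module generated by all elements of `N`. -/
noncomputable def freeCoverMap (N : GModule R) : GModuleHom (freeCover N) N :=
  freeModuleDesc fun k : (U : C) × N.obj U => k.2

/-- Each `n` is the image of the generator that it indexes itself. -/
theorem freeCoverMap_surjective (N : GModule R) (X : C) :
    Function.Surjective ((freeCoverMap N).app X) := fun n =>
  ⟨basisElem R (fun k : (U : C) × N.obj U => k.1) ⟨X, n⟩,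
    freeModuleDesc_basisElem (fun k : (U : C) × N.obj U => k.2) ⟨X, n⟩⟩

/-- The iterated syzygies of `N` with respect to free covers. -/
noncomputable def syzygy (N : GModule R) : ℕ → GModule R
  | 0 => N
  | n + 1 => (freeCoverMap (syzygy N n)).kernel

/-- The free resolution of `N`. -/
noncomputable def freeResolution (N : GModule R) : AugSequence N where
  X n := freeCover (syzygy N n)
  d n := (freeCoverMap (syzygy N n)).kernelι.comp (freeCoverMap (syzygy N (n + 1)))
  aug := freeCoverMap N

/-- Precomposition with a surjection does not change the image. This splices the short exact
sequences of syzygies and covers. -/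
theorem exact_comp_of_surjective {A B D E : GModule R} (f : GModuleHom A B) (i : GModuleHom B D)
    (g : GModuleHom D E) {X : C} (hf : Function.Surjective (f.app X))
    (h : Function.Exact (i.app X) (g.app X)) : Function.Exact ((i.comp f).app X) (g.app X) := by
  intro y
  refine (h y).trans ⟨?_, ?_⟩
  · rintro ⟨x, rfl⟩
    obtain ⟨w, rfl⟩ := hf x
    exact ⟨w, rfl⟩
  · rintro ⟨w, rfl⟩
    exact ⟨f.app X w, rfl⟩

theorem freeResolution_isProjectiveResolution (N : GModule R) :
    (freeResolution N).IsProjectiveResolution where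
  projective _ := isProjective_freeModule _
  surjective := freeCoverMap_surjective N
  exact_zero Y := exact_comp_of_surjective _ _ _ (freeCoverMap_surjective _ Y)
    ((freeCoverMap N).exact_kernelι Y)
  exact_succ n Y := by
    have h := exact_comp_of_surjective _ _ _ (freeCoverMap_surjective (syzygy N (n + 2)) Y)
      ((freeCoverMap (syzygy N (n + 1))).exact_kernelι Y)
    intro y
    -- The differential `d n` is a cover followed by the inclusion of a syzygy. The inclusion is
    -- injective, so its kernel is the kernel of the cover.
    refine Iff.trans ?_ (h y)
    exact ⟨fun hy => Subtype.ext hy, fun hy => congrArg Subtype.val hy⟩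

/-! ### Chain maps and homotopies between projective resolutions -/

variable {N : GModule R} {P Q : AugSequence N}

/-- The comparison theorem: existence of chain maps between projective resolutions. -/
theorem AugSequence.IsProjectiveResolution.exists_hom (hP : P.IsProjectiveResolution)
    (hQ : Q.IsProjectiveResolution) : Nonempty (P.Hom Q) := by
  -- The invariant carried along the recursion: the next map exists as soon as `f ∘ d` lands in the
  -- image of `Q.d n`. Including it in the type makes the choice in one degree depend only on the
  -- map in the degree before.
  let T : ℕ → Type u := fun n => {f : GModuleHom (P.X n) (Q.X n) //
    ∀ Y (x : (P.X (n + 1)).obj Y), ∃ y, (Q.d n).app Y y = f.app Y ((P.d n).app Y x)}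
  obtain ⟨f₀, hf₀⟩ := (hP.projective 0).exists_lift P.aug Q.aug
    fun Y x => hQ.surjective Y (P.aug.app Y x)
  have start : ∃ f : T 0, ∀ Y x, Q.aug.app Y (f.1.app Y x) = P.aug.app Y x := by
    refine ⟨⟨f₀, fun Y x => (hQ.exact_zero Y _).1 ?_⟩, hf₀⟩
    rw [hf₀, (hP.exact_zero Y).apply_apply_eq_zero]
  have step : ∀ n (f : T n), ∃ f' : T (n + 1), ∀ Y x,
      (Q.d n).app Y (f'.1.app Y x) = f.1.app Y ((P.d n).app Y x) := by
    rintro n ⟨f, hf⟩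
    obtain ⟨f', hf'⟩ := (hP.projective (n + 1)).exists_lift (f.comp (P.d n)) (Q.d n) hf
    refine ⟨⟨f', fun Y x => (hQ.exact_succ n Y _).1 ?_⟩, hf'⟩
    -- The new map sends boundaries to cycles because `d ∘ d = 0` in `P`, and cycles are boundaries
    -- in `Q`.
    refine (hf' Y _).trans ?_
    refine (congrArg (f.app Y) ((hP.exact_succ n Y).apply_apply_eq_zero x)).trans (map_zero _)
  obtain ⟨s, hs⟩ := start
  choose next hnext using step
  let F : ∀ n, T n := fun n => Nat.rec s next n
  exact ⟨⟨fun n => (F n).1, fun n Y x => (hnext n (F n) Y x).symm, hs⟩⟩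

/-- A chain homotopy between two chain maps over the same map. -/
structure AugSequence.Homotopy (f g : P.Hom Q) where
  s : ∀ n, GModuleHom (P.X n) (Q.X (n + 1))
  zero : ∀ Y x, (f.f 0).app Y x = (g.f 0).app Y x + (Q.d 0).app Y ((s 0).app Y x)
  succ : ∀ n Y x, (f.f (n + 1)).app Y x = (g.f (n + 1)).app Y x +
    ((Q.d (n + 1)).app Y ((s (n + 1)).app Y x) + (s n).app Y ((P.d n).app Y x))

/-- The homotopy is built by recursion: `f - g - s ∘ d` takes values in cycles, which are boundaries
since `Q` is exact, and it then lifts through the next differential by projectivity. In degree zero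
`f - g` is killed by the augmentation, both maps lying over the identity of `N`. -/
theorem AugSequence.IsProjectiveResolution.exists_homotopy (hP : P.IsProjectiveResolution)
    (hQ : Q.IsProjectiveResolution) (f g : P.Hom Q) :
    Nonempty (AugSequence.Homotopy f g) := by
  -- The recursion only needs the homotopy relation on boundaries, where the term `s ∘ d` has
  -- disappeared. This is what makes `f - g - s ∘ d` a cycle in the next degree.
  let T : ℕ → Type u := fun n => {s : GModuleHom (P.X n) (Q.X (n + 1)) //
    ∀ Y (x : (P.X (n + 1)).obj Y), (Q.d n).app Y (s.app Y ((P.d n).app Y x)) =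
      (f.f n).app Y ((P.d n).app Y x) - (g.f n).app Y ((P.d n).app Y x)}
  have start : ∃ s : T 0, ∀ Y x, (Q.d 0).app Y (s.1.app Y x) =
      (f.f 0).app Y x - (g.f 0).app Y x := by
    obtain ⟨s, hs⟩ := (hP.projective 0).exists_lift ((f.f 0).sub (g.f 0)) (Q.d 0)
      (fun Y x => (hQ.exact_zero Y _).1 (by
        refine (map_sub (Q.aug.app Y) _ _).trans ?_
        rw [f.aug_comm, g.aug_comm, sub_self]))
    exact ⟨⟨s, fun Y x => hs Y _⟩, hs⟩
  have step : ∀ n (s : T n), ∃ s' : T (n + 1), ∀ Y x,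
      (Q.d (n + 1)).app Y (s'.1.app Y x) = (f.f (n + 1)).app Y x - (g.f (n + 1)).app Y x -
        s.1.app Y ((P.d n).app Y x) := by
    rintro n ⟨s, hs⟩
    obtain ⟨s', hs'⟩ := (hP.projective (n + 1)).exists_lift
      (((f.f (n + 1)).sub (g.f (n + 1))).sub (s.comp (P.d n))) (Q.d (n + 1))
      (fun Y x => (hQ.exact_succ n Y _).1 (by
        refine (map_sub ((Q.d n).app Y) _ _).trans ?_
        refine (congrArg₂ (· - ·) (map_sub ((Q.d n).app Y) _ _) (hs Y x)).trans ?_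
        rw [f.comm, g.comm, sub_self]))
    refine ⟨⟨s', fun Y x => (hs' Y _).trans ?_⟩, hs'⟩
    -- On boundaries the correction term involves `d ∘ d = 0`, so the new component satisfies the
    -- same invariant.
    have e : s.app Y ((P.d n).app Y ((P.d (n + 1)).app Y x)) = 0 :=
      (congrArg (s.app Y) ((hP.exact_succ n Y).apply_apply_eq_zero x)).trans (map_zero _)
    exact (congrArg _ e).trans (sub_zero _)
  obtain ⟨s, hs⟩ := start
  choose next hnext using step
  let F : ∀ n, T n := fun n => Nat.rec s next n
  refine ⟨⟨fun n => (F n).1, fun Y x => ?_, fun n Y x => ?_⟩⟩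
  · exact (sub_eq_iff_eq_add'.1 (hs Y x).symm)
  · exact sub_eq_iff_eq_add'.1 (sub_eq_iff_eq_add.1 (hnext n (F n) Y x).symm)

/-- Composition of chain maps. -/
def AugSequence.Hom.comp {L : AugSequence N} (g : Q.Hom L) (f : P.Hom Q) : P.Hom L where
  f n := (g.f n).comp (f.f n)
  comm n Y x := (congrArg ((g.f n).app Y) (f.comm n Y x)).trans (g.comm n Y _)
  aug_comm Y x := (g.aug_comm Y _).trans (f.aug_comm Y x)

/-- The identity chain map. -/
def AugSequence.Hom.id (P : AugSequence N) : P.Hom P where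
  f n := GModuleHom.id (P.X n)
  comm _ _ _ := rfl
  aug_comm _ _ := rfl

end Resolutions

/-! ## The comparison of box products along a morphism of Green functors -/

section BoxChange

variable {C : Type u} [Category.{u} C] [HasFiniteLimits C] [FinitaryExtensive C]
  {R S : GreenFunctor C} (φ : GreenHom R S) (M : RightGModule S) (N : GModule R)

/-- The pairing `(m, s ⊗ n) ↦ m s ⊗ n` at one level, as a function of the second variable. -/
noncomputable def boxUnchangeAct {X : C} (m : M.obj X) :
    Box (rightVia φ) N X →+ Box (M.restrict φ.op) N X :=
  Box.lift (A := Box (M.restrict φ.op) N X)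
    (fun {Y} f s n => Box.mk (M.restrict φ.op) N f (S.toOp s • M.res f m : M.obj Y) n)
    { add_left := fun {Y} f s t n => by
        refine Eq.trans ?_ (Box.mk_add_left f _ _ n)
        exact congrArg (fun t => Box.mk (M.restrict φ.op) N f t n)
          (add_smul (S.toOp s) (S.toOp t) (M.res f m))
      add_right := fun _ _ _ _ => Box.mk_add_right _ _ _ _
      tr_left := fun {Y Z} h f s n => by
        refine Eq.trans ?_ (Box.mk_tr_left (M := M.restrict φ.op) (N := N) h f _ n)
        refine congrArg (fun t => Box.mk (M.restrict φ.op) N f t n) ?_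
        rw [M.isMackey.res_comp]
        exact M.tr_smul h (S.toOp s) (M.res f m)
      tr_right := fun {Y Z} h f s n => by
        refine (Box.mk_tr_right (M := M.restrict φ.op) (N := N) h f _ n).trans ?_
        refine congrArg (fun t => Box.mk (M.restrict φ.op) N (h ≫ f) t n) ?_
        rw [M.isMackey.res_comp]
        exact M.res_smul h (S.toOp s) (M.res f m)
      balanced := fun {Y} f r s n => by
        refine Eq.trans ?_ (Box.mk_balanced (M := M.restrict φ.op) (N := N) f r _ n)
        exact congrArg (fun t => Box.mk (M.restrict φ.op) N f t n)
          (mul_smul (S.toOp (φ.app Y r)) (S.toOp s) (M.res f m)) }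

theorem boxUnchangeAct_mk {X Y : C} (m : M.obj X) (f : Y ⟶ X) (s : (rightVia φ).obj Y)
    (n : N.obj Y) :
    boxUnchangeAct φ M N m (Box.mk (rightVia φ) N f s n) =
      Box.mk (M.restrict φ.op) N f (S.toOp s • M.res f m : M.obj Y) n :=
  Box.lift_mk _ _ _ _ _

/-- The pairing `(m, s ⊗ n) ↦ m s ⊗ n`. -/
noncomputable def boxUnchangePairing :
    BoxPairing M (baseChange φ N) (boxProduct (M.restrict φ.op) N) where
  toFun {X} m z := boxUnchangeAct φ M N m z
  add_left {X} m m' z := by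
    refine Box.hom_congr (boxUnchangeAct φ M N (m + m'))
      (boxUnchangeAct φ M N m + boxUnchangeAct φ M N m') (fun {Y} f s n => ?_) z
    rw [AddMonoidHom.add_apply, boxUnchangeAct_mk, boxUnchangeAct_mk, boxUnchangeAct_mk, map_add,
      smul_add]
    exact Box.mk_add_left _ _ _ _
  add_right m z z' := map_add (boxUnchangeAct φ M N m) z z'
  res {X Y} h m z := by
    refine Box.hom_congr ((Box.res h).comp (boxUnchangeAct φ M N m))
      ((boxUnchangeAct φ M N (M.res h m)).comp (Box.res h)) (fun {Z} f s n => ?_) z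
    have hp := IsPullback.of_hasPullback f h
    rw [AddMonoidHom.comp_apply, AddMonoidHom.comp_apply, boxUnchangeAct_mk, Box.res_mk hp]
    refine (Box.res_mk (M := M.restrict φ.op) (N := N) hp _ n).trans ?_
    refine Eq.trans ?_ (boxUnchangeAct_mk φ M N _ _ _ _).symm
    refine congrArg (fun t => Box.mk (M.restrict φ.op) N _ t _) ?_
    refine (M.res_smul _ (S.toOp s) _).trans ?_
    rw [← M.isMackey.res_comp, ← M.isMackey.res_comp, hp.w]
    rfl
  tr_left {X Y} h m z := by
    refine Box.hom_congr (boxUnchangeAct φ M N (M.tr h m))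
      (((Box.tr h).comp (boxUnchangeAct φ M N m)).comp (Box.res h)) (fun {Z} f s n => ?_) z
    have hp := IsPullback.of_hasPullback f h
    rw [AddMonoidHom.comp_apply, AddMonoidHom.comp_apply, boxUnchangeAct_mk, Box.res_mk hp]
    refine Eq.trans ?_ (congrArg (Box.tr h) (boxUnchangeAct_mk φ M N _ _ _ _).symm)
    -- Restricting the transfer of `m` along `f` is, by base change, a transfer from the pullback.
    -- Frobenius moves `s` inside that transfer, which then slides through the tensor.
    have e := M.smul_tr (pullback.fst f h) (S.toOp (X := Z) s) (M.res (pullback.snd f h) m)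
    rw [← M.isMackey.base_change hp.flip] at e
    refine (congrArg (fun t => Box.mk (M.restrict φ.op) N f t n) e).trans ?_
    refine (Box.mk_tr_left (M := M.restrict φ.op) (N := N) _ _ _ _).trans ?_
    rw [hp.w]
    exact (Box.tr_mk (M := M.restrict φ.op) (N := N) h _ _ _).symm
  tr_right {X Y} h m z := by
    refine Box.hom_congr ((boxUnchangeAct φ M N m).comp (Box.tr h))
      ((Box.tr h).comp (boxUnchangeAct φ M N (M.res h m))) (fun {Z} f s n => ?_) z
    rw [AddMonoidHom.comp_apply, AddMonoidHom.comp_apply, Box.tr_mk, boxUnchangeAct_mk,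
      boxUnchangeAct_mk, M.isMackey.res_comp]
    exact (Box.tr_mk (M := M.restrict φ.op) (N := N) h _ _ _).symm
  balanced {X} t m z := by
    refine Box.hom_congr (boxUnchangeAct φ M N (S.toOp t • m))
      ((boxUnchangeAct φ M N m).comp ((baseChangeOps φ N).act X t)) (fun {Z} f s n => ?_) z
    rw [AddMonoidHom.comp_apply, baseChangeOps_mk, boxUnchangeAct_mk]
    refine Eq.trans ?_ (boxUnchangeAct_mk φ M N _ _ _ _).symm
    refine congrArg (fun t => Box.mk (M.restrict φ.op) N f t n) ?_
    rw [M.res_smul]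
    exact (mul_smul (S.toOp s) (S.toOp (S.res f t)) (M.res f m)).symm

/-- On pure tensors the composite is `m ⊗ n ↦ m ⊗ (1 ⊗ n) ↦ m 1 ⊗ n`. -/
theorem boxUnchange_boxChange {X : C} (z : Box (M.restrict φ.op) N X) :
    (boxUnchangePairing φ M N).lift.app X ((boxChange φ M N).app X z) = z := by
  refine Box.hom_congr (((boxUnchangePairing φ M N).lift.app X).comp ((boxChange φ M N).app X))
    (AddMonoidHom.id _) (fun {Y} f m n => ?_) z
  refine (congrArg ((boxUnchangePairing φ M N).lift.app X) (boxChange_mk φ M N f m n)).trans ?_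
  refine (BoxPairing.lift_mk _ _ _ _).trans ?_
  refine (congrArg (Box.tr f) (boxUnchangeAct_mk φ M N m (𝟙 Y) (1 : S.obj Y) n)).trans ?_
  refine (Box.tr_mk_id f _ n).trans (congrArg (fun t => Box.mk (M.restrict φ.op) N f t n) ?_)
  exact (one_smul (S.op.obj Y) (M.res (𝟙 Y) m)).trans (M.isMackey.res_id m)

/-- Balancing over `S` gives `m ⊗ (s ⊗ n) = m s ⊗ (1 ⊗ n)`. Together with the left inverse this
yields bijectivity without computing the other composite. -/
theorem boxChange_surjective (X : C) : Function.Surjective ((boxChange φ M N).app X) := by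
  suffices h : ((boxChange φ M N).app X).range = ⊤ from AddMonoidHom.range_eq_top.1 h
  refine eq_top_iff.2 fun z _ => ?_
  induction z using Box.induction with
  | zero => exact zero_mem _
  | add a b ha hb => exact add_mem (ha trivial) (hb trivial)
  | neg a ha => exact neg_mem (ha trivial)
  | @mk Y f m w =>
    -- The second factor is itself an element of a box product, so a second induction is run on it
    -- inside a pure tensor.
    have key : ∀ w : Box (rightVia φ) N Y,
        Box.mk M (baseChange φ N) f m w ∈ ((boxChange φ M N).app X).range := by
      intro w
      let mkHom : Box (rightVia φ) N Y →+ Box M (baseChange φ N) X :=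
        AddMonoidHom.mk' (fun w => Box.mk M (baseChange φ N) f m w)
          fun w w' => Box.mk_add_right (M := M) (N := baseChange φ N) f m w w'
      change mkHom w ∈ _
      induction w using Box.induction with
      | zero => rw [map_zero]; exact zero_mem _
      | add a b ha hb => rw [map_add]; exact add_mem ha hb
      | neg a ha => rw [map_neg]; exact neg_mem ha
      | @mk Z g s n =>
        -- The right entry is the transfer along `g` of `s (1 ⊗ n)`. Sliding the transfer out
        -- restricts `m` along `g`, and balancing then moves `s` onto it.
        refine ⟨Box.mk (M.restrict φ.op) N (g ≫ f) (S.toOp s • M.res g m : M.obj Z) n, ?_⟩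
        refine (boxChange_mk φ M N (g ≫ f) _ n).trans ?_
        refine (Box.mk_balanced (M := M) (N := baseChange φ N) (g ≫ f) s _ _).trans ?_
        refine (Box.mk_tr_right (M := M) (N := baseChange φ N) g f m _).symm.trans ?_
        exact congrArg (fun t => Box.mk M (baseChange φ N) f m t)
          (mk_eq_tr_smul_oneTmul φ N g s n).symm
    exact key w

theorem boxChange_bijective (X : C) : Function.Bijective ((boxChange φ M N).app X) :=
  ⟨Function.LeftInverse.injective (boxUnchange_boxChange φ M N), boxChange_surjective φ M N X⟩

end BoxChange

/-! ## Invariance of Tor -/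

section TorInvariance

variable {C : Type u} [Category.{u} C]

/-- A levelwise bijective morphism of Mackey functors is an isomorphism. -/
theorem MackeyHom.isIso_of_bijective {M N : MackeyFunctor C} (φ : MackeyHom M N)
    (h : ∀ X, Function.Bijective (φ.app X)) : φ.IsIso := by
  let e : ∀ X, M.obj X ≃+ N.obj X := fun X => AddEquiv.ofBijective (φ.app X) (h X)
  have he : ∀ X y, φ.app X ((e X).symm y) = y := fun X y => (e X).apply_symm_apply y
  refine ⟨⟨fun X => (e X).symm.toAddMonoidHom, fun {X Y} f y => (h X).1 ?_,
    fun {X Y} f x => (h Y).1 ?_⟩, fun X x => (e X).symm_apply_apply x, he⟩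
  · exact (he X _).trans (((φ.app_res f _).trans (congrArg (N.res f) (he Y y))).symm)
  · exact (he Y _).trans (((φ.app_tr f _).trans (congrArg (N.tr f) (he X x))).symm)

variable [FinitaryExtensive C]

/-- `inj` and `surj` are injectivity and surjectivity on cycles modulo boundaries, spelled out on
elements. In this form no chain map in the opposite direction is required between the box products.
-/
theorem homologyMap_isIso {L M N L' M' N' : MackeyFunctor C} {f : MackeyHom L M}
    {g : MackeyHom M N} {f' : MackeyHom L' M'} {g' : MackeyHom M' N'} (β : MackeyHom M M')
    (hker : ∀ X (m : M.obj X), g.app X m = 0 → g'.app X (β.app X m) = 0)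
    (him : ∀ X (l : L.obj X), ∃ l' : L'.obj X, f'.app X l' = β.app X (f.app X l))
    (inj : ∀ X (m : M.obj X), g.app X m = 0 → (∃ l', f'.app X l' = β.app X m) →
      ∃ l, f.app X l = m)
    (surj : ∀ X (m' : M'.obj X), g'.app X m' = 0 → ∃ m, g.app X m = 0 ∧
      ∃ l', f'.app X l' = m' - β.app X m) :
    (homologyMap (f := f) (g := g) (f' := f') (g' := g') β hker him).IsIso := by
  refine MackeyHom.isIso_of_bijective _ fun X => ⟨?_, ?_⟩
  · refine (injective_iff_map_eq_zero _).2 fun x hx => ?_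
    induction x using QuotientAddGroup.induction_on with
    | H x =>
      obtain ⟨l', hl'⟩ := (QuotientAddGroup.eq_zero_iff _).1 hx
      obtain ⟨l, hl⟩ := inj X x.1 x.2 ⟨l', hl'⟩
      exact (QuotientAddGroup.eq_zero_iff _).2 ⟨l, hl⟩
  · intro y
    induction y using QuotientAddGroup.induction_on with
    | H y =>
      obtain ⟨m, hm, l', hl'⟩ := surj X y.1 y.2
      refine ⟨QuotientAddGroup.mk ⟨m, hm⟩, QuotientAddGroup.eq.2 ⟨l', hl'.trans ?_⟩⟩
      exact (neg_add_eq_sub _ _).symm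

variable [HasFiniteLimits C] {R S : GreenFunctor C}

/-- Functoriality in the form used for commuting squares, which avoids rewriting with composite
morphisms. -/
theorem boxMap_congr (M : RightGModule R) {A B D : GModule R} {f : GModuleHom A B}
    {g : GModuleHom B D} {B' : GModule R} {f' : GModuleHom A B'} {g' : GModuleHom B' D}
    (h : ∀ X x, g.app X (f.app X x) = g'.app X (f'.app X x)) {X : C} (z : Box M A X) :
    (boxMap M g).app X ((boxMap M f).app X z) = (boxMap M g').app X ((boxMap M f').app X z) := by
  refine Box.hom_congr (((boxMap M g).app X).comp ((boxMap M f).app X))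
    (((boxMap M g').app X).comp ((boxMap M f').app X)) (fun {Y} k m n => ?_) z
  rw [AddMonoidHom.comp_apply, AddMonoidHom.comp_apply, boxMap_mk, boxMap_mk, boxMap_mk,
    boxMap_mk, h]

theorem boxMap_comp (M : RightGModule R) {A B D : GModule R} (f : GModuleHom A B)
    (g : GModuleHom B D) {X : C} (z : Box M A X) :
    (boxMap M (g.comp f)).app X z = (boxMap M g).app X ((boxMap M f).app X z) := by
  refine Box.hom_congr ((boxMap M (g.comp f)).app X)
    (((boxMap M g).app X).comp ((boxMap M f).app X)) (fun {Y} k m n => ?_) z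
  rw [AddMonoidHom.comp_apply, boxMap_mk, boxMap_mk, boxMap_mk]
  rfl

theorem boxMap_id (M : RightGModule R) (A : GModule R) {X : C} (z : Box M A X) :
    (boxMap M (GModuleHom.id A)).app X z = z :=
  Box.hom_congr ((boxMap M (GModuleHom.id A)).app X) (AddMonoidHom.id _)
    (fun _ _ _ => boxMap_mk _ _ _ _ _) z

/-! ### Chain maps and homotopies after boxing -/

section Homotopy

variable {N : GModule R} {P Q : AugSequence N} (M : RightGModule R)

theorem AugSequence.Hom.boxMap_comm (f : P.Hom Q) (n : ℕ) {X : C} (z : Box M (P.X (n + 1)) X) :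
    (boxMap M (f.f n)).app X ((boxMap M (P.d n)).app X z) =
      (boxMap M (Q.d n)).app X ((boxMap M (f.f (n + 1))).app X z) :=
  boxMap_congr M (f.comm n) z

theorem AugSequence.Homotopy.boxMap_zero {f g : P.Hom Q} (s : AugSequence.Homotopy f g) {X : C}
    (z : Box M (P.X 0) X) :
    (boxMap M (f.f 0)).app X z =
      (boxMap M (g.f 0)).app X z + (boxMap M (Q.d 0)).app X ((boxMap M (s.s 0)).app X z) := by
  refine Box.hom_congr ((boxMap M (f.f 0)).app X)
    ((boxMap M (g.f 0)).app X + ((boxMap M (Q.d 0)).app X).comp ((boxMap M (s.s 0)).app X))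
    (fun {Y} k m n => ?_) z
  rw [AddMonoidHom.add_apply, AddMonoidHom.comp_apply, boxMap_mk, boxMap_mk, boxMap_mk, boxMap_mk,
    s.zero, Box.mk_add_right]

/-- The relation `f = g + d s + s d` survives boxing since tensors are additive in the right entry.
On a cycle the last term vanishes, so positive degrees take the same shape as degree zero. -/
theorem AugSequence.Homotopy.boxMap_succ {f g : P.Hom Q} (s : AugSequence.Homotopy f g) (n : ℕ)
    {X : C} (z : Box M (P.X (n + 1)) X) (hz : (boxMap M (P.d n)).app X z = 0) :
    (boxMap M (f.f (n + 1))).app X z = (boxMap M (g.f (n + 1))).app X z +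
      (boxMap M (Q.d (n + 1))).app X ((boxMap M (s.s (n + 1))).app X z) := by
  have h : (boxMap M (f.f (n + 1))).app X z = (boxMap M (g.f (n + 1))).app X z +
      ((boxMap M (Q.d (n + 1))).app X ((boxMap M (s.s (n + 1))).app X z) +
        (boxMap M (s.s n)).app X ((boxMap M (P.d n)).app X z)) := by
    refine Box.hom_congr ((boxMap M (f.f (n + 1))).app X)
      ((boxMap M (g.f (n + 1))).app X +
        (((boxMap M (Q.d (n + 1))).app X).comp ((boxMap M (s.s (n + 1))).app X) +
          ((boxMap M (s.s n)).app X).comp ((boxMap M (P.d n)).app X)))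
      (fun {Y} k m x => ?_) z
    rw [AddMonoidHom.add_apply, AddMonoidHom.add_apply, AddMonoidHom.comp_apply,
      AddMonoidHom.comp_apply, boxMap_mk, boxMap_mk, boxMap_mk, boxMap_mk, boxMap_mk, boxMap_mk,
      s.succ, Box.mk_add_right, Box.mk_add_right]
  rw [h, hz, map_zero, add_zero]

end Homotopy

/-- Naturality in `N`: it makes the isomorphisms `boxChange` compatible with the differentials of a
resolution. -/
theorem boxChange_boxMap (φ : GreenHom R S) (M : RightGModule S) {N N' : GModule R}
    (ψ : GModuleHom N N') {X : C} (z : Box (M.restrict φ.op) N X) :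
    (boxChange φ M N').app X ((boxMap (M.restrict φ.op) ψ).app X z) =
      (boxMap M (baseChangeMap φ ψ)).app X ((boxChange φ M N).app X z) := by
  refine Box.hom_congr
    (((boxChange φ M N').app X).comp ((boxMap (M.restrict φ.op) ψ).app X))
    (((boxMap M (baseChangeMap φ ψ)).app X).comp ((boxChange φ M N).app X))
    (fun {Y} f m n => ?_) z
  refine (congrArg ((boxChange φ M N').app X) (boxMap_mk _ ψ f m n)).trans ?_
  refine (boxChange_mk φ M N' f m _).trans (Eq.symm ?_)
  refine (congrArg ((boxMap M (baseChangeMap φ ψ)).app X) (boxChange_mk φ M N f m n)).trans ?_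
  refine (boxMap_mk M (baseChangeMap φ ψ) f m _).trans ?_
  exact congrArg (fun t => Box.mk M (baseChange φ N') f m t) (baseChangeMap_oneTmul φ ψ n)

/-- The comparison map on Tor is an isomorphism as soon as base change takes the given projective
resolution to a projective resolution. -/
theorem torComparison_isIso (φ : GreenHom R S) {N : GModule R} {N' : GModule S}
    (g : GModuleHom (baseChange φ N) N') (M : RightGModule S) {P : AugSequence N}
    {Q : AugSequence N'} (hP : (P.baseChange φ g).IsProjectiveResolution)
    (hQ : Q.IsProjectiveResolution) (h : (P.baseChange φ g).Hom Q) (n : ℕ) :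
    (torComparison φ g M h n).IsIso := by
  -- `k` is a homotopy inverse of `h`: both composites are homotopic to identities, since they are
  -- endomorphisms of projective resolutions over the identity.
  obtain ⟨k⟩ := hQ.exists_hom hP
  obtain ⟨s⟩ := hP.exists_homotopy hP (k.comp h) (AugSequence.Hom.id _)
  obtain ⟨t⟩ := hQ.exists_homotopy hQ (h.comp k) (AugSequence.Hom.id _)
  have hb := fun n X => boxChange_bijective φ M (P.X n) X
  have hc : ∀ n X (z : Box (M.restrict φ.op) (P.X (n + 1)) X),
      (boxChange φ M (P.X n)).app X ((boxMap (M.restrict φ.op) (P.d n)).app X z) =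
        (boxMap M ((P.baseChange φ g).d n)).app X ((boxChange φ M (P.X (n + 1))).app X z) :=
    fun n X z => boxChange_boxMap φ M (P.d n) z
  -- The homotopy relation at the single element is taken as a hypothesis, so that one argument
  -- covers both cases: in degree zero it holds for every element, in positive degrees only for
  -- cycles.
  have inj : ∀ n X (z : Box (M.restrict φ.op) (P.X n) X),
      (boxMap M ((k.comp h).f n)).app X ((boxChange φ M (P.X n)).app X z) =
        (boxMap M ((AugSequence.Hom.id (P.baseChange φ g)).f n)).app X
          ((boxChange φ M (P.X n)).app X z) +
        (boxMap M ((P.baseChange φ g).d n)).app X ((boxMap M (s.s n)).app X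
          ((boxChange φ M (P.X n)).app X z)) →
      (∃ l', (boxMap M (Q.d n)).app X l' =
        ((boxMap M (h.f n)).comp (boxChange φ M (P.X n))).app X z) →
      ∃ l, (boxMap (M.restrict φ.op) (P.d n)).app X l = z := by
    rintro n X z hz ⟨l', hl'⟩
    -- Let `w` be the image of `z` under `boxChange`. From `k h w = w + d s w` and `h w = d l'` one
    -- gets `w = d (k l' - s w)`; the element in parentheses is pulled back along the bijection.
    obtain ⟨l, hl⟩ := (hb (n + 1) X).2 ((boxMap M (k.f (n + 1))).app X l' -
      (boxMap M (s.s n)).app X ((boxChange φ M (P.X n)).app X z))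
    refine ⟨l, (hb n X).1 ?_⟩
    have e2 := boxMap_comp M (h.f n) (k.f n) ((boxChange φ M (P.X n)).app X z)
    have e3 := boxMap_id M ((P.baseChange φ g).X n) ((boxChange φ M (P.X n)).app X z)
    have e4 := (k.boxMap_comm M n l').symm.trans (congrArg ((boxMap M (k.f n)).app X) hl')
    refine (hc n X l).trans ((congrArg _ hl).trans ((map_sub _ _ _).trans ?_))
    exact sub_eq_iff_eq_add.2 (e4.trans <| e2.symm.trans (hz.trans (congrArg (· + _) e3)))
  have surj : ∀ n X (y : Box M (Q.X n) X),
      (boxMap M ((h.comp k).f n)).app X y =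
        (boxMap M ((AugSequence.Hom.id Q).f n)).app X y +
          (boxMap M (Q.d n)).app X ((boxMap M (t.s n)).app X y) →
      ∃ z, (boxChange φ M (P.X n)).app X z = (boxMap M (k.f n)).app X y ∧
        ∃ l', (boxMap M (Q.d n)).app X l' =
          y - ((boxMap M (h.f n)).comp (boxChange φ M (P.X n))).app X z := by
    intro n X y hy
    obtain ⟨z, hz⟩ := (hb n X).2 ((boxMap M (k.f n)).app X y)
    -- The class of `y` comes from `k y`: the relation `h k y = y + d t y` gives `y - h k y = d (-t
    -- y)`.
    refine ⟨z, hz, -(boxMap M (t.s n)).app X y, ?_⟩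
    have e1 : ((boxMap M (h.f n)).comp (boxChange φ M (P.X n))).app X z =
        (boxMap M (h.f n)).app X ((boxMap M (k.f n)).app X y) :=
      congrArg ((boxMap M (h.f n)).app X) hz
    have e2 := boxMap_comp M (k.f n) (h.f n) y
    have e3 := boxMap_id M (Q.X n) y
    rw [e1]
    refine (map_neg _ _).trans ?_
    rw [eq_sub_iff_add_eq, neg_add_eq_iff_eq_add, add_comm]
    exact e2.symm.trans (hy.trans (congrArg (· + _) e3))
  have hτ := torComparison_comm φ M P Q h.f h.comm
  -- In degree zero the outgoing map is zero and every element is a cycle; in positive degrees the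
  -- cycle conditions have to be carried through `boxChange` and `k`.
  cases n with
  | zero =>
    refine homologyMap_isIso _ (fun _ _ _ => rfl) (fun Y z => ⟨_, (hτ 0 Y z).symm⟩)
      (fun X z _ => inj 0 X z (s.boxMap_zero M _)) fun X y _ => ?_
    obtain ⟨z, -, hz⟩ := surj 0 X y (t.boxMap_zero M y)
    exact ⟨z, rfl, hz⟩
  | succ n =>
    refine homologyMap_isIso _
      (fun Y z hz => (hτ n Y z).symm.trans ((congrArg _ hz).trans (map_zero _)))
      (fun Y z => ⟨_, (hτ (n + 1) Y z).symm⟩)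
      (fun X z hz => inj (n + 1) X z (s.boxMap_succ M n _ ?_)) fun X y hy => ?_
    · exact (hc n X z).symm.trans ((congrArg _ hz).trans (map_zero _))
    · obtain ⟨z, hz, hl⟩ := surj (n + 1) X y (t.boxMap_succ M n y hy)
      -- The preimage of `k y` is a cycle because `boxChange` is injective one degree lower and the
      -- chain map `k` preserves cycles.
      refine ⟨z, (hb n X).1 ?_, hl⟩
      refine (hc n X z).trans ((congrArg _ hz).trans ?_)
      refine (k.boxMap_comm M n y).symm.trans ((congrArg _ hy).trans ?_)
      exact (map_zero _).trans (map_zero _).symm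

end TorInvariance

/-! ## The comparison map of an augmented algebra -/

namespace AugmentedAlgebra

variable {C : Type u} [Category.{u} C] [HasFiniteLimits C] [FinitaryExtensive C]
  {K : GreenFunctor C} (R : AugmentedAlgebra K) (E : GreenHom R.toGreen R.env)

/-- The map `R^e → R^e ⊠_R K`, `s ↦ s ⊗ 1`. -/
noncomputable def tmulOne (X : C) : R.env.obj X →+ Box (rightVia E) R.base X :=
  AddMonoidHom.mk' (fun s => Box.mk (rightVia E) R.base (𝟙 X) s (1 : K.obj X))
    fun s t => Box.mk_add_left (M := rightVia E) (N := R.base) (𝟙 X) s t (1 : K.obj X)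

theorem tmulOne_tr {X Y : C} (f : Y ⟶ X) (s : R.env.obj Y) :
    R.tmulOne E X (R.env.tr f s) = Box.mk (rightVia E) R.base f s (1 : K.obj Y) := by
  refine (Box.mk_tr_left (M := rightVia E) (N := R.base) f (𝟙 X) s (1 : K.obj X)).trans ?_
  rw [Category.comp_id]
  exact congrArg (fun k => Box.mk (rightVia E) R.base f s k) (K.res_one f)

/-- The right action of `r` on `R^e` is multiplication by `E(r)`, and `r` acts on `K` through the
augmentation; balancing exchanges the two. -/
theorem mk_mul_one {X Y : C} (f : Y ⟶ X) (s : R.env.obj Y) (r : R.toGreen.obj Y) :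
    Box.mk (rightVia E) R.base f (s * E.app Y r) (1 : K.obj Y) =
      Box.mk (rightVia E) R.base f s (R.aug.app Y r) := by
  refine (Box.mk_balanced (M := rightVia E) (N := R.base) f r s (1 : K.obj Y)).trans ?_
  exact congrArg (fun k => Box.mk (rightVia E) R.base f s k) (mul_one (R.aug.app Y r))

theorem tmulOne_surjective (X : C) : Function.Surjective (R.tmulOne E X) := by
  intro z
  induction z using Box.induction with
  | zero => exact ⟨0, map_zero _⟩
  | add a b ha hb =>
    obtain ⟨a, rfl⟩ := ha
    obtain ⟨b, rfl⟩ := hb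
    exact ⟨a + b, map_add _ _ _⟩
  | neg a ha =>
    obtain ⟨a, rfl⟩ := ha
    exact ⟨-a, map_neg _ _⟩
  | @mk Y f s k =>
    -- Since `ε η = id`, a tensor `s ⊗ k` equals `s E(η(k)) ⊗ 1`. The transfer along `f` is taken in
    -- `R^e`, with which `s ↦ s ⊗ 1` commutes.
    refine ⟨R.env.tr f ((show R.env.obj Y from s) * E.app Y (R.unit.app Y k)), ?_⟩
    refine (R.tmulOne_tr E f _).trans ((R.mk_mul_one E f s _).trans ?_)
    exact congrArg (fun k => Box.mk (rightVia E) R.base f s k) (R.aug_unit Y k)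

/-- A generator `s E(i)` with `ε(i) = 0` satisfies `s E(i) ⊗ 1 = s ⊗ ε(i) = 0`, also after a
transfer. Together with surjectivity this presents the box product as a quotient of `R^e / R^e
E(I)`. -/
theorem tmulOne_eq_zero {X : C} {z : R.env.obj X} (hz : z ∈ R.extendedIdeal E X) :
    R.tmulOne E X z = 0 := by
  suffices h : R.extendedIdeal E X ≤ (R.tmulOne E X).ker from h hz
  refine (AddSubgroup.closure_le _).2 ?_
  rintro _ ⟨Y, f, s, i, hi, rfl⟩
  refine (R.tmulOne_tr E f _).trans ((R.mk_mul_one E f s i).trans ?_)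
  rw [hi]
  have h := Box.mk_add_right (M := rightVia E) (N := R.base) f s (0 : K.obj Y) (0 : K.obj Y)
  have e : (0 : K.obj Y) + 0 = 0 := add_zero 0
  exact (left_eq_add).1 ((congrArg (fun k => Box.mk (rightVia E) R.base f s k) e).symm.trans h)

variable (hE : ∀ X (r : R.toGreen.obj X),
  R.rho.app X (E.app X r) = R.unit.app X (R.aug.app X r))

/-- `s ⊗ 1` goes to `s η(1) = s • 1`, which is how `ρ` is defined. This converts the kernel of `g`
into the kernel of `ρ`. -/
theorem comparison_tmulOne {X : C} (s : R.env.obj X) :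
    (R.comparison E hE).app X (R.tmulOne E X s) = R.rho.app X s := by
  refine (BoxPairing.lift_mk (liftPairing E (R.unitHom E hE)) (𝟙 X) s (1 : K.obj X)).trans ?_
  refine (R.envMod.isMackey.tr_id _).trans ?_
  exact congrArg (fun t : R.envMod.obj X => s • t) (map_one (R.unit.app X))

theorem rho_surjective (X : C) : Function.Surjective (R.rho.app X) := fun r => by
  refine ⟨Box.mk R.rightMod R.op.leftMod (𝟙 X) (show R.toGreen.obj X from r)
    (R.toGreen.toOp 1), (R.rho_mk (𝟙 X) r 1).trans ?_⟩
  exact (R.toGreen.isMackey.tr_id _).trans (mul_one (show R.toGreen.obj X from r))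

/-- The map `R^e ⊠_R K → R` is an isomorphism when the kernel of `R^e → R` is generated by the
image of the augmentation ideal. -/
theorem comparison_bijective
    (hE1 : ∀ X (z : R.env.obj X), R.rho.app X z = 0 ↔ z ∈ R.extendedIdeal E X) (X : C) :
    Function.Bijective ((R.comparison E hE).app X) := by
  constructor
  · refine (injective_iff_map_eq_zero ((R.comparison E hE).app X)).2 fun z hz => ?_
    obtain ⟨s, rfl⟩ := R.tmulOne_surjective E X z
    -- An element `s ⊗ 1` killed by `g` has `ρ(s) = 0`. Then (E.1) places `s` in `R^e E(I)`, so `s ⊗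
    -- 1` was already zero.
    exact R.tmulOne_eq_zero E ((hE1 X s).1 ((R.comparison_tmulOne E hE s).symm.trans hz))
  · intro r
    obtain ⟨s, hs⟩ := R.rho_surjective X r
    exact ⟨R.tmulOne E X s, (R.comparison_tmulOne E hE s).trans hs⟩

end AugmentedAlgebra

end Mackey
-- The main theorem
theorem mainTheorem8 {G : Type u} [Group G] [Finite G]
    (K : Mackey.GreenFunctor (FinGSet G)) (hK : K.IsCommutative)
    (R : Mackey.AugmentedAlgebra K)
    (E : Mackey.GreenHom R.toGreen R.env)
    (hE : ∀ (X : FinGSet G) (r : R.toGreen.obj X),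
      R.rho.app X (E.app X r) = R.unit.app X (R.aug.app X r))
    (hE1 : ∀ (X : FinGSet G) (z : R.env.obj X),
      R.rho.app X z = 0 ↔ z ∈ R.extendedIdeal E X)
    (hE2 : Mackey.IsProjective (Mackey.rightVia E)) :
    (∃ P : Mackey.AugSequence R.base, P.IsProjectiveResolution) ∧
    (∀ P : Mackey.AugSequence R.base, P.IsProjectiveResolution →
      (P.baseChange E (R.comparison E hE)).IsProjectiveResolution) ∧
    ∀ (M : Mackey.Bimodule R.toGAlgebra) (P : Mackey.AugSequence R.base)
      (Q : Mackey.AugSequence R.envMod),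
      P.IsProjectiveResolution → Q.IsProjectiveResolution →
      Nonempty ((P.baseChange E (R.comparison E hE)).Hom Q) ∧
      ∀ (h : (P.baseChange E (R.comparison E hE)).Hom Q) (n : ℕ),
        (Mackey.torComparison E (R.comparison E hE) M.toRightEnv h n).IsIso := by
  -- (E.1) enters only here, to make the augmentation an isomorphism; (E.2) enters only in `hres`,
  -- through flatness. The Tor statement is then formal for an arbitrary right `R^e`-module.
  have hg := R.comparison_bijective E hE hE1
  have hres : ∀ P : Mackey.AugSequence R.base, P.IsProjectiveResolution →
      (P.baseChange E (R.comparison E hE)).IsProjectiveResolution :=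
    fun P hP => hP.baseChange hE2 (R.comparison E hE) hg
  exact ⟨⟨_, Mackey.freeResolution_isProjectiveResolution R.base⟩, hres, fun M P Q hP hQ =>
    ⟨(hres P hP).exists_hom hQ, fun h n =>
      Mackey.torComparison_isIso E (R.comparison E hE) M.toRightEnv (hres P hP) hQ h n⟩⟩
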